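/- Let $Q$ be a commutative noetherian local ring with maximal ideal $\mathfrak m$ that contains a field of characteristic zero, and let $Q\to R$ be a surjective homomorphism of commutative local rings which is Gorenstein of projective dimension $d$, that is, $R$ has finite projective dimension over $Q$, $\operatorname{Ext}^d_Q(R,Q)\cong R$, and $\operatorname{Ext}^i_Q(R,Q)=0$ for $i\neq d$. Assume that $d$ is odd, and let $\varepsilon\colon A\to R$ be the minimal free resolution of $R$ over $Q$, with differential $\partial$. Then the graded $Q$-module $A$ carries an $A_\infty$-algebra structure with $m_1=\partial$, that is, $Q$-linear maps $m_n\colon A^{\otimes n}\to A$ of degree $n-2$ for $n\ge 1$ with $$\sum_{r+s+t=n,\ r,t\ge 0,\ s\ge 1}(-1)^{r+st}\,m_{r+1+t}\bigl(\mathrm{id}^{\otimes r}\otimes m_s\otimes \mathrm{id}^{\otimes t}\bigr)=0\qquad\text{for all } n\ge 1$$ (with the Koszul sign convention), such that the following hold. (1) It has a split unit: there is $1_A\in A_0$ with $m_2(1_A\otimes a)=a=m_2(a\otimes 1_A)$ for all $a\in A$, with $m_n(a_1\otimes\cdots\otimes a_n)=0$ whenever $n>2$ and some $a_i=1_A$,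 and such that $1_A$ is a free generator of a direct summand of the graded $Q$-module $A$. (2) It is cyclic of degree $d$: $A$ is a complex of finitely generated free $Q$-modules, and there is a perfect $Q$-bilinear pairing of complexes $\langle -,-\rangle\colon A\otimes_Q A\to \Sigma^dQ$ such that for all $n\ge 1$ and all homogeneous $a_1,\dots,a_{n+1}\in A$ $$\langle m_n(a_1,\ldots,a_n),a_{n+1}\rangle=(-1)^{n+|a_1|(|a_2|+\cdots+|a_{n+1}|)}\langle m_n(a_2,\ldots,a_{n+1}),a_1\rangle .$$ (3) The map $\varepsilon\colon A\to R$ is a strict quasi-isomorphism of $A_\infty$-algebras, where $R$ is regarded as an $A_\infty$-algebra concentrated in degree $0$ whose only nonzero operation is its product $m_2$: it commutes with all operations, it sends $1_A$ to $1_R$, and it induces an isomorphism on homology. -/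

import Mathlib

open CategoryTheory

universe u v w

noncomputable section

/-! ### `A∞`-algebras -/

/-- The operator `m_{r+1+t} (id^{⊗ r} ⊗ m_s ⊗ id^{⊗ t})` applied to `a 0 ⊗ ⋯ ⊗ a (r+s+t-1)`, where
`a j` has degree `e j`.  The sign is the Koszul sign obtained by moving `m_s`, which has degree
`s - 2`, past the first `r` arguments. -/
def stasheffTerm {Q : Type u} [CommRing Q] {A : Type v} [AddCommGroup A] [Module Q A]
    (m : (n : ℕ) → MultilinearMap Q (fun _ : Fin n => A) A)
    (r s t : ℕ) (a : ℕ → A) (e : ℕ → ℤ) : A :=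
  (((s : ℤ) - 2) * ∑ i ∈ Finset.range r, e i).negOnePow •
    m (r + 1 + t) (fun j =>
      if (j : ℕ) < r then a j
      else if (j : ℕ) = r then m s (fun i => a (r + i))
      else a (j - 1 + s))

/-- An `A∞`-algebra structure on the module `A` graded by the submodules `𝒜 i`, `i : ℤ`
(homological grading).  The operations are `m n` for `n ≥ 1`; there is no operation with zero
inputs, so `m 0` is set to zero.

The arguments `a 0, …, a (n-1)` of the `n`th Stasheff identity are given as the first `n` terms of
a sequence of homogeneous elements, `a i` being homogeneous of degree `e i`. -/
structure AInfinityAlgebra (Q : Type u) [CommRing Q] {A : Type v} [AddCommGroup A] [Module Q A]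
    (𝒜 : ℤ → Submodule Q A) where
  /-- `A` is the direct sum of its homogeneous components. -/
  isInternal : DirectSum.IsInternal 𝒜
  /-- The operations. -/
  m : (n : ℕ) → MultilinearMap Q (fun _ : Fin n => A) A
  m_zero : m 0 = 0
  /-- `m n` has degree `n - 2`. -/
  m_mem : ∀ (n : ℕ), 1 ≤ n → ∀ (a : Fin n → A) (e : Fin n → ℤ), (∀ i, a i ∈ 𝒜 (e i)) →
    m n a ∈ 𝒜 (∑ i, e i + ((n : ℤ) - 2))
  /-- The Stasheff identities
  `∑_{r + s + t = n, s ≥ 1} (-1)^(r + s t) m_{r+1+t} (id^{⊗ r} ⊗ m_s ⊗ id^{⊗ t}) = 0`. -/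
  stasheff : ∀ (n : ℕ), 1 ≤ n → ∀ (a : ℕ → A) (e : ℕ → ℤ), (∀ i, a i ∈ 𝒜 (e i)) →
    ∑ p ∈ Finset.HasAntidiagonal.antidiagonal n,
      ∑ q ∈ Finset.HasAntidiagonal.antidiagonal p.2 with 1 ≤ q.1,
        ((p.1 : ℤ) + q.1 * q.2).negOnePow • stasheffTerm m p.1 q.1 q.2 a e = 0

namespace AInfinityAlgebra

section

variable {Q : Type u} [CommRing Q] {A : Type v} [AddCommGroup A] [Module Q A]
  {𝒜 : ℤ → Submodule Q A}

/-- The differential `∂ = m_1` of an `A∞`-algebra. -/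
def diff (S : AInfinityAlgebra Q 𝒜) : A →ₗ[Q] A :=
  (MultilinearMap.ofSubsingleton Q A A (0 : Fin 1)).symm (S.m 1)

theorem diff_apply (S : AInfinityAlgebra Q 𝒜) (a : A) : S.diff a = S.m 1 (fun _ => a) := rfl

/-- The homology `ker ∂ / im ∂` of the complex `(A, ∂)`. -/
abbrev Homology (S : AInfinityAlgebra Q 𝒜) : Type v :=
  LinearMap.ker S.diff ⧸ (LinearMap.range S.diff).submoduleOf (LinearMap.ker S.diff)

/-- `one` is a strict unit. -/
structure IsStrictUnit (S : AInfinityAlgebra Q 𝒜) (one : A) : Prop where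
  mem : one ∈ 𝒜 0
  one_mul : ∀ a, S.m 2 ![one, a] = a
  mul_one : ∀ a, S.m 2 ![a, one] = a
  higher : ∀ (n : ℕ), 2 < n → ∀ (a : Fin n → A) (i : Fin n), a i = one → S.m n a = 0

/-- `one` is a split unit: it is a strict unit, and it is a free generator of a direct summand of
the graded module `A`.  As `one` has degree zero, the condition is on the component `𝒜 0`. -/
structure IsSplitUnit (S : AInfinityAlgebra Q 𝒜) (one : A) : Prop extends
    S.IsStrictUnit one where
  free : ∀ q : Q, q • one = 0 → q = 0
  split : ∃ N : Submodule Q A, N ≤ 𝒜 0 ∧ Disjoint (Q ∙ one) N ∧ (Q ∙ one) ⊔ N = 𝒜 0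

/-- The pairing `B : A ⊗ A ⟶ Σ^d Q` makes the `A∞`-algebra cyclic of degree `d`. -/
structure IsCyclic (S : AInfinityAlgebra Q 𝒜) (d : ℤ) (B : A →ₗ[Q] A →ₗ[Q] Q) : Prop where
  free : ∀ i, Module.Free Q (𝒜 i)
  finite : ∀ i, Module.Finite Q (𝒜 i)
  /-- `B` is a map of graded modules `A ⊗ A ⟶ Σ^d Q`. -/
  degree : ∀ (i j : ℤ), i + j ≠ d → ∀ a ∈ 𝒜 i, ∀ b ∈ 𝒜 j, B a b = 0
  /-- `B` is a chain map. -/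
  chain : ∀ i, ∀ a ∈ 𝒜 i, ∀ b, B (S.diff a) b + i.negOnePow • B a (S.diff b) = 0
  /-- `B` is perfect. -/
  perfect : ∀ (i j : ℤ), i + j = d → (B.domRestrict₁₂ (𝒜 i) (𝒜 j)).IsPerfPair
  /-- The cyclic symmetry, for `a = (a_1, …, a_{n+1})`. -/
  cyclic : ∀ (n : ℕ), 1 ≤ n → ∀ (a : Fin (n + 1) → A) (e : Fin (n + 1) → ℤ),
    (∀ i, a i ∈ 𝒜 (e i)) →
    B (S.m n (fun i => a i.castSucc)) (a (Fin.last n)) =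
      ((n : ℤ) + e 0 * ∑ i : Fin n, e i.succ).negOnePow • B (S.m n (fun i => a i.succ)) (a 0)

/-- A strict morphism of `A∞`-algebras: a degree zero linear map commuting with all operations. -/
structure StrictHom {B : Type w} [AddCommGroup B] [Module Q B] {ℬ : ℤ → Submodule Q B}
    (S : AInfinityAlgebra Q 𝒜) (T : AInfinityAlgebra Q ℬ) where
  toLinearMap : A →ₗ[Q] B
  map_mem : ∀ i, ∀ a ∈ 𝒜 i, toLinearMap a ∈ ℬ i
  map_m : ∀ (n : ℕ), 1 ≤ n → ∀ a : Fin n → A,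
    toLinearMap (S.m n a) = T.m n (fun i => toLinearMap (a i))

namespace StrictHom

variable {B : Type w} [AddCommGroup B] [Module Q B] {ℬ : ℤ → Submodule Q B}
  {S : AInfinityAlgebra Q 𝒜} {T : AInfinityAlgebra Q ℬ}

theorem map_diff (f : StrictHom S T) (a : A) :
    f.toLinearMap (S.diff a) = T.diff (f.toLinearMap a) :=
  f.map_m 1 le_rfl _

theorem map_ker (f : StrictHom S T) :
    ∀ a ∈ LinearMap.ker S.diff, f.toLinearMap a ∈ LinearMap.ker T.diff := by
  intro a ha
  rw [LinearMap.mem_ker] at ha ⊢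
  rw [← f.map_diff, ha, map_zero]

/-- The map induced on homology. -/
def homologyMap (f : StrictHom S T) : S.Homology →ₗ[Q] T.Homology :=
  Submodule.mapQ _ _ (f.toLinearMap.restrict f.map_ker) (by
    rintro ⟨a, ha⟩ ⟨b, hb⟩
    exact ⟨f.toLinearMap b, by rw [← f.map_diff, hb]; rfl⟩)

/-- The morphism induces an isomorphism on homology. -/
def IsQuasiIso (f : StrictHom S T) : Prop :=
  Function.Bijective f.homologyMap

end StrictHom

end

/-! ### A commutative algebra as an `A∞`-algebra -/

section

variable (Q : Type u) [CommRing Q] (R : Type v) [CommRing R] [Algebra Q R]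

/-- The grading of a module concentrated in degree zero. -/
def degreeZero (R : Type v) [AddCommGroup R] [Module Q R] (i : ℤ) : Submodule Q R :=
  if i = 0 then ⊤ else ⊥

theorem degreeZero_isInternal : DirectSum.IsInternal (degreeZero Q R) := by
  rw [DirectSum.isInternal_submodule_iff_iSupIndep_and_iSup_eq_top]
  constructor
  · intro i
    by_cases hi : i = 0
    · have : (⨆ j, ⨆ (_ : j ≠ i), degreeZero Q R j) = ⊥ := by
        simp only [iSup_eq_bot]
        intro j hj
        simp [degreeZero, show j ≠ 0 from hi ▸ hj]
      rw [this]
      exact disjoint_bot_right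
    · rw [show degreeZero Q R i = ⊥ by simp [degreeZero, hi]]
      exact disjoint_bot_left
  · refine eq_top_iff.2 (le_trans ?_ (le_iSup _ (0 : ℤ)))
    simp [degreeZero]

/-- A commutative `Q`-algebra `R`, viewed as an `A∞`-algebra concentrated in degree zero; the only
nonzero operation is the multiplication `m_2`. -/
def ofAlgebra : AInfinityAlgebra Q (degreeZero Q R) where
  isInternal := degreeZero_isInternal Q R
  m n := if n = 2 then MultilinearMap.mkPiAlgebraFin Q n R else 0
  m_zero := by simp
  m_mem := by
    intro n _ a e ha
    by_cases hn : n = 2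
    · subst hn
      by_cases h0 : e 0 = 0
      · by_cases h1 : e 1 = 0
        · simp [degreeZero, h0, h1]
        · have : a 1 = 0 := by simpa [degreeZero, h1] using ha 1
          simp [this, MultilinearMap.mkPiAlgebraFin_apply, List.ofFn_succ]
      · have : a 0 = 0 := by simpa [degreeZero, h0] using ha 0
        simp [this, MultilinearMap.mkPiAlgebraFin_apply, List.ofFn_succ]
    · simp [hn]
  stasheff := by
    intro n _ a e _
    by_cases hn : n = 3
    · subst hn
      simp only [Finset.sum_filter]
      simp [stasheffTerm, Finset.Nat.antidiagonal_succ, List.ofFn_succ, mul_assoc,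
        MultilinearMap.mkPiAlgebraFin_apply, Int.negOnePow_even 2 even_two]
    · refine Finset.sum_eq_zero fun ⟨r, p⟩ hp => Finset.sum_eq_zero fun ⟨s, t⟩ hq => ?_
      rw [Finset.HasAntidiagonal.mem_antidiagonal] at hp
      rw [Finset.mem_filter, Finset.HasAntidiagonal.mem_antidiagonal] at hq
      simp only at hp hq
      by_cases h : r + 1 + t = 2
      · have hs : s ≠ 2 := by omega
        rw [stasheffTerm, MultilinearMap.map_coord_zero _ (⟨r, by omega⟩ : Fin (r + 1 + t))
          (by simp [hs])]
        simp
      · simp [stasheffTerm, h]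

end

end AInfinityAlgebra

/-! ### The total graded module of a chain complex -/

section

variable {Q : Type u} [CommRing Q]

/-- The direct sum of the terms of a chain complex. -/
abbrev totalModule (C : ChainComplex (ModuleCat.{u} Q) ℕ) : Type u :=
  DirectSum ℕ (fun n => C.X n)

/-- The elements of `totalModule C` that are homogeneous of degree `i`; there are only zero ones
when `i < 0`. -/
def totalGrading (C : ChainComplex (ModuleCat.{u} Q) ℕ) (i : ℤ) :
    Submodule Q (totalModule C) where
  carrier := {x | ∀ n : ℕ, (n : ℤ) ≠ i → x n = 0}
  zero_mem' := fun _ _ => rfl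
  add_mem' := fun {x y} hx hy n hn => by
    rw [DirectSum.add_apply, hx n hn, hy n hn, add_zero]
  smul_mem' := fun q x hx n hn => by
    rw [DirectSum.smul_apply, hx n hn, smul_zero]

/-- The differential of `C` on the direct sum of its terms.  In degree `0` it vanishes, since
`C.d 0 0 = 0`. -/
def totalDiff (C : ChainComplex (ModuleCat.{u} Q) ℕ) : totalModule C →ₗ[Q] totalModule C :=
  DirectSum.toModule Q ℕ (totalModule C) fun n =>
    (DirectSum.lof Q ℕ (fun k => C.X k) (n - 1)) ∘ₗ (C.d n (n - 1)).hom

end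

/-! ### Minimal resolutions and Gorenstein homomorphisms -/

section

variable {Q : Type u} [CommRing Q]

/-- The augmentation `A ⟶ M` of a resolution, on the direct sum of the terms of the resolution:
it is `A_0 ⟶ M` in degree zero, and zero in all other degrees. -/
def totalAugmentation {M : ModuleCat.{u} Q} (P : ProjectiveResolution M) :
    totalModule P.complex →ₗ[Q] M :=
  (P.π.f 0 ≫ (HomologicalComplex.singleObjXSelf (ComplexShape.down ℕ) 0 M).hom).hom ∘ₗ
    DirectSum.component Q ℕ (fun n => P.complex.X n) 0

/-- A resolution over a local ring is a minimal free resolution: its terms are finitely generated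
free modules, and its differential has image in `𝔪 A`, where `𝔪` is the maximal ideal. -/
structure IsMinimalFreeResolution [IsLocalRing Q] {M : ModuleCat.{u} Q}
    (P : ProjectiveResolution M) : Prop where
  free : ∀ n, Module.Free Q (P.complex.X n)
  finite : ∀ n, Module.Finite Q (P.complex.X n)
  minimal : ∀ n, LinearMap.range (P.complex.d (n + 1) n).hom ≤
    IsLocalRing.maximalIdeal Q • (⊤ : Submodule Q (P.complex.X n))

/-- `Q ⟶ R` is a surjective Gorenstein homomorphism of projective dimension `d`: it is surjective,
`R` has finite projective dimension over `Q`, and `Ext^i_Q(R, Q)` is isomorphic to `R` for `i = d`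
and is zero for `i ≠ d`. -/
structure IsSurjectiveGorenstein (Q : Type u) [CommRing Q] (R : Type u) [CommRing R] [Algebra Q R]
    (d : ℕ) : Prop where
  surjective : Function.Surjective (algebraMap Q R)
  finite_projectiveDimension : projectiveDimension (ModuleCat.of Q R) ≠ ⊤
  ext_self : Nonempty (Abelian.Ext (ModuleCat.of Q R) (ModuleCat.of Q Q) d ≃ₗ[Q] R)
  ext_other : ∀ i, i ≠ d → Subsingleton (Abelian.Ext (ModuleCat.of Q R) (ModuleCat.of Q Q) i)

end

end

noncomputable section

/-! On the suspension of `A`, an `A∞`-structure is a family of odd operations whose insertion square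
vanishes, and all Koszul signs are carried by one involution `σ`. Given a perfect pairing `ω` on the
suspension, antisymmetric because `d` is odd, a cyclic operation of arity `n` is the same as a
`Q`-valued function on words of length `n + 1` in a homogeneous basis that is invariant under signed
rotation. So the task is to find one function `F` on words that is cyclic, has prescribed values on
pairs (the differential) and on words containing the unit (`IsUnitalForm`), and has zero square.

This is obstruction theory. If the square vanishes up to arity `n`, its part of arity `n + 1` gives
a function on words of length `n + 2` that is cyclic, vanishes on words containing the unit, and is
a cocycle for the dual differential by a Bianchi identity (`insertSum_insertSum`,
`squareForm_cocycle`). Subtracting a cyclic primitive that also vanishes on words containing the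
unit extends the structure by one arity (`IsUnitalForm.exists_step`).

The primitive exists for degree reasons. Since `Ext^i(R, Q) = 0` for `i < d`, the dual of `A` is
exact below degree `d`. Discarding the unit creates one new class, in degree one: the coboundary of
the functional dual to the unit. It has suspended degree two, so on words of length `m` its powers
live in suspended degree `2 m`. The obstruction has suspended degree `d + 4`, which is odd, and
counting degrees keeps its first letter below degree `d`. Hence it bounds (`exists_primitive`), and
averaging over rotations, possible in characteristic zero, makes the primitive cyclic
(`exists_cyclic_primitive`). Non-unit letters have suspended degree at least two, so only finitely
many arities matter.

The pairing comes from a unital product on the resolution satisfying the Leibniz rule, associative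
or not (`exists_product`), composed with a coordinate of `A_d` and symmetrized (`exists_pairing`).
Here `A_0` and `A_d` have rank one because `R` and `Ext^d(R, Q) ≅ R` are cyclic. The resulting chain
map from `A` to its shifted dual is bijective degree by degree, by minimality and Nakayama
(`pairing_bijective`); the start of this induction needs that the annihilator of `Ext^d(R, Q)` lies
in the kernel of `Q → R`.

Finally `mulOp` removes the suspension, and the augmentation is strict because non-unit basis
elements have positive degree. -/

namespace CyclicResolution

/-! ### Sums over splittings of lists -/

section Lists

variable {α M N : Type*} [AddCommMonoid M] [AddCommMonoid N]

/-- The sum of `f y z` over all decompositions `l = y ++ z`. -/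
def splitSum : (List α → List α → M) → List α → M
  | f, [] => f [] []
  | f, v :: l => f [] (v :: l) + splitSum (fun y z => f (v :: y) z) l

/-- The sum of `f (x.map σ ++ β y :: z)` over all decompositions `l = x ++ y ++ z` with `y`
nonempty. -/
def insertSum (σ : α → α) (β : List α → α) : (List α → M) → List α → M
  | _, [] => 0
  | f, v :: l => splitSum (fun y z => f (β (v :: y) :: z)) l +
      insertSum σ β (fun l => f (σ v :: l)) l

theorem splitSum_add (f g : List α → List α → M) (l : List α) :
    splitSum (fun y z => f y z + g y z) l = splitSum f l + splitSum g l := by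
  induction l generalizing f g with
  | nil => rfl
  | cons v l ih => simp only [splitSum, ih]; abel

theorem map_splitSum (φ : M →+ N) (f : List α → List α → M) (l : List α) :
    φ (splitSum f l) = splitSum (fun y z => φ (f y z)) l := by
  induction l generalizing f with
  | nil => rfl
  | cons v l ih => simp only [splitSum, ih, map_add]

theorem splitSum_congr {f g : List α → List α → M} {l : List α}
    (h : ∀ y z, y ++ z = l → f y z = g y z) : splitSum f l = splitSum g l := by
  induction l generalizing f g with
  | nil => exact h _ _ rfl
  | cons v l ih =>
    simp only [splitSum]
    rw [h _ _ rfl, ih fun y z hyz => h _ _ (by simp [hyz])]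

theorem splitSum_eq_zero {f : List α → List α → M} {l : List α}
    (h : ∀ y z, y ++ z = l → f y z = 0) : splitSum f l = 0 := by
  induction l generalizing f with
  | nil => exact h _ _ rfl
  | cons v l ih =>
    simp only [splitSum]
    rw [h _ _ rfl, ih fun y z hyz => h _ _ (by simp [hyz]), zero_add]

theorem splitSum_snoc (f : List α → List α → M) (l : List α) (w : α) :
    splitSum f (l ++ [w]) = splitSum (fun y z => f y (z ++ [w])) l + f (l ++ [w]) [] := by
  induction l generalizing f with
  | nil => rfl
  | cons v l ih => simp only [splitSum, List.cons_append, ih]; abel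

/-- Coassociativity of deconcatenation: both sides sum over all ways to cut the word into three
pieces. -/
theorem splitSum_assoc (h : List α → List α → List α → M) (l : List α) :
    splitSum (fun y r => splitSum (fun y' z => h y y' z) r) l =
      splitSum (fun r z => splitSum (fun y y' => h y y' z) r) l := by
  induction l generalizing h with
  | nil => rfl
  | cons v l ih =>
    simp only [splitSum, splitSum_add]
    rw [ih fun y y' z => h (v :: y) y' z]
    abel

variable (σ : α → α) (β : List α → α)

theorem insertSum_add (f g : List α → M) (l : List α) :
    insertSum σ β (fun l => f l + g l) l = insertSum σ β f l + insertSum σ β g l := by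
  induction l generalizing f g with
  | nil => simp [insertSum]
  | cons v l ih => simp only [insertSum, ih, splitSum_add]; abel

theorem map_insertSum (φ : M →+ N) (f : List α → M) (l : List α) :
    φ (insertSum σ β f l) = insertSum σ β (fun l => φ (f l)) l := by
  induction l generalizing f with
  | nil => simp [insertSum]
  | cons v l ih => simp only [insertSum, ih, map_add, map_splitSum]

theorem insertSum_eq_zero {f : List α → M} {l : List α}
    (h : ∀ x v y z, x ++ v :: y ++ z = l → f (x.map σ ++ β (v :: y) :: z) = 0) :
    insertSum σ β f l = 0 := by
  induction l generalizing f with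
  | nil => rfl
  | cons v l ih =>
    simp only [insertSum]
    rw [splitSum_eq_zero (f := fun y z => f (β (v :: y) :: z))
      fun y z hyz => h [] v y z (by simp [hyz]), ih, zero_add]
    intro x v' y z hl
    exact h (v :: x) v' y z (by simp [← hl])

theorem insertSum_congr {β' : List α → α} {f g : List α → M} {l : List α}
    (h : ∀ x v y z, x ++ v :: y ++ z = l →
      f (x.map σ ++ β (v :: y) :: z) = g (x.map σ ++ β' (v :: y) :: z)) :
    insertSum σ β f l = insertSum σ β' g l := by
  induction l generalizing f g with
  | nil => rfl
  | cons v l ih =>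
    simp only [insertSum]
    rw [splitSum_congr (f := fun y z => f (β (v :: y) :: z))
      (g := fun y z => g (β' (v :: y) :: z)) fun y z hyz => h [] v y z (by simp [hyz]), ih]
    intro x v' y z hl
    exact h (v :: x) v' y z (by simp [← hl])

theorem insertSum_snoc (f : List α → M) (l : List α) (w : α) :
    insertSum σ β f (l ++ [w]) = insertSum σ β (fun l => f (l ++ [w])) l +
      splitSum (fun x y => f (x.map σ ++ [β (y ++ [w])])) l := by
  induction l generalizing f with
  | nil => simp [insertSum, splitSum]
  | cons v l ih =>
    simp only [insertSum, List.cons_append, splitSum_snoc, ih, splitSum, List.map_nil,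
      List.nil_append, List.map_cons]
    abel

/-- The coderivation rule: after an insertion, the new letter lies on one side of the cut. If it
lies on the right, `σ` acts on the whole left piece. -/
theorem insertSum_splitSum (g : List α → List α → M) (l : List α) :
    insertSum σ β (splitSum g) l =
      splitSum (fun y z => insertSum σ β (fun y => g y z) y) l +
      splitSum (fun y z => insertSum σ β (fun z => g (y.map σ) z) z) l := by
  induction l generalizing g with
  | nil => simp [insertSum, splitSum]
  | cons v l ih =>
    simp only [insertSum, splitSum, insertSum_add, ih, splitSum_add, List.map_nil, List.map_cons]
    rw [splitSum_assoc fun y z1 z2 => g (β (v :: y) :: z1) z2]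
    abel

end Lists

/-! ### Multilinear functions of lists -/

section Multi

variable {Q A M : Type*} [CommRing Q] [AddCommGroup A] [Module Q A] [AddCommGroup M] [Module Q M]

variable (Q) in
/-- The function `f` on lists is linear in each entry. -/
def IsMulti (f : List A → M) : Prop :=
  ∀ x z, IsLinearMap Q fun v => f (x ++ v :: z)

theorem IsMulti.cons {f : List A → M} (hf : IsMulti Q f) (v : A) :
    IsMulti Q fun l => f (v :: l) := fun x z => hf (v :: x) z

theorem IsMulti.append_right {f : List A → M} (hf : IsMulti Q f) (r : List A) :
    IsMulti Q fun l => f (l ++ r) := fun x z => by simpa using hf x (z ++ r)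

theorem IsMulti.map {f : List A → M} (hf : IsMulti Q f) (σ : A →ₗ[Q] A) :
    IsMulti Q fun l => f (l.map σ) := fun x z => by
  constructor
  · intro v w; simpa using (hf (x.map σ) (z.map σ)).map_add (σ v) (σ w)
  · intro c v; simpa using (hf (x.map σ) (z.map σ)).map_smul c (σ v)

theorem IsMulti.neg {f : List A → M} (hf : IsMulti Q f) (x z : List A) (v : A) :
    f (x ++ -v :: z) = -f (x ++ v :: z) := (hf x z).map_neg v

theorem IsMulti.zero {f : List A → M} (hf : IsMulti Q f) (x z : List A) :
    f (x ++ 0 :: z) = 0 := (hf x z).map_zero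

theorem IsMulti.comp {N : Type*} [AddCommGroup N] [Module Q N] {f : List A → M}
    (hf : IsMulti Q f) (φ : M →ₗ[Q] N) : IsMulti Q fun l => φ (f l) := fun x z => by
  constructor
  · intro v w; simp only [(hf x z).map_add, map_add]
  · intro c v; simp only [(hf x z).map_smul, map_smul]

theorem isLinearMap_add {f g : A → M} (hf : IsLinearMap Q f) (hg : IsLinearMap Q g) :
    IsLinearMap Q fun v => f v + g v := by
  constructor
  · intro v w; rw [hf.map_add, hg.map_add]; abel
  · intro c v; rw [hf.map_smul, hg.map_smul, smul_add]

theorem isLinearMap_splitSum {f : A → List A → List A → M}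
    (hf : ∀ y z, IsLinearMap Q fun v => f v y z) (l : List A) :
    IsLinearMap Q fun v => splitSum (f v) l := by
  induction l generalizing f with
  | nil => exact hf _ _
  | cons u l ih => exact isLinearMap_add (hf _ _) (ih fun y z => hf (u :: y) z)

theorem isMulti_splitSum {g : List A → List A → M} (h1 : ∀ z, IsMulti Q fun y => g y z)
    (h2 : ∀ y, IsMulti Q (g y)) : IsMulti Q (splitSum g) := by
  intro x z
  induction x generalizing g with
  | nil => exact isLinearMap_add (h2 [] [] z) (isLinearMap_splitSum (fun y r => h1 r [] y) z)
  | cons u x ih =>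
    exact isLinearMap_add (h2 [] (u :: x) z) (ih (fun z => (h1 z).cons u) fun y => h2 (u :: y))

theorem isLinearMap_insertSum (σ : A → A) (β : List A → A) {f : A → List A → M}
    (hf : ∀ y, IsLinearMap Q fun v => f v y) (l : List A) :
    IsLinearMap Q fun v => insertSum σ β (f v) l := by
  induction l generalizing f with
  | nil => exact ⟨fun _ _ => (add_zero _).symm, fun _ _ => (smul_zero _).symm⟩
  | cons u l ih =>
    exact isLinearMap_add (isLinearMap_splitSum (fun y z => hf _) l) (ih fun y => hf _)

theorem isLinearMap_comp {f : A → M} (hf : IsLinearMap Q f) {B : Type*} [AddCommGroup B]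
    [Module Q B] {g : B → A} (hg : IsLinearMap Q g) : IsLinearMap Q fun v => f (g v) := by
  constructor
  · intro v w; rw [hg.map_add, hf.map_add]
  · intro c v; rw [hg.map_smul, hf.map_smul]

theorem isMulti_insertSum (σ : A →ₗ[Q] A) {β : List A → A} (hβ : IsMulti Q β) {f : List A → M}
    (hf : IsMulti Q f) : IsMulti Q (insertSum σ β f) := by
  intro x z
  induction x generalizing f with
  | nil =>
    refine isLinearMap_add (isLinearMap_splitSum (fun y r => ?_) z)
      (isLinearMap_insertSum _ _ (fun y => ?_) z)
    · exact isLinearMap_comp (hf [] r) (hβ [] y)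
    · exact isLinearMap_comp (hf [] y) σ.isLinear
  | cons u x ih =>
    refine isLinearMap_add ?_ (ih (hf.cons (σ u)))
    refine isMulti_splitSum (g := fun y z => f (β (u :: y) :: z)) (fun r a c => ?_)
      (fun y => hf.cons _) x z
    exact isLinearMap_comp (hf [] r) (hβ (u :: a) c)

/-- Inserting an odd operation twice is the same as inserting its square. -/
theorem insertSum_insertSum {σ : A →ₗ[Q] A} {β : List A → A} (hσ : ∀ a, σ (σ a) = a)
    (hβσ : ∀ l : List A, β (l.map σ) = -σ (β l)) {f : List A → M} (hf : IsMulti Q f)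
    (l : List A) :
    insertSum σ β (insertSum σ β f) l = insertSum id (insertSum σ β β) f l := by
  induction l generalizing f with
  | nil => rfl
  | cons v l ih =>
    rw [insertSum]
    conv_lhs => enter [2]; simp only [insertSum]
    rw [insertSum_add, hσ, ih (hf.cons v)]
    rw [insertSum_splitSum]
    rw [insertSum]
    simp only [id]
    rw [← add_assoc]
    congr 1
    simp only [insertSum, splitSum_add]
    -- Two disjoint blocks can be inserted in either order. Since `β` anticommutes with `σ`, the two
    -- orders have opposite signs and cancel, so only nested insertions survive.
    have h1 : ∀ y z : List A, insertSum σ β (fun z => f (β (σ v :: y.map σ) :: z)) z =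
        - insertSum σ β (fun l => f (σ (β (v :: y)) :: l)) z := by
      intro y z
      have := hβσ (v :: y)
      rw [List.map_cons] at this
      rw [this]
      have h2 : ∀ z, f (-σ (β (v :: y)) :: z) = -f (σ (β (v :: y)) :: z) :=
        fun z => hf.neg [] z _
      simp only [h2]
      exact (map_insertSum σ β (-AddMonoidHom.id M) _ _).symm
    have h3 : ∀ φ : List A → List A → M,
        splitSum (fun y z => - φ y z) l = - splitSum φ l := fun φ =>
      (map_splitSum (-AddMonoidHom.id M) _ _).symm
    simp only [h1, h3]
    have h4 : ∀ y z, f ((splitSum (fun y z => β (β (v :: y) :: z)) y +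
        insertSum σ β (fun l => β (σ v :: l)) y) :: z) =
        splitSum (fun y' y'' => f (β (β (v :: y') :: y'') :: z)) y +
        insertSum σ β (fun l => f (β (σ v :: l) :: z)) y := by
      intro y z
      have hz := hf [] z
      have e1 := map_splitSum (hz.mk' _).toAddMonoidHom (fun y z => β (β (v :: y) :: z)) y
      have e2 := map_insertSum σ β (hz.mk' _).toAddMonoidHom (fun l => β (σ v :: l)) y
      have e3 := hz.map_add (splitSum (fun y z => β (β (v :: y) :: z)) y)
        (insertSum σ β (fun l => β (σ v :: l)) y)
      exact e3.trans (congrArg₂ (· + ·) e1 e2)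
    simp only [h4, splitSum_add]
    rw [splitSum_assoc fun y y' z => f (β (β (v :: y) :: y') :: z)]
    abel

end Multi

/-! ### Insertions of single letters and of the full word -/

section

variable {α M : Type*} [AddCommMonoid M]

theorem splitSum_eq_nil_left {f : List α → List α → M} {l : List α}
    (h : ∀ v y z, f (v :: y) z = 0) : splitSum f l = f [] l := by
  cases l with
  | nil => rfl
  | cons v l => rw [splitSum, splitSum_eq_zero fun y z _ => h v y z, add_zero]

theorem splitSum_eq_nil_right {f : List α → List α → M} {l : List α}
    (h : ∀ y v z, f y (v :: z) = 0) : splitSum f l = f l [] := by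
  induction l generalizing f with
  | nil => rfl
  | cons v l ih => rw [splitSum, h, ih fun y v z => h _ _ _, zero_add]

/-- The sum of `f (x.map σ ++ D v :: z)` over all decompositions `l = x ++ v :: z`. -/
def diffSum (σ D : α → α) : (List α → M) → List α → M
  | _, [] => 0
  | f, v :: l => f (D v :: l) + diffSum σ D (fun l => f (σ v :: l)) l

/-- A block with two or more letters shortens the word to a length where `f` vanishes, so only
one-letter blocks contribute. -/
theorem insertSum_eq_diffSum (σ D : α → α) {β : List α → α} (hβ : ∀ v, β [v] = D v)
    {f : List α → M} {l : List α} (hf : ∀ l' : List α, l'.length < l.length → f l' = 0) :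
    insertSum σ β f l = diffSum σ D f l := by
  induction l generalizing f with
  | nil => rfl
  | cons v l ih =>
    rw [insertSum, diffSum, ih fun l' hl' => hf _ (by simpa using hl'), ← hβ]
    cases l with
    | nil => rfl
    | cons u l =>
      rw [splitSum, splitSum_eq_zero (f := fun y z => f (β (v :: u :: y) :: z)), add_zero]
      intro y z hyz
      refine hf _ ?_
      simp [← hyz]

theorem insertSum_eq_of_length {σ : α → α} {γ : List α → α} {f : List α → M} {l : List α}
    (hl : l ≠ []) (hf : ∀ x v y z, x ++ v :: y ++ z = l → (v :: y).length < l.length →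
      f (x.map σ ++ γ (v :: y) :: z) = 0) :
    insertSum σ γ f l = f [γ l] := by
  cases l with
  | nil => exact absurd rfl hl
  | cons v l =>
    rw [insertSum, insertSum_eq_zero, add_zero]
    · have : ∀ y z, y ++ z = l → f (γ (v :: y) :: z) =
          (fun y z => if z = [] then f (γ (v :: y) :: z) else 0) y z := by
        intro y z hyz
        by_cases hz : z = []
        · simp [hz]
        · simp only [hz, if_false]
          refine hf [] v y z (by simp [hyz]) ?_
          have := List.length_pos_iff.2 hz
          simp [← hyz]; omega
      rw [splitSum_congr this, splitSum_eq_nil_right (by simp)]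
      simp
    · intro x v' y z hl'
      exact hf (v :: x) v' y z (by simp [← hl']) (by simp [← hl']; omega)

end

/-! ### The square of a family of operations: Bianchi identity, cyclicity, unit -/

section

variable {Q A M : Type*} [CommRing Q] [AddCommGroup A] [Module Q A] [AddCommGroup M] [Module Q M]

/-- If the Stasheff identities hold in arities below the length of `l`, then the left hand side
of the next one is a cocycle. -/
theorem diff_insertSum {σ D : A →ₗ[Q] A} {β : List A → A} (hσ : ∀ a, σ (σ a) = a)
    (hβσ : ∀ l : List A, β (l.map σ) = -σ (β l)) (hβ : IsMulti Q β) (hD : ∀ v, β [v] = D v)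
    {l : List A} (hl : l ≠ [])
    (h0 : ∀ l' : List A, l'.length < l.length → insertSum σ β β l' = 0) :
    diffSum σ D (insertSum σ β β) l = D (insertSum σ β β l) := by
  rw [← insertSum_eq_diffSum σ D hD h0, insertSum_insertSum hσ hβσ hβ,
    insertSum_eq_of_length hl, hD]
  intro x v y z _ h
  rw [h0 _ h]
  exact hβ.zero _ _

/-- Inner blocks avoiding `v` on the left match those avoiding `w` on the right, by one rotation of
the outer operation. For a block containing `v`, rotate the outer operation, exchange its value with
that of the inner one by antisymmetry, and rotate again. -/
theorem insertSum_cyclic {σ : A →ₗ[Q] A} {β : List A → A} {ω : A →ₗ[Q] A →ₗ[Q] Q}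
    (hσ : ∀ a, σ (σ a) = a) (hβσ : ∀ l : List A, β (l.map σ) = -σ (β l))
    (hω : ∀ x y, ω x y = -ω y x) (hωσ : ∀ x y, ω (σ x) y = -ω x (σ y))
    (hc : ∀ v l w, ω (β (v :: l)) w = ω (β (l ++ [w])) (σ v)) (v : A) (l : List A) (w : A) :
    ω (insertSum σ β β (v :: l)) w = ω (insertSum σ β β (l ++ [w])) v := by
  have e1 : ∀ (x : A) (f : List A → List A → A), ω (splitSum f l) x =
      splitSum (fun y z => ω (f y z) x) l := fun x f =>
    map_splitSum ((LinearMap.flip ω) x).toAddMonoidHom f l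
  have e2 : ∀ (x : A) (f : List A → A), ω (insertSum σ β f l) x =
      insertSum σ β (fun l => ω (f l) x) l := fun x f =>
    map_insertSum σ β ((LinearMap.flip ω) x).toAddMonoidHom f l
  rw [insertSum, insertSum_snoc, map_add, map_add, LinearMap.add_apply, LinearMap.add_apply,
    e1, e1, e2, e2, add_comm]
  congr 1
  · refine insertSum_congr _ _ fun x u y z _ => ?_
    rw [hc, hσ]
  · refine splitSum_congr fun y z _ => ?_
    have e : ω (β (z ++ [w])) (σ (β (v :: y))) = ω (β (v :: y)) (σ (β (z ++ [w]))) := by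
      rw [hω (β (v :: y)), hωσ, neg_neg]
    rw [hc, e, hc]
    have h := hβσ (y.map σ ++ [β (z ++ [w])])
    have h2 : (y.map σ).map σ = y := by
      rw [List.map_map, show (σ ∘ σ : A → A) = id from funext hσ, List.map_id]
    rw [List.map_append, h2, List.map_singleton] at h
    rw [h, map_neg, LinearMap.neg_apply, hωσ, hσ, neg_neg]

/-- Only two terms survive: multiplying the first letter by the unit before applying `β`, and
multiplying the value of `β` by the unit. They cancel because the unit is odd in the suspension. -/
theorem insertSum_unit {σ : A →ₗ[Q] A} {β : List A → A} (hβ : IsMulti Q β) {one : A}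
    (hσ1 : σ one = -one) (h1 : β [one] = 0) (h2 : ∀ v, β [one, v] = v)
    (h3 : ∀ v v' l, β (one :: v :: v' :: l) = 0) (l : List A) :
    insertSum σ β β (one :: l) = 0 := by
  have hn : ∀ l, β (-one :: l) = -β (one :: l) := fun l => hβ.neg [] l one
  rw [insertSum, hσ1]
  cases l with
  | nil => simp only [splitSum, insertSum, h1, add_zero]; exact hβ.zero [] []
  | cons v l =>
    rw [splitSum, insertSum, h1, show β (0 :: v :: l) = 0 from hβ.zero [] (v :: l), zero_add, splitSum_eq_nil_left,
      splitSum_eq_nil_right, insertSum_eq_zero, add_zero, h2, hn, h2, add_neg_cancel]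
    · intro x v' y z _
      rw [hn]
      cases x with
      | nil => simp [h3]
      | cons u x => simp [h3]
    · intro y u z
      rw [hn, h3, neg_zero]
    · intro u y z
      rw [h3]
      exact hβ.zero [] z

end

/-! ### Functions on words in a basis -/

section Ext

variable {Q A E M : Type*} [CommRing Q] [AddCommGroup A] [Module Q A] [AddCommGroup M] [Module Q M]
  [Fintype E]

/-- The multilinear extension of a function on words in a basis. -/
def multiExt (b : Module.Basis E Q A) : (List E → Q) → List A → Q
  | F, [] => F []
  | F, v :: l => ∑ e, b.repr v e * multiExt b (fun w => F (e :: w)) l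

theorem isMulti_multiExt (b : Module.Basis E Q A) (F : List E → Q) :
    IsMulti Q (multiExt b F) := by
  intro x z
  induction x generalizing F with
  | nil =>
    constructor
    · intro v w; simp [multiExt, add_mul, Finset.sum_add_distrib]
    · intro c v; simp [multiExt, mul_assoc, Finset.mul_sum]
  | cons u x ih =>
    constructor
    · intro v w
      simp only [multiExt, List.cons_append, (ih _).map_add, mul_add, Finset.sum_add_distrib]
    · intro c v
      simp only [multiExt, List.cons_append, (ih _).map_smul, Finset.smul_sum, mul_smul_comm]

theorem multiExt_map [DecidableEq E] (b : Module.Basis E Q A) (F : List E → Q) (w : List E) :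
    multiExt b F (w.map b) = F w := by
  induction w generalizing F with
  | nil => rfl
  | cons e w ih => simp [multiExt, ih, Finsupp.single_apply]

omit [Fintype E] in
theorem IsMulti.eq_of_basis (b : Module.Basis E Q A) {f g : List A → M} (hf : IsMulti Q f)
    (hg : IsMulti Q g) (n : ℕ) (h : ∀ w : List E, w.length = n → f (w.map b) = g (w.map b))
    (l : List A) (hl : l.length = n) : f l = g l := by
  induction l generalizing f g n with
  | nil => exact h [] hl
  | cons v l ih =>
    have : (hf [] l).mk' _ = (hg [] l).mk' _ := by
      refine b.ext fun e => ?_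
      refine ih (f := fun l => f (b e :: l)) (g := fun l => g (b e :: l)) (hf.cons _) (hg.cons _)
        l.length (fun w hw => ?_) rfl
      exact h (e :: w) (by simpa [hw] using hl)
    exact LinearMap.congr_fun this v

/-- The operation on functions of words that corresponds to `diffSum`, for a differential with
matrix `D` and signs `s`. -/
def wordDiff (s : E → Q) (D : E → E → Q) : (List E → Q) → List E → Q
  | _, [] => 0
  | F, e :: w => ∑ e', D e e' * F (e' :: w) + s e * wordDiff s D (fun w => F (e :: w)) w

theorem diffSum_map (b : Module.Basis E Q A) {s : E → Q} {D : E → E → Q} {σ δ : A →ₗ[Q] A}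
    (hσ : ∀ e, σ (b e) = s e • b e) (hδ : ∀ e, δ (b e) = ∑ e', D e e' • b e') {f : List A → Q}
    (hf : IsMulti Q f) (w : List E) :
    diffSum σ δ f (w.map b) = wordDiff s D (fun w => f (w.map b)) w := by
  induction w generalizing f with
  | nil => rfl
  | cons e w ih =>
    have e1 : f (δ (b e) :: w.map b) = ∑ e', D e e' * f (b e' :: w.map b) := by
      rw [hδ]
      change ((hf [] (w.map b)).mk' _) _ = _
      simp
    have e2 : diffSum σ δ (fun l => f (σ (b e) :: l)) (w.map b) =
        s e * diffSum σ δ (fun l => f (b e :: l)) (w.map b) := by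
      have : ∀ (c : Q) (g : List A → Q) l, diffSum σ δ (fun l => c * g l) l =
          c * diffSum σ δ g l := by
        intro c g l
        induction l generalizing g with
        | nil => simp [diffSum]
        | cons v l ih => simp only [diffSum, ih, mul_add]
      rw [← this]
      congr 1
      funext l
      rw [hσ]
      exact (hf [] l).map_smul _ _
    rw [List.map_cons, diffSum, wordDiff, e1, e2, ih (hf.cons _)]
    rfl

end Ext

/-! ### The dual differential on functions of words -/

section WordDiff

variable {Q E : Type*} [CommRing Q] [Fintype E] (s : E → Q) (D : E → E → Q)

theorem wordDiff_eq_zero {F : List E → Q} {w : List E}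
    (h : ∀ w' : List E, w'.length = w.length → F w' = 0) : wordDiff s D F w = 0 := by
  induction w generalizing F with
  | nil => rfl
  | cons e w ih =>
    rw [wordDiff, ih fun w' hw' => h _ (by simpa using hw'), mul_zero, add_zero]
    exact Finset.sum_eq_zero fun e' _ => by rw [h _ (by simp), mul_zero]

theorem wordDiff_add (F G : List E → Q) (w : List E) :
    wordDiff s D (fun w => F w + G w) w = wordDiff s D F w + wordDiff s D G w := by
  induction w generalizing F G with
  | nil => simp [wordDiff]
  | cons e w ih => simp only [wordDiff, ih, mul_add, Finset.sum_add_distrib]; ring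

theorem wordDiff_mul (c : Q) (F : List E → Q) (w : List E) :
    wordDiff s D (fun w => c * F w) w = c * wordDiff s D F w := by
  induction w generalizing F with
  | nil => simp [wordDiff]
  | cons e w ih =>
    simp only [wordDiff, ih, mul_add, Finset.mul_sum]
    congr 1
    · exact Finset.sum_congr rfl fun _ _ => by ring
    · ring

theorem wordDiff_sub (F G : List E → Q) (w : List E) :
    wordDiff s D (fun w => F w - G w) w = wordDiff s D F w - wordDiff s D G w := by
  have := wordDiff_add s D F (fun w => (-1) * G w) w
  rw [wordDiff_mul] at this
  simp only [neg_one_mul, ← sub_eq_add_neg] at this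
  exact this

theorem wordDiff_sum {ι : Type*} (t : Finset ι) (F : ι → List E → Q) (w : List E) :
    wordDiff s D (fun w => ∑ i ∈ t, F i w) w = ∑ i ∈ t, wordDiff s D (F i) w := by
  classical
  induction t using Finset.induction_on with
  | empty => simp [wordDiff_eq_zero]
  | insert a t ha ih => simp only [Finset.sum_insert ha, wordDiff_add, ih]

theorem wordDiff_congr {F G : List E → Q} {w : List E}
    (h : ∀ w' : List E, w'.length = w.length → F w' = G w') :
    wordDiff s D F w = wordDiff s D G w := by
  rw [← sub_eq_zero, ← wordDiff_sub]
  exact wordDiff_eq_zero s D fun w' hw' => sub_eq_zero.2 (h w' hw')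

theorem wordDiff_snoc (F : List E → Q) (w : List E) (e : E) :
    wordDiff s D F (w ++ [e]) = wordDiff s D (fun w => F (w ++ [e])) w +
      (w.map s).prod * ∑ e', D e e' * F (w ++ [e']) := by
  induction w generalizing F with
  | nil => simp [wordDiff]
  | cons e1 w ih =>
    simp only [List.cons_append, wordDiff, ih, List.map_cons, List.prod_cons]
    ring

/-- Two steps on the same letter cancel by `hD`; steps on two different letters occur in both orders
with opposite signs by `hs`. -/
theorem wordDiff_wordDiff (hD : ∀ e e'', ∑ e', D e e' * D e' e'' = 0)
    (hs : ∀ e e', D e e' * s e' = - (s e * D e e')) (F : List E → Q) (w : List E) :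
    wordDiff s D (wordDiff s D F) w = 0 := by
  induction w generalizing F with
  | nil => rfl
  | cons e w ih =>
    simp only [wordDiff, wordDiff_add, wordDiff_mul, ih, wordDiff_sum, mul_zero, add_zero,
      mul_add, Finset.sum_add_distrib]
    have h1 : ∑ e', D e e' * ∑ e'', D e' e'' * F (e'' :: w) = 0 := by
      simp only [Finset.mul_sum]
      rw [Finset.sum_comm]
      refine Finset.sum_eq_zero fun e'' _ => ?_
      simp only [← mul_assoc]
      rw [← Finset.sum_mul, hD, zero_mul]
    rw [h1, zero_add, Finset.mul_sum, ← Finset.sum_add_distrib]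
    refine Finset.sum_eq_zero fun e' _ => ?_
    rw [← mul_assoc, hs]
    ring

end WordDiff

/-! ### Primitives of cocycles on words without the unit -/

/-- The matrix of the differential of a finite complex of free modules, whose degree zero part is
generated by a single element, and whose dual is exact in degrees below `d`. -/
structure DualExactComplex (Q E : Type*) [CommRing Q] [Fintype E] where
  /-- The degrees of the basis elements. -/
  deg : E → ℕ
  /-- The matrix of the differential. -/
  D : E → E → Q
  D_deg : ∀ e e', D e e' ≠ 0 → deg e' + 1 = deg e
  D_D : ∀ e e'', ∑ e', D e e' * D e' e'' = 0
  /-- The generator of degree zero. -/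
  one : E
  deg_eq_zero : ∀ e, deg e = 0 ↔ e = one
  /-- The length of the complex. -/
  d : ℕ
  exact : ∀ j < d, ∀ φ : E → Q, (∀ e, deg e ≠ j → φ e = 0) → (∀ e, ∑ e', D e e' * φ e' = 0) →
    ∃ ψ : E → Q, (∀ e, deg e + 1 ≠ j → ψ e = 0) ∧ ∀ e, φ e = ∑ e', D e e' * ψ e'

namespace DualExactComplex

variable {Q E : Type*} [CommRing Q] [Fintype E] (X : DualExactComplex Q E)

/-- The degree in the suspended complex. -/
def sdeg (e : E) : ℕ := X.deg e + 1

/-- The sign of a basis element in the suspended complex. -/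
def s (e : E) : Q := (-1) ^ X.sdeg e

/-- The differential on functions on words. -/
def L (F : List E → Q) (w : List E) : Q := wordDiff X.s X.D F w

/-- The function `F` vanishes on words that contain the unit. -/
def Reduced (F : List E → Q) : Prop := ∀ w, X.one ∈ w → F w = 0

/-- The function `F` vanishes on words whose suspended degree is not `k`. -/
def Hom (F : List E → Q) (k : ℕ) : Prop := ∀ w, F w ≠ 0 → (w.map X.sdeg).sum = k

theorem s_mul_s (e : E) : X.s e * X.s e = 1 := by
  simp [s, ← mul_pow]

theorem D_mul_s (e e' : E) : X.D e e' * X.s e' = -(X.s e * X.D e e') := by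
  by_cases h : X.D e e' = 0
  · simp [h]
  · rw [s, s, sdeg, sdeg, ← X.D_deg e e' h, pow_succ _ (X.deg e' + 1)]
    ring

theorem prod_s (w : List E) : (w.map X.s).prod = (-1) ^ (w.map X.sdeg).sum := by
  induction w with
  | nil => simp
  | cons e w ih => simp [ih, pow_add, s]

theorem L_L (F : List E → Q) (w : List E) : X.L (X.L F) w = 0 :=
  wordDiff_wordDiff _ _ X.D_D X.D_mul_s F w

theorem L_cons (F : List E → Q) (e : E) (w : List E) :
    X.L F (e :: w) = ∑ e', X.D e e' * F (e' :: w) + X.s e * X.L (fun w => F (e :: w)) w := rfl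

variable {X}

/-- This is dual to `∂ 1 = 0`: the row of `D` at the unit vanishes for degree reasons, so the
differential never replaces a unit letter. -/
theorem Reduced.L {F : List E → Q} (hF : X.Reduced F) : X.Reduced (X.L F) := by
  intro w hw
  induction w generalizing F with
  | nil => simp at hw
  | cons e w ih =>
    rw [L_cons]
    by_cases hew : X.one ∈ w
    · rw [ih (fun w hw => hF _ (by simp [hw])) hew, mul_zero, add_zero]
      exact Finset.sum_eq_zero fun e' _ => by rw [hF _ (by simp [hew]), mul_zero]
    · have he : X.one = e := by simpa [hew] using hw
      have h1 : X.L (fun w => F (e :: w)) w = 0 :=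
        wordDiff_eq_zero _ _ fun w' _ => hF _ (by simp [he])
      rw [h1, mul_zero, add_zero]
      refine Finset.sum_eq_zero fun e' _ => ?_
      have : X.D e e' = 0 := by
        by_contra h
        have := X.D_deg _ _ h
        rw [(X.deg_eq_zero e).2 he.symm] at this
        omega
      rw [this, zero_mul]

theorem Hom.L {F : List E → Q} {k : ℕ} (hF : X.Hom F k) : X.Hom (X.L F) (k + 1) := by
  intro w hw
  induction w generalizing F k with
  | nil => exact absurd rfl hw
  | cons e w ih =>
    rw [L_cons] at hw
    by_cases h1 : X.L (fun w => F (e :: w)) w = 0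
    · rw [h1, mul_zero, add_zero] at hw
      obtain ⟨e', -, he'⟩ := Finset.exists_ne_zero_of_sum_ne_zero hw
      have h2 := X.D_deg _ _ (left_ne_zero_of_mul he')
      have h3 := hF _ (right_ne_zero_of_mul he')
      simp only [List.map_cons, List.sum_cons, sdeg] at h3 ⊢
      omega
    · have hk : X.sdeg e ≤ k := by
        by_contra hk
        refine h1 (wordDiff_eq_zero _ _ fun w' _ => ?_)
        by_contra h
        have := hF _ h
        simp only [List.map_cons, List.sum_cons] at this
        omega
      have := ih (F := fun w => F (e :: w)) (k := k - X.sdeg e) (fun w' hw' => by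
        have := hF _ hw'
        simp only [List.map_cons, List.sum_cons] at this
        omega) h1
      simp only [List.map_cons, List.sum_cons]
      omega

theorem Reduced.sub {F G : List E → Q} (hF : X.Reduced F) (hG : X.Reduced G) :
    X.Reduced fun w => F w - G w := fun w hw => by simp only [hF w hw, hG w hw, sub_zero]

theorem Reduced.add {F G : List E → Q} (hF : X.Reduced F) (hG : X.Reduced G) :
    X.Reduced fun w => F w + G w := fun w hw => by simp only [hF w hw, hG w hw, add_zero]

theorem Hom.sub {F G : List E → Q} {k : ℕ} (hF : X.Hom F k) (hG : X.Hom G k) :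
    X.Hom (fun w => F w - G w) k := fun w hw => by
  by_cases h : F w = 0
  · exact hG w fun h' => hw (by simp only [h, h', sub_zero])
  · exact hF w h

theorem Hom.add {F G : List E → Q} {k : ℕ} (hF : X.Hom F k) (hG : X.Hom G k) :
    X.Hom (fun w => F w + G w) k := fun w hw => by
  by_cases h : F w = 0
  · exact hG w fun h' => hw (by simp only [h, h', add_zero])
  · exact hF w h

theorem Hom.sum {ι : Type*} {t : Finset ι} {F : ι → List E → Q} {k : ℕ}
    (hF : ∀ i ∈ t, X.Hom (F i) k) : X.Hom (fun w => ∑ i ∈ t, F i w) k := fun w hw => by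
  obtain ⟨i, hi, h⟩ := Finset.exists_ne_zero_of_sum_ne_zero hw
  exact hF i hi w h

variable (X)

/-- One step of the construction of a primitive: the part of `F` where the first letter has degree
`j` is removed. -/
theorem exists_primitive_step {F : List E → Q} {j k n : ℕ} (hj : 2 ≤ j) (hr : X.Reduced F)
    (hh : X.Hom F (k + 1)) (hF : ∀ e w, w.length = n → j < X.deg e → F (e :: w) = 0)
    (hex : ∀ w : List E, w.length = n → ∃ ψ : E → Q, (∀ e, X.deg e + 1 ≠ j → ψ e = 0) ∧
      ∀ e, X.deg e = j → F (e :: w) = ∑ e', X.D e e' * ψ e') :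
    ∃ G, X.Reduced G ∧ X.Hom G k ∧
      ∀ e w, w.length = n → j ≤ X.deg e → X.L G (e :: w) = F (e :: w) := by
  classical
  -- The middle clause, choosing `ψ = 0` when there is nothing to kill, is what makes the resulting
  -- `G` reduced and homogeneous.
  have h : ∀ w : List E, ∃ ψ : E → Q, (∀ e, X.deg e + 1 ≠ j → ψ e = 0) ∧
      ((∀ e, X.deg e = j → F (e :: w) = 0) → ψ = 0) ∧
      (w.length = n → ∀ e, X.deg e = j → F (e :: w) = ∑ e', X.D e e' * ψ e') := by
    intro w
    by_cases h0 : ∀ e, X.deg e = j → F (e :: w) = 0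
    · exact ⟨0, fun _ _ => rfl, fun _ => rfl, fun _ e he => by simp [h0 e he]⟩
    · by_cases hn : w.length = n
      · obtain ⟨ψ, h1, h2⟩ := hex w hn
        exact ⟨ψ, h1, fun h => absurd h h0, fun _ => h2⟩
      · exact ⟨0, fun _ _ => rfl, fun _ => rfl, fun h => absurd h hn⟩
  choose ψ h1 h2 h3 using h
  refine ⟨fun w => match w with | [] => 0 | e :: w => ψ w e, ?_, ?_, ?_⟩
  · rintro (_ | ⟨e, w⟩) hw
    · rfl
    · rcases List.mem_cons.1 hw with he | he
      · refine h1 w e ?_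
        rw [(X.deg_eq_zero e).2 he.symm]
        omega
      · simp only
        rw [h2 w fun e _ => hr _ (by simp [he])]
        rfl
  · rintro (_ | ⟨e, w⟩) hw
    · exact absurd rfl hw
    · simp only at hw
      have he : X.deg e + 1 = j := by
        by_contra h
        exact hw (h1 w e h)
      obtain ⟨e1, h4, h5⟩ : ∃ e1, X.deg e1 = j ∧ F (e1 :: w) ≠ 0 := by
        by_contra! h
        exact hw (by rw [h2 w h]; rfl)
      have := hh _ h5
      simp only [List.map_cons, List.sum_cons, sdeg] at this ⊢
      omega
  · intro e w hn he
    have h4 : X.L (fun w => ψ w e) w = 0 :=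
      wordDiff_eq_zero _ _ fun w' _ => h1 w' e (by omega)
    rw [L_cons]
    simp only [h4, mul_zero, add_zero]
    rcases he.eq_or_lt with he | he
    · exact (h3 w hn e he.symm).symm
    · rw [hF e w hn he]
      refine Finset.sum_eq_zero fun e' _ => ?_
      by_cases h : X.D e e' = 0
      · rw [h, zero_mul]
      · rw [h1 w e' (by have := X.D_deg _ _ h; omega), mul_zero]

/-- In the cocycle equation at a first letter of degree `j + 1`, the terms differentiating the later
letters vanish by `hF`. What remains says that the degree `j` part of `F` is a cocycle in its first
letter, and dual exactness applies. -/
theorem exists_dual_primitive {F : List E → Q} {j n : ℕ} (hj : j < X.d)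
    (hc : ∀ w, w.length = n + 1 → X.L F w = 0)
    (hF : ∀ e w, w.length = n → j < X.deg e → F (e :: w) = 0) (w : List E) (hw : w.length = n) :
    ∃ ψ : E → Q, (∀ e, X.deg e + 1 ≠ j → ψ e = 0) ∧
      ∀ e, X.deg e = j → F (e :: w) = ∑ e', X.D e e' * ψ e' := by
  classical
  obtain ⟨ψ, h1, h2⟩ := X.exact j hj (fun e => if X.deg e = j then F (e :: w) else 0)
    (fun e he => if_neg he) (fun e => by
      by_cases he : X.deg e = j + 1
      · have h := hc (e :: w) (by simp [hw])
        have h3 : X.L (fun w => F (e :: w)) w = 0 :=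
          wordDiff_eq_zero _ _ fun w' hw' => hF e w' (hw'.trans hw) (by omega)
        rw [L_cons, h3, mul_zero, add_zero] at h
        rw [← h]
        refine Finset.sum_congr rfl fun e' _ => ?_
        by_cases h : X.D e e' = 0
        · simp [h]
        · have := X.D_deg _ _ h
          rw [if_pos (by omega)]
      · refine Finset.sum_eq_zero fun e' _ => ?_
        by_cases h : X.D e e' = 0
        · simp [h]
        · have := X.D_deg _ _ h
          rw [if_neg (by omega), mul_zero])
  exact ⟨ψ, h1, fun e he => by rw [← h2 e, if_pos he]⟩

theorem s_of_deg_one {e : E} (he : X.deg e = 1) : X.s e = 1 := by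
  simp [s, sdeg, he]

/-- The case where the first letter of the words on which `F` does not vanish has degree one. -/
theorem exists_primitive_one {F : List E → Q} {k n : ℕ} (hd : 1 < X.d) (hk : k + 1 ≠ 2 * (n + 1))
    (hr : X.Reduced F) (hh : X.Hom F (k + 1)) (hc : ∀ w, w.length = n + 1 → X.L F w = 0)
    (hF : ∀ e w, w.length = n → 1 < X.deg e → F (e :: w) = 0)
    (ih : ∀ g : List E → Q, X.Reduced g → X.Hom g (k - 1) → (∀ w, w.length = n → X.L g w = 0) →
      ∃ h, X.Reduced h ∧ X.Hom h (k - 2) ∧ (1 < k → ∀ w, w.length = n → X.L h w = g w)) :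
    ∃ G, X.Reduced G ∧ X.Hom G k ∧ ∀ w, w.length = n + 1 → X.L G w = F w := by
  classical
  -- In degree one the dual primitive is a multiple `c` of the functional dual to the unit, which is
  -- not allowed in a reduced `G`. The coefficient, as a function `g` of the remaining word, is
  -- treated instead.
  have h : ∀ w : List E, ∃ c : Q, ((∀ e, X.deg e = 1 → F (e :: w) = 0) → c = 0) ∧
      (w.length = n → ∀ e, X.deg e = 1 → F (e :: w) = X.D e X.one * c) := by
    intro w
    by_cases h0 : ∀ e, X.deg e = 1 → F (e :: w) = 0
    · exact ⟨0, fun _ => rfl, fun _ e he => by simp [h0 e he]⟩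
    · by_cases hn : w.length = n
      · obtain ⟨ψ, h1, h2⟩ := X.exists_dual_primitive hd hc hF w hn
        refine ⟨ψ X.one, fun h => absurd h h0, fun _ e he => ?_⟩
        rw [h2 e he]
        refine Finset.sum_eq_single _ (fun e' _ he' => ?_) (by simp)
        rw [h1 e', mul_zero]
        intro h
        exact he' ((X.deg_eq_zero e').1 (by omega))
      · exact ⟨0, fun _ => rfl, fun h => absurd h hn⟩
  choose g h1 h2 using h
  have hg1 : X.Reduced g := fun w hw => h1 w fun e _ => hr _ (by simp [hw])
  have hg : ∀ w, g w ≠ 0 → (w.map X.sdeg).sum + 1 = k := by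
    intro w hw
    obtain ⟨e, he, h⟩ : ∃ e, X.deg e = 1 ∧ F (e :: w) ≠ 0 := by
      by_contra! h
      exact hw (h1 w h)
    have := hh _ h
    have he' : X.sdeg e = 2 := by simp [sdeg, he]
    simp only [List.map_cons, List.sum_cons, he'] at this
    omega
  have hg2 : X.Hom g (k - 1) := fun w hw => by have := hg w hw; omega
  -- The cocycle equation only gives `D e one * L g w = 0` for all `e`. Exactness in degree zero,
  -- where there are no nonzero coboundaries, removes the factor.
  have hg3 : ∀ w : List E, w.length = n → X.L g w = 0 := by
    intro w hn
    have h3 : ∀ e, X.D e X.one * X.L g w = 0 := by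
      intro e
      by_cases he : X.deg e = 1
      · have h4 := hc (e :: w) (by simp [hn])
        have h5 : X.L (fun w => F (e :: w)) w = X.D e X.one * X.L g w := by
          rw [L, wordDiff_congr X.s X.D fun w' hw' => h2 w' (hw'.trans hn) e he, wordDiff_mul]
          rfl
        have h6 : ∑ e', X.D e e' * F (e' :: w) = 0 := by
          refine Finset.sum_eq_zero fun e' _ => ?_
          by_cases h : X.D e e' = 0
          · rw [h, zero_mul]
          · have := X.D_deg _ _ h
            rw [hr, mul_zero]
            rw [(X.deg_eq_zero e').1 (by omega)]
            simp
        rw [L_cons, h5, h6, zero_add, X.s_of_deg_one he, one_mul] at h4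
        exact h4
      · have : X.D e X.one = 0 := by
          by_contra h
          have := X.D_deg _ _ h
          rw [(X.deg_eq_zero X.one).2 rfl] at this
          omega
        rw [this, zero_mul]
    obtain ⟨ψ, h4, h5⟩ := X.exact 0 (by omega) (fun e => if e = X.one then X.L g w else 0)
      (fun e he => if_neg fun h => he ((X.deg_eq_zero e).2 h)) (fun e => by simpa using h3 e)
    have := h5 X.one
    simpa [h4] using this
  obtain ⟨h, hh1, hh2, hh3⟩ := ih g hg1 hg2 hg3
  -- Here a nonzero `g` would force `k = 1` and `n = 0`: this is the degree one class itself, on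
  -- one-letter words, excluded by `hk`.
  by_cases hk1 : k ≤ 1
  · refine ⟨0, fun _ _ => rfl, fun w hw => absurd rfl hw, ?_⟩
    have hg0 : ∀ w, w.length = n → g w = 0 := by
      intro w hw
      by_contra h
      have h3 := hg w h
      have h4 : w = [] := by
        rcases w with _ | ⟨e, w⟩
        · rfl
        · simp only [List.map_cons, List.sum_cons, sdeg] at h3
          omega
      subst h4
      simp at hw h3
      omega
    rintro (_ | ⟨e, w⟩) hw
    · simp at hw
    · have hw' : w.length = n := by simpa using hw
      rw [show X.L 0 (e :: w) = 0 from wordDiff_eq_zero _ _ fun _ _ => rfl]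
      rcases lt_trichotomy (X.deg e) 1 with he | he | he
      · rw [hr]
        rw [(X.deg_eq_zero e).1 (by omega)]
        simp
      · rw [h2 w hw' e he, hg0 w hw', mul_zero]
      · rw [hF e w hw' he]
  -- With `g = L h`, multiply the degree one cocycle `D e one` by `h`; differentiating the first
  -- letter contributes nothing since `D ∘ D = 0`.
  refine ⟨fun w => match w with | [] => 0 | e :: w => X.D e X.one * h w, ?_, ?_, ?_⟩
  · rintro (_ | ⟨e, w⟩) hw
    · rfl
    · rcases List.mem_cons.1 hw with he | he
      · have : X.D e X.one = 0 := by
          by_contra h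
          have := X.D_deg _ _ h
          rw [← he] at this
          omega
        simp [this]
      · simp [hh1 w he]
  · rintro (_ | ⟨e, w⟩) hw
    · exact absurd rfl hw
    · simp only at hw
      have h3 := X.D_deg _ _ (left_ne_zero_of_mul hw)
      rw [(X.deg_eq_zero X.one).2 rfl] at h3
      have h4 := hh2 _ (right_ne_zero_of_mul hw)
      simp only [List.map_cons, List.sum_cons, sdeg] at h4 ⊢
      omega
  · rintro (_ | ⟨e, w⟩) hw
    · simp at hw
    · have hw' : w.length = n := by simpa using hw
      rw [L_cons]
      have h3 : X.L (fun w => X.D e X.one * h w) w = X.D e X.one * g w := by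
        rw [L, wordDiff_mul, ← hh3 (by omega) w hw']
        rfl
      simp only [h3, ← mul_assoc]
      rw [← Finset.sum_mul, X.D_D, zero_mul, zero_add]
      rcases lt_trichotomy (X.deg e) 1 with he | he | he
      · rw [hr]
        · have : X.D e X.one = 0 := by
            by_contra h
            have := X.D_deg _ _ h
            omega
          rw [this, mul_zero, zero_mul]
        · rw [(X.deg_eq_zero e).1 (by omega)]
          simp
      · rw [h2 w hw' e he, X.s_of_deg_one he, one_mul]
      · have : X.D e X.one = 0 := by
          by_contra h
          have := X.D_deg _ _ h
          rw [(X.deg_eq_zero X.one).2 rfl] at this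
          omega
        rw [hF e w hw' he, this, mul_zero, zero_mul]

/-- Every letter other than the unit has suspended degree at least two. -/
theorem Reduced.two_mul_length_le {X : DualExactComplex Q E} {F : List E → Q} {k : ℕ}
    (hr : X.Reduced F) (hh : X.Hom F k) {w : List E} (hw : F w ≠ 0) : 2 * w.length ≤ k := by
  rw [← hh w hw]
  have h : ∀ e ∈ w.map X.sdeg, 2 ≤ e := by
    intro m hm
    obtain ⟨e, he, rfl⟩ := List.mem_map.1 hm
    have : X.deg e ≠ 0 := fun h => hw (hr w ((X.deg_eq_zero e).1 h ▸ he))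
    simp only [sdeg]
    omega
  have := List.card_nsmul_le_sum _ _ h
  simpa [mul_comm] using this

theorem Reduced.deg_le {X : DualExactComplex Q E} {F : List E → Q} {k : ℕ}
    (hr : X.Reduced F) (hh : X.Hom F k) {e : E} {w : List E} (hw : F (e :: w) ≠ 0) :
    X.deg e + 1 + 2 * w.length ≤ k := by
  have h1 := hh _ hw
  simp only [List.map_cons, List.sum_cons] at h1
  have h2 := Reduced.two_mul_length_le (X := X) (F := fun w => F (e :: w)) (k := k - X.sdeg e)
    (fun w hw => hr _ (by simp [hw]))
    (fun w hw => by have := hh _ hw; simp only [List.map_cons, List.sum_cons] at this; omega) hw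
  simp only [sdeg] at h1 h2
  omega

/-- Outer induction on the length of words, inner induction on a bound `j` for the degree of the
first letter. For `j ≥ 2` dual exactness in the first letter lowers `j`. For `j = 1` the class `D e
one` splits off, which removes one letter and lowers `k` by two. The condition `k + 1 ≠ 2 * n` is
stable under this and excludes products consisting of that class alone. -/
theorem exists_primitive_aux (n : ℕ) : ∀ (j k : ℕ) (F : List E → Q), (j = 0 ∨ j < X.d) →
    k + 1 ≠ 2 * n → k + 2 < 2 * n + X.d → X.Reduced F → X.Hom F (k + 1) → (∀ w, w.length = n → X.L F w = 0) →
    (∀ e w, w.length + 1 = n → j < X.deg e → F (e :: w) = 0) →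
    ∃ G, X.Reduced G ∧ X.Hom G k ∧ ∀ w, w.length = n → X.L G w = F w := by
  induction n with
  | zero =>
    intro j k F _ _ _ _ hh _ _
    refine ⟨0, fun _ _ => rfl, fun w hw => absurd rfl hw, ?_⟩
    intro w hw
    obtain rfl : w = [] := List.length_eq_zero_iff.1 hw
    by_contra h
    have := hh [] fun h' => h (h'.symm ▸ rfl)
    simp at this
  | succ n ih =>
    intro j
    induction j with
    | zero =>
      intro k F _ _ _ hr _ _ hF
      refine ⟨0, fun _ _ => rfl, fun w hw => absurd rfl hw, ?_⟩
      rintro (_ | ⟨e, w⟩) hw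
      · simp at hw
      · rw [show X.L 0 (e :: w) = 0 from wordDiff_eq_zero _ _ fun _ _ => rfl]
        rcases Nat.eq_zero_or_pos (X.deg e) with he | he
        · rw [hr]
          rw [(X.deg_eq_zero e).1 he]
          simp
        · rw [hF e w (by simpa using hw) he]
    | succ j ihj =>
      intro k F hj hk hb hr hh hc hF
      have hj' : j + 1 < X.d := by omega
      have hF' : ∀ e (w : List E), w.length = n → j + 1 < X.deg e → F (e :: w) = 0 :=
        fun e w hw => hF e w (by omega)
      rcases Nat.eq_zero_or_pos j with rfl | hj0
      · refine X.exists_primitive_one hj' hk hr hh hc hF' fun g hg1 hg2 hg3 => ?_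
        by_cases hk1 : 1 < k
        · have hg4 : ∀ e (w : List E), w.length + 1 = n → X.d - 1 < X.deg e → g (e :: w) = 0 := by
            intro e w hw he
            by_contra h
            have := hg1.deg_le hg2 h
            omega
          obtain ⟨h, h1, h2, h3⟩ := ih (X.d - 1) (k - 2) g (by omega) (by omega) (by omega) hg1
            (by rwa [show k - 2 + 1 = k - 1 by omega]) hg3 hg4
          exact ⟨h, h1, h2, fun _ => h3⟩
        · exact ⟨0, fun _ _ => rfl, fun w hw => absurd rfl hw, fun h => absurd h hk1⟩
      · obtain ⟨G1, h1, h2, h3⟩ := X.exists_primitive_step (j := j + 1) (by omega) hr hh hF'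
          (X.exists_dual_primitive hj' hc hF')
        obtain ⟨G2, h4, h5, h6⟩ := ihj k (fun w => F w - X.L G1 w) (by omega) hk hb
          (hr.sub h1.L) (hh.sub h2.L)
          (fun w hw => by rw [L, wordDiff_sub]; exact (sub_eq_zero.2 ((hc w hw).trans (X.L_L _ _).symm)))
          (fun e w hw he => by rw [h3 e w (by omega) (by omega), sub_self])
        refine ⟨fun w => G1 w + G2 w, h1.add h4, h2.add h5, fun w hw => ?_⟩
        have := h6 w hw
        rw [L, wordDiff_add]
        change X.L G1 w + X.L G2 w = _
        rw [this]
        ring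

/-- By `hb`, a word of length `n` on which `F` is nonzero has a first letter of degree below `X.d`,
since each other letter takes up at least two. So the induction can start at `j = X.d - 1`. -/
theorem exists_primitive {n k : ℕ} {F : List E → Q} (hk : k + 1 ≠ 2 * n)
    (hb : k + 2 < 2 * n + X.d) (hr : X.Reduced F) (hh : X.Hom F (k + 1))
    (hc : ∀ w, w.length = n → X.L F w = 0) :
    ∃ G, X.Reduced G ∧ X.Hom G k ∧ ∀ w, w.length = n → X.L G w = F w := by
  refine X.exists_primitive_aux n (X.d - 1) k F (by omega) hk hb hr hh hc fun e w hw he => ?_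
  by_contra h
  have := hr.deg_le hh h
  omega

end DualExactComplex

/-! ### Cyclic rotation and averaging -/

namespace DualExactComplex

variable {Q E : Type*} [CommRing Q] [Fintype E] (X : DualExactComplex Q E)

/-- The signed cyclic rotation of a function on words. -/
def rotate (F : List E → Q) : List E → Q
  | [] => F []
  | e :: w => X.s e * F (w ++ [e])

theorem Hom.rotate {X : DualExactComplex Q E} {F : List E → Q} {k : ℕ} (hF : X.Hom F k) :
    X.Hom (X.rotate F) k := by
  rintro (_ | ⟨e, w⟩) hw
  · exact hF _ hw
  · have := hF _ (right_ne_zero_of_mul hw)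
    simpa [add_comm] using this

theorem Reduced.rotate {X : DualExactComplex Q E} {F : List E → Q} (hF : X.Reduced F) :
    X.Reduced (X.rotate F) := by
  rintro (_ | ⟨e, w⟩) hw
  · exact hF _ hw
  · exact mul_eq_zero_of_right _ (hF _ (by simpa [or_comm] using hw))

/-- In even degree the total sign of a word in the support of `F` is `1`. Hence the sign collected
while passing all other letters equals the sign of the moved letter. -/
theorem L_rotate {F : List E → Q} {k : ℕ} (hk : Even k) (hF : X.Hom F k) (e : E) (w : List E) :
    X.L (X.rotate F) (e :: w) = X.L F (w ++ [e]) := by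
  rw [L_cons, L.eq_1 X F, wordDiff_snoc]
  simp only [rotate]
  rw [L, wordDiff_mul, ← mul_assoc, s_mul_s, one_mul, add_comm, Finset.mul_sum]
  congr 1
  refine Finset.sum_congr rfl fun e' _ => ?_
  by_cases h : F (w ++ [e']) = 0
  · simp [h]
  · have h1 := hF _ h
    have h2 : (w.map X.s).prod * X.s e' = 1 := by
      have h3 := X.prod_s (w ++ [e'])
      rw [h1, hk.neg_one_pow] at h3
      simpa using h3
    have h3 : (w.map X.s).prod = X.s e' := by
      rw [← mul_one (w.map X.s).prod, ← X.s_mul_s e', ← mul_assoc, h2, one_mul]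
    rw [h3]
    ring

theorem iterate_rotate (F : List E → Q) (u v : List E) :
    (X.rotate^[u.length]) F (u ++ v) = (u.map X.s).prod * F (v ++ u) := by
  induction u generalizing v with
  | nil => simp
  | cons e u ih =>
    rw [List.length_cons, Function.iterate_succ_apply', List.cons_append, rotate, List.append_assoc,
      ih]
    simp [mul_assoc]

theorem iterate_rotate_length {F : List E → Q} {k : ℕ} (hk : Even k) (hF : X.Hom F k)
    (w : List E) : (X.rotate^[w.length]) F w = F w := by
  have := X.iterate_rotate F w []
  rw [List.append_nil, List.nil_append, prod_s] at this
  rw [this]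
  by_cases h : F w = 0
  · simp [h]
  · rw [hF w h, hk.neg_one_pow, one_mul]

/-- A cyclic primitive of a cyclic cocycle, obtained by averaging. -/
theorem exists_cyclic_primitive (hQ : ∀ n : ℕ, n ≠ 0 → IsUnit (n : Q)) {n k : ℕ} {F : List E → Q}
    (hn : n ≠ 0) (hke : Even k) (hb : k + 2 < 2 * n + X.d) (hr : X.Reduced F)
    (hh : X.Hom F (k + 1)) (hc : ∀ w, w.length = n → X.L F w = 0)
    (hF : ∀ e w, w.length + 1 = n → F (e :: w) = F (w ++ [e])) :
    ∃ G, X.Reduced G ∧ X.Hom G k ∧ (∀ w, w.length ≠ n → G w = 0) ∧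
      (∀ e w, G (e :: w) = X.s e * G (w ++ [e])) ∧ ∀ w, w.length = n → X.L G w = F w := by
  classical
  -- Evenness of `k` enters here: `k + 1` is odd, so it cannot be `2 * n`.
  obtain ⟨G, h1, h2, h3⟩ := X.exists_primitive (n := n) (k := k)
    (by intro h; have := h ▸ hke.add_one; exact Nat.not_odd_iff_even.2 (even_two_mul n) this)
    hb hr hh hc
  obtain ⟨c, hc⟩ := (hQ n hn).exists_left_inv
  have h4 : ∀ j, X.Reduced (X.rotate^[j] G) ∧ X.Hom (X.rotate^[j] G) k ∧
      ∀ w, w.length = n → X.L (X.rotate^[j] G) w = F w := by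
    intro j
    induction j with
    | zero => exact ⟨h1, h2, h3⟩
    | succ j ih =>
      rw [Function.iterate_succ_apply']
      refine ⟨ih.1.rotate, ih.2.1.rotate, ?_⟩
      rintro (_ | ⟨e, w⟩) hw
      · exact absurd hw.symm hn
      · rw [X.L_rotate hke ih.2.1, ih.2.2 _ (by simpa using hw), hF _ _ (by simpa using hw)]
  -- Each rotation of `G` is again a primitive because `F` is cyclic. The sum over all `n` rotations
  -- is invariant since a full turn is the identity in even degree; `c = 1 / n` normalizes it.
  set S : List E → Q := fun w => ∑ j ∈ Finset.range n, X.rotate^[j] G w with hS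
  have h5 : ∀ e w, w.length + 1 = n → S (e :: w) = X.s e * S (w ++ [e]) := by
    intro e w hw
    have h6 : X.s e * S (w ++ [e]) = ∑ j ∈ Finset.range n, X.rotate^[j + 1] G (e :: w) := by
      rw [hS, Finset.mul_sum]
      refine Finset.sum_congr rfl fun j _ => ?_
      rw [Function.iterate_succ_apply']
      rfl
    have h7 := Finset.sum_range_succ (fun j => X.rotate^[j] G (e :: w)) n
    have h8 := Finset.sum_range_succ' (fun j => X.rotate^[j] G (e :: w)) n
    have h9 := X.iterate_rotate_length hke h2 (e :: w)
    rw [List.length_cons, hw] at h9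
    rw [h6]
    rw [h7, h9] at h8
    exact add_right_cancel h8
  refine ⟨fun w => if w.length = n then c * S w else 0, fun w hw => ?_, fun w hw => ?_,
    fun w hw => if_neg hw, fun e w => ?_, fun w hw => ?_⟩
  · simp only [hS]
    rw [Finset.sum_eq_zero fun j _ => (h4 j).1 w hw]
    simp
  · have h6 : S w ≠ 0 := fun h => hw (by simp [h])
    exact Hom.sum (fun j _ => (h4 j).2.1) w h6
  · simp only [List.length_cons, List.length_append, List.length_nil, zero_add]
    by_cases hw : w.length + 1 = n
    · rw [if_pos hw, if_pos hw, h5 e w hw]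
      ring
    · rw [if_neg hw, if_neg hw, mul_zero]
  · rw [L, wordDiff_congr X.s X.D (G := fun w => c * S w) fun w' hw' => if_pos (hw'.trans hw),
      wordDiff_mul, hS, wordDiff_sum,
      Finset.sum_congr rfl fun j _ => show wordDiff X.s X.D _ w = F w from (h4 j).2.2 w hw]
    simp [← mul_assoc, hc]

end DualExactComplex

/-! ### Linearity of insertions in the operation and in the outer function -/

section DiffSum

variable {Q A M N : Type*} [CommRing Q] [AddCommGroup A] [Module Q A] [AddCommGroup M] [Module Q M]
  [AddCommGroup N] [Module Q N]

omit [AddCommGroup A] [Module Q A] in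
theorem map_diffSum (σ D : A → A) (φ : M →ₗ[Q] N) (f : List A → M) (l : List A) :
    φ (diffSum σ D f l) = diffSum σ D (fun l => φ (f l)) l := by
  induction l generalizing f with
  | nil => simp [diffSum]
  | cons v l ih => simp only [diffSum, ih, map_add]

theorem isLinearMap_diffSum (σ D : A → A) {f : A → List A → M}
    (hf : ∀ y, IsLinearMap Q fun v => f v y) (l : List A) :
    IsLinearMap Q fun v => diffSum σ D (f v) l := by
  induction l generalizing f with
  | nil => exact ⟨fun _ _ => (add_zero _).symm, fun _ _ => (smul_zero _).symm⟩
  | cons u l ih => exact isLinearMap_add (hf _) (ih fun y => hf _)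

theorem isMulti_diffSum (σ D : A →ₗ[Q] A) {f : List A → M} (hf : IsMulti Q f) :
    IsMulti Q (diffSum σ D f) := by
  intro x z
  induction x generalizing f with
  | nil =>
    refine isLinearMap_add ?_ (isLinearMap_diffSum _ _ (fun y => ?_) z)
    · exact isLinearMap_comp (hf [] z) D.isLinear
    · exact isLinearMap_comp (hf [] y) σ.isLinear
  | cons u x ih => exact isLinearMap_add (hf.cons (D u) x z) (ih (hf.cons (σ u)))

theorem splitSum_sub {α : Type*} (f g : List α → List α → M) (l : List α) :
    splitSum (fun y z => f y z - g y z) l = splitSum f l - splitSum g l := by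
  have h := splitSum_add f (fun y z => - g y z) l
  have h' := map_splitSum (-AddMonoidHom.id M) g l
  simp only [sub_eq_add_neg, h]
  exact congrArg _ h'.symm

theorem insertSum_sub_left (σ : A → A) (β γ : List A → A) {f : List A → M} (hf : IsMulti Q f)
    (l : List A) :
    insertSum σ (fun l => β l - γ l) f l = insertSum σ β f l - insertSum σ γ f l := by
  induction l generalizing f with
  | nil => simp [insertSum]
  | cons v l ih =>
    have : ∀ y z, f ((β (v :: y) - γ (v :: y)) :: z) = f (β (v :: y) :: z) - f (γ (v :: y) :: z) :=
      fun y z => (hf [] z).map_sub _ _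
    simp only [insertSum, ih (hf.cons _), this, splitSum_sub]
    abel

omit [AddCommGroup A] in
theorem insertSum_sub_right (σ : A → A) (β : List A → A) (f g : List A → M) (l : List A) :
    insertSum σ β (fun l => f l - g l) l = insertSum σ β f l - insertSum σ β g l := by
  induction l generalizing f g with
  | nil => simp [insertSum]
  | cons v l ih =>
    simp only [insertSum, ih, splitSum_sub]
    abel

end DiffSum

/-! ### Operations encoded by cyclic forms -/

/-- A complex with a perfect antisymmetric pairing on its suspension. -/
structure PairedComplex (Q E A : Type*) [CommRing Q] [Fintype E] [AddCommGroup A] [Module Q A]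
    extends DualExactComplex Q E where
  /-- The homogeneous basis. -/
  b : Module.Basis E Q A
  /-- The differential. -/
  δ : A →ₗ[Q] A
  δ_b : ∀ e, δ (b e) = ∑ e', D e e' • b e'
  /-- The pairing. -/
  ω : A →ₗ[Q] A →ₗ[Q] Q
  ω_antisymm : ∀ x y, ω x y = -ω y x
  ω_deg : ∀ e e', ω (b e) (b e') ≠ 0 → deg e + deg e' = d
  ω_δ' : ∀ e y, ω (δ (b e)) y + (-1) ^ (deg e + 1) * ω (b e) (δ y) = 0
  ω_bijective : Function.Bijective ω
  d_odd : Odd d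

namespace PairedComplex

variable {Q E A : Type*} [CommRing Q] [Fintype E] [AddCommGroup A] [Module Q A]
  (X : PairedComplex Q E A)

/-- The suspended degree sign. -/
def σ : A →ₗ[Q] A := X.b.constr Q fun e => X.s e • X.b e

theorem σ_b (e : E) : X.σ (X.b e) = X.s e • X.b e :=
  X.b.constr_basis Q _ _

theorem σ_σ (a : A) : X.σ (X.σ a) = a := by
  have : X.σ ∘ₗ X.σ = LinearMap.id := X.b.ext fun e => by
    simp [σ_b, smul_smul, X.s_mul_s]
  exact LinearMap.congr_fun this a

theorem σ_δ (a : A) : X.σ (X.δ a) = -X.δ (X.σ a) := by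
  have : X.σ ∘ₗ X.δ = -(X.δ ∘ₗ X.σ) := X.b.ext fun e => by
    simp only [LinearMap.comp_apply, LinearMap.neg_apply, σ_b, δ_b, map_sum, map_smul,
      Finset.smul_sum, ← Finset.sum_neg_distrib, smul_smul, X.D_mul_s, neg_smul]
  exact LinearMap.congr_fun this a

/-- When `ω` is nonzero on two basis elements, their suspended degrees add up to `d + 2`, which is
odd, so their signs are opposite. -/
theorem ω_σ (x y : A) : X.ω (X.σ x) y = -X.ω x (X.σ y) := by
  have : X.ω ∘ₗ X.σ = -(X.ω.compl₂ X.σ) := X.b.ext fun e => X.b.ext fun e' => by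
    simp only [LinearMap.comp_apply, LinearMap.neg_apply, LinearMap.compl₂_apply, σ_b, map_smul,
      LinearMap.smul_apply, smul_eq_mul]
    by_cases h : X.ω (X.b e) (X.b e') = 0
    · simp [h]
    · have h1 : X.s e * X.s e' = -1 := by
        rw [DualExactComplex.s, DualExactComplex.s, ← pow_add, DualExactComplex.sdeg,
          DualExactComplex.sdeg, show X.deg e + 1 + (X.deg e' + 1) = X.d + 2 by
            rw [← X.ω_deg e e' h]; ring]
        exact (X.d_odd.add_even even_two).neg_one_pow
      have h2 : X.s e = -X.s e' := by
        rw [← mul_one (X.s e), ← X.s_mul_s e', ← mul_assoc, h1, neg_one_mul]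
      rw [h2, neg_mul]
  exact LinearMap.congr_fun (LinearMap.congr_fun this x) y

theorem ω_δ (x y : A) : X.ω (X.δ x) y + X.ω (X.σ x) (X.δ y) = 0 := by
  have : X.ω ∘ₗ X.δ + (X.ω ∘ₗ X.σ).compl₂ X.δ = 0 := X.b.ext fun e => LinearMap.ext fun y => by
    have := X.ω_δ' e y
    simpa [σ_b, DualExactComplex.s, DualExactComplex.sdeg] using this
  exact LinearMap.congr_fun (LinearMap.congr_fun this x) y

theorem eq_of_ω {x y : A} (h : ∀ w, X.ω x w = X.ω y w) : x = y :=
  X.ω_bijective.1 (LinearMap.ext h)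

/-- The operation with the given cyclic form. -/
def op (F : List E → Q) (l : List A) : A :=
  (LinearEquiv.ofBijective X.ω X.ω_bijective).symm
    ((isMulti_multiExt X.b F l []).mk' _)

theorem ω_op (F : List E → Q) (l : List A) (w : A) :
    X.ω (X.op F l) w = multiExt X.b F (l ++ [w]) := by
  have := (LinearEquiv.ofBijective X.ω X.ω_bijective).apply_symm_apply
    ((isMulti_multiExt X.b F l []).mk' _)
  exact LinearMap.congr_fun this w

theorem isMulti_op (F : List E → Q) : IsMulti Q (X.op F) := by
  intro x z
  constructor
  · intro v v'
    refine X.eq_of_ω fun w => ?_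
    simp only [map_add, LinearMap.add_apply, ω_op, List.append_assoc, List.cons_append,
      (isMulti_multiExt X.b F _ _).map_add]
  · intro c v
    refine X.eq_of_ω fun w => ?_
    simp only [map_smul, LinearMap.smul_apply, ω_op, List.append_assoc, List.cons_append,
      (isMulti_multiExt X.b F _ _).map_smul]

theorem multiExt_sub (F G : List E → Q) (l : List A) :
    multiExt X.b (fun w => F w - G w) l = multiExt X.b F l - multiExt X.b G l := by
  induction l generalizing F G with
  | nil => rfl
  | cons v l ih => simp only [multiExt, ih, mul_sub, Finset.sum_sub_distrib]

theorem op_sub (F G : List E → Q) (l : List A) :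
    X.op (fun w => F w - G w) l = X.op F l - X.op G l :=
  X.eq_of_ω fun w => by simp [ω_op, multiExt_sub]

theorem multiExt_eq_zero {F : List E → Q} {l : List A}
    (h : ∀ w : List E, w.length = l.length → F w = 0) : multiExt X.b F l = 0 := by
  induction l generalizing F with
  | nil => exact h [] rfl
  | cons v l ih =>
    rw [multiExt]
    refine Finset.sum_eq_zero fun e _ => ?_
    rw [ih fun w hw => h _ (by simp [hw]), mul_zero]

theorem op_eq_zero {F : List E → Q} {l : List A}
    (h : ∀ w : List E, w.length = l.length + 1 → F w = 0) : X.op F l = 0 :=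
  X.eq_of_ω fun w => by
    rw [ω_op, X.multiExt_eq_zero fun u hu => h u (by simpa using hu)]; simp

theorem multiExt_cyclic {F : List E → Q} (hF : ∀ e w, F (e :: w) = X.s e * F (w ++ [e]))
    (v : A) (l : List A) :
    multiExt X.b F (v :: l) = multiExt X.b F (l ++ [X.σ v]) := by
  classical
  let g : List A → Q := fun l => match l with
    | [] => F []
    | v :: l => multiExt X.b F (l ++ [X.σ v])
  have hg : IsMulti Q g := by
    rintro (_ | ⟨u, x⟩) z
    · exact isLinearMap_comp (isMulti_multiExt X.b F z []) X.σ.isLinear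
    · exact (isMulti_multiExt X.b F).append_right [X.σ u] x z
  refine (isMulti_multiExt X.b F).eq_of_basis X.b hg (l.length + 1) (fun w _ => ?_) (v :: l) rfl
  rw [multiExt_map]
  rcases w with _ | ⟨e, w⟩
  · rfl
  · have h := (isMulti_multiExt X.b F (w.map X.b) []).map_smul (X.s e) (X.b e)
    change _ = multiExt X.b F (w.map X.b ++ [X.σ (X.b e)])
    rw [σ_b, h, hF, smul_eq_mul, show w.map X.b ++ [X.b e] = (w ++ [e]).map X.b by simp,
      multiExt_map]

/-- On a basis word, applying `σ` to every letter multiplies by the total sign, which is `1` on the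
support of `F`. -/
theorem multiExt_σ {F : List E → Q} {k : ℕ} (hk : Even k) (hF : X.Hom F k) (l : List A) :
    multiExt X.b F (l.map X.σ) = multiExt X.b F l := by
  classical
  refine ((isMulti_multiExt X.b F).map X.σ).eq_of_basis X.b (isMulti_multiExt X.b F) l.length
    (fun w _ => ?_) l rfl
  have : ∀ (G : List E → Q) (w : List E), multiExt X.b G ((w.map X.b).map X.σ) =
      (w.map X.s).prod * G w := by
    intro G w
    induction w generalizing G with
    | nil => simp [multiExt]
    | cons e w ih =>
      simp [multiExt, ih, σ_b, Finsupp.single_apply, mul_assoc, -List.map_map]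
  rw [this, multiExt_map, X.prod_s]
  by_cases h : F w = 0
  · simp [h]
  · rw [hF w h, hk.neg_one_pow, one_mul]

/-! ### Homogeneous elements -/

/-- The element `v` is homogeneous of suspended degree `k`. -/
def IsHomog (v : A) (k : ℕ) : Prop := ∀ e, X.b.repr v e ≠ 0 → X.sdeg e = k

theorem isHomog_b (e : E) : X.IsHomog (X.b e) (X.sdeg e) := by
  classical
  intro e' h
  rw [X.b.repr_self, Finsupp.single_apply] at h
  rw [show e = e' by by_contra h'; exact h (if_neg h')]

theorem IsHomog.σ {X : PairedComplex Q E A} {v : A} {k : ℕ} (h : X.IsHomog v k) :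
    X.IsHomog (X.σ v) k := by
  classical
  intro e he
  refine h e fun h0 => he ?_
  have : X.b.coord e ∘ₗ X.σ = X.s e • X.b.coord e := X.b.ext fun e' => by
    by_cases hee : e' = e
    · subst hee; simp [σ_b]
    · simp [σ_b, hee]
  have := LinearMap.congr_fun this v
  simp only [LinearMap.comp_apply, Module.Basis.coord_apply, LinearMap.smul_apply, h0] at this
  rw [this, smul_zero]

theorem multiExt_eq_zero_of_isHomog {F : List E → Q} {k : ℕ} (hF : X.Hom F k) {l : List A}
    {ks : List ℕ} (hl : List.Forall₂ X.IsHomog l ks) (hk : ks.sum ≠ k) :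
    multiExt X.b F l = 0 := by
  induction hl generalizing F k with
  | nil =>
    by_contra h
    exact hk (hF [] h)
  | @cons v k' l ks hv _ ih =>
    rw [multiExt]
    refine Finset.sum_eq_zero fun e _ => ?_
    by_cases he : X.b.repr v e = 0
    · rw [he, zero_mul]
    · have h1 := hv e he
      rw [List.sum_cons] at hk
      by_cases hkk : k' ≤ k
      · rw [ih (F := fun w => F (e :: w)) (k := k - k') (fun w hw => ?_) (by omega), mul_zero]
        have := hF _ hw
        simp only [List.map_cons, List.sum_cons] at this
        omega
      · rw [X.multiExt_eq_zero fun w _ => ?_, mul_zero]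
        by_contra h
        have := hF _ h
        simp only [List.map_cons, List.sum_cons] at this
        omega

/-- The component of `v` of suspended degree `k` has the same pairings with the basis as `v`, so the
two agree because `ω` is injective. -/
theorem isHomog_of_ω {v : A} {k : ℕ} (h : ∀ e, X.ω v (X.b e) ≠ 0 → X.sdeg e + k = X.d + 2) :
    X.IsHomog v k := by
  classical
  have hv : v = ∑ e, (if X.sdeg e = k then X.b.repr v e else 0) • X.b e := by
    have hv0 : v = ∑ e, X.b.repr v e • X.b e := (X.b.sum_repr v).symm
    refine X.ω_bijective.1 (X.b.ext fun e' => ?_)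
    rw [map_sum, LinearMap.sum_apply]
    conv_lhs => rw [hv0, map_sum, LinearMap.sum_apply]
    have hω : ∀ e, X.ω (X.b e) (X.b e') ≠ 0 → X.sdeg e + X.sdeg e' = X.d + 2 := by
      intro e he
      have := X.ω_deg e e' he
      simp only [DualExactComplex.sdeg]
      omega
    by_cases he' : X.sdeg e' + k = X.d + 2
    · refine Finset.sum_congr rfl fun e _ => ?_
      simp only [map_smul, LinearMap.smul_apply]
      by_cases he : X.ω (X.b e) (X.b e') = 0
      · simp [he]
      · rw [if_pos (by have := hω e he; omega)]
    · have h1 : X.ω v (X.b e') = 0 := by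
        by_contra h0
        exact he' (h e' h0)
      conv_lhs at h1 => rw [hv0, map_sum, LinearMap.sum_apply]
      rw [h1]
      refine (Finset.sum_eq_zero fun e _ => ?_).symm
      simp only [map_smul, LinearMap.smul_apply]
      by_cases he : X.ω (X.b e) (X.b e') = 0
      · simp [he]
      · rw [if_neg (by have := hω e he; omega), zero_smul]
  intro e he
  by_contra hk
  refine he ?_
  rw [hv, ← Module.Basis.coord_apply, map_sum]
  refine Finset.sum_eq_zero fun e' _ => ?_
  rw [map_smul, Module.Basis.coord_apply, X.b.repr_self, Finsupp.single_apply]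
  by_cases hee : e' = e
  · subst hee
    rw [if_neg hk, zero_smul]
  · rw [if_neg hee, smul_zero]

theorem isHomog_op {F : List E → Q} (hF : X.Hom F (X.d + 3)) {l : List A}
    {ks : List ℕ} (hl : List.Forall₂ X.IsHomog l ks) {k : ℕ} (hk : ks.sum = k + 1) :
    X.IsHomog (X.op F l) k := by
  refine X.isHomog_of_ω fun e he => ?_
  rw [ω_op] at he
  by_contra h
  refine he (X.multiExt_eq_zero_of_isHomog hF (ks := ks ++ [X.sdeg e])
    (List.rel_append hl (List.Forall₂.cons (X.isHomog_b e) List.Forall₂.nil)) ?_)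
  simp only [List.sum_append, List.sum_cons, List.sum_nil, hk]
  omega

end PairedComplex

/-! ### Obstruction theory for cyclic unital forms -/

namespace PairedComplex

variable {Q E A : Type*} [CommRing Q] [Fintype E] [AddCommGroup A] [Module Q A]
  (X : PairedComplex Q E A)

/-- The function `F` on words is the cyclic form of a family of operations that extends the
differential and has a strict unit. -/
structure IsUnitalForm (F : List E → Q) : Prop where
  hom : X.Hom F (X.d + 3)
  cyclic : ∀ e w, F (e :: w) = X.s e * F (w ++ [e])
  two : ∀ e e', F [e, e'] = X.ω (X.δ (X.b e)) (X.b e')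
  unit : ∀ e e', F [X.one, e, e'] = X.ω (X.b e) (X.b e')
  unit_higher : ∀ w : List E, 3 ≤ w.length → F (X.one :: w) = 0

/-- The left hand side of the Stasheff identities for the operations with cyclic form `F`. -/
def square (F : List E → Q) : List A → A := insertSum X.σ (X.op F) (X.op F)

/-- The cyclic form of `square`, rotated by one step. -/
def squareForm (F : List E → Q) : List A → Q
  | [] => 0
  | v :: l => X.ω (X.square F l) v

theorem isMulti_square (F : List E → Q) : IsMulti Q (X.square F) :=
  isMulti_insertSum X.σ (X.isMulti_op F) (X.isMulti_op F)

theorem isMulti_squareForm (F : List E → Q) : IsMulti Q (X.squareForm F) := by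
  rintro (_ | ⟨u, x⟩) z
  · exact (X.ω (X.square F z)).isLinear
  · exact (X.isMulti_square F).comp (X.ω.flip u) x z

theorem even_d_add : Even (X.d + 3) := X.d_odd.add_odd (by decide)

theorem δ_one : X.δ (X.b X.one) = 0 := by
  rw [δ_b]
  refine Finset.sum_eq_zero fun e _ => ?_
  have : X.D X.one e = 0 := by
    by_contra h
    have := X.D_deg _ _ h
    rw [(X.deg_eq_zero X.one).2 rfl] at this
    omega
  rw [this, zero_smul]

theorem s_one : X.s X.one = -1 := by
  simp [DualExactComplex.s, DualExactComplex.sdeg, (X.deg_eq_zero X.one).2 rfl]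

theorem σ_one : X.σ (X.b X.one) = -X.b X.one := by
  rw [σ_b, s_one, neg_one_smul]

namespace IsUnitalForm

variable {X} {F : List E → Q} (hF : X.IsUnitalForm F)
include hF

theorem multiExt_σ (l : List A) : multiExt X.b F (l.map X.σ) = multiExt X.b F l :=
  X.multiExt_σ X.even_d_add hF.hom l

theorem op_map_σ (l : List A) : X.op F (l.map X.σ) = -X.σ (X.op F l) := by
  refine X.eq_of_ω fun w => ?_
  have := hF.multiExt_σ (l ++ [X.σ w])
  rw [List.map_append, List.map_singleton, σ_σ, ← ω_op, ← ω_op] at this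
  rw [this, map_neg, LinearMap.neg_apply, ω_σ, neg_neg]

theorem op_cyclic (v : A) (l : List A) (w : A) :
    X.ω (X.op F (v :: l)) w = X.ω (X.op F (l ++ [w])) (X.σ v) := by
  rw [ω_op, ω_op, ← X.multiExt_cyclic hF.cyclic]
  rfl

theorem op_singleton (v : A) : X.op F [v] = X.δ v := by
  classical
  have : (X.isMulti_op F [] []).mk' _ = X.δ := X.b.ext fun e => X.ω_bijective.1 (X.b.ext fun e' => by
    change X.ω (X.op F [X.b e]) _ = _
    rw [ω_op, show [X.b e] ++ [X.b e'] = [e, e'].map X.b from rfl, multiExt_map, hF.two])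
  exact LinearMap.congr_fun this v

theorem op_one_left (v : A) : X.op F [X.b X.one, v] = v := by
  classical
  have : (X.isMulti_op F [X.b X.one] []).mk' _ = LinearMap.id :=
    X.b.ext fun e => X.ω_bijective.1 (X.b.ext fun e' => by
      change X.ω (X.op F [X.b X.one, X.b e]) _ = _
      rw [ω_op, show [X.b X.one, X.b e] ++ [X.b e'] = [X.one, e, e'].map X.b from rfl,
        multiExt_map, hF.unit]
      rfl)
  exact LinearMap.congr_fun this v

theorem multiExt_one (l : List A) (hl : 3 ≤ l.length) :
    multiExt X.b F (X.b X.one :: l) = 0 := by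
  classical
  refine ((isMulti_multiExt X.b F).cons (X.b X.one)).eq_of_basis X.b (g := fun _ => 0) (fun _ _ =>
    ⟨fun _ _ => (add_zero _).symm, fun _ _ => (smul_zero _).symm⟩) l.length (fun w hw => ?_) l rfl
  rw [show X.b X.one :: w.map X.b = (X.one :: w).map X.b from rfl, multiExt_map]
  exact hF.unit_higher w (by omega)

/-- Rotation moves the unit to the front of the cyclic word, where `unit_higher` applies. -/
theorem op_one_higher (x z : List A) (h : 2 ≤ x.length + z.length) :
    X.op F (x ++ X.b X.one :: z) = 0 := by
  refine X.eq_of_ω fun w => ?_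
  rw [ω_op, map_zero, LinearMap.zero_apply]
  have : ∀ x z : List A, multiExt X.b F (x ++ z) = multiExt X.b F (z ++ x.map X.σ) := by
    intro x
    induction x with
    | nil => simp
    | cons v x ih =>
      intro z
      rw [List.cons_append, X.multiExt_cyclic hF.cyclic, List.append_assoc, ih]
      simp
  rw [List.append_assoc, this, List.cons_append, List.cons_append, multiExt_one hF]
  simp only [List.length_append, List.length_singleton, List.length_map]
  omega

theorem op_one_right (v : A) : X.op F [v, X.b X.one] = -X.σ v := by
  refine X.eq_of_ω fun w => ?_
  rw [hF.op_cyclic, show [X.b X.one] ++ [w] = [X.b X.one, w] from rfl, hF.op_one_left,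
    X.ω_antisymm, map_neg, LinearMap.neg_apply]

theorem square_cyclic (v : A) (l : List A) (w : A) :
    X.ω (X.square F (v :: l)) w = X.ω (X.square F (l ++ [w])) v :=
  insertSum_cyclic X.σ_σ hF.op_map_σ X.ω_antisymm X.ω_σ hF.op_cyclic v l w

theorem squareForm_cyclic (v : A) (l : List A) :
    X.squareForm F (v :: l) = X.squareForm F (l ++ [v]) := by
  rcases l with _ | ⟨u, l⟩
  · rfl
  · exact hF.square_cyclic u l v

theorem square_one (l : List A) : X.square F (X.b X.one :: l) = 0 := by
  refine insertSum_unit (X.isMulti_op F) X.σ_one ?_ hF.op_one_left ?_ l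
  · rw [hF.op_singleton, δ_one]
  · intro v v' l
    exact hF.op_one_higher [] (v :: v' :: l) (by simp)

/-- `squareForm` is invariant under rotation without signs, so the unit can be rotated into the
first argument of `square`, where `square_one` applies. -/
theorem squareForm_reduced : X.Reduced fun w => X.squareForm F (w.map X.b) := by
  intro w hw
  obtain ⟨x, z, rfl⟩ := List.append_of_mem hw
  have : ∀ x z : List A, X.squareForm F (x ++ z) = X.squareForm F (z ++ x) := by
    intro x
    induction x with
    | nil => simp
    | cons v x ih =>
      intro z
      rw [List.cons_append, hF.squareForm_cyclic, List.append_assoc, ih]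
      simp
  simp only
  rw [List.map_append, this, List.map_cons, List.cons_append]
  rcases List.eq_nil_or_concat (z.map X.b ++ x.map X.b) with h | ⟨l, u, h⟩
  · rw [h]
    change X.ω (X.square F []) _ = 0
    simp [square, insertSum]
  · rw [h, List.concat_eq_append, ← List.cons_append, ← hF.squareForm_cyclic]
    change X.ω (X.square F (X.b X.one :: l)) u = 0
    rw [hF.square_one]
    simp

theorem squareForm_hom : X.Hom (fun w => X.squareForm F (w.map X.b)) (X.d + 4) := by
  rintro (_ | ⟨e, u⟩) hw
  · exact absurd rfl hw
  · by_contra hk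
    refine hw ?_
    change X.ω (X.square F (u.map X.b)) (X.b e) = 0
    have h0 : ∀ f : List A → A, X.ω (insertSum X.σ (X.op F) f (u.map X.b)) (X.b e) =
        insertSum X.σ (X.op F) (fun l => X.ω (f l) (X.b e)) (u.map X.b) := fun f =>
      map_insertSum X.σ (X.op F) (X.ω.flip (X.b e)).toAddMonoidHom f _
    rw [square, h0, insertSum_eq_zero]
    intro x v y z h
    obtain ⟨xy', z', rfl, h1, rfl⟩ := List.map_eq_append_iff.1 h.symm
    obtain ⟨x', y', rfl, rfl, h2⟩ := List.map_eq_append_iff.1 h1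
    rw [← h2, ω_op]
    rw [List.map_eq_cons_iff] at h2
    obtain ⟨v', y'', rfl, -, -⟩ := h2
    have hw : ∀ w : List E, List.Forall₂ X.IsHomog (w.map X.b) (w.map X.sdeg) := by
      intro w
      induction w with
      | nil => exact .nil
      | cons e w ih => exact .cons (X.isHomog_b e) ih
    have hσ : ∀ w : List E, List.Forall₂ X.IsHomog ((w.map X.b).map X.σ) (w.map X.sdeg) := by
      intro w
      induction w with
      | nil => exact .nil
      | cons e w ih => exact .cons (X.isHomog_b e).σ ih
    refine X.multiExt_eq_zero_of_isHomog hF.hom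
      (List.rel_append (List.rel_append (hσ x') (.cons (X.isHomog_op hF.hom (hw (v' :: y''))
        (k := X.deg v' + (y''.map X.sdeg).sum) ?_) (hw z'))) (.cons (X.isHomog_b e) .nil)) ?_
    · simp only [List.map_cons, List.sum_cons, DualExactComplex.sdeg]
      ring
    · intro hk'
      refine hk ?_
      simp only [List.map_append, List.map_cons, List.sum_append, List.sum_cons, List.sum_nil,
        DualExactComplex.sdeg] at hk' ⊢
      omega

/-- This is the Bianchi identity `diff_insertSum` paired with one more argument: differentiating the
arguments of `square` gives `δ` of its value, and `ω_δ` moves this `δ` to the other side of the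
pairing. -/
theorem squareForm_cocycle {n : ℕ} (h0 : ∀ l : List A, l.length ≤ n → X.square F l = 0)
    (l : List A) (hl : l.length = n + 2) : diffSum X.σ X.δ (X.squareForm F) l = 0 := by
  rcases l with _ | ⟨v, l⟩
  · simp at hl
  have hl' : l.length = n + 1 := by simpa using hl
  rw [diffSum]
  have e1 : diffSum X.σ X.δ (fun l => X.squareForm F (X.σ v :: l)) l =
      X.ω (X.δ (X.square F l)) (X.σ v) := by
    have h1 := diff_insertSum X.σ_σ hF.op_map_σ (X.isMulti_op F) hF.op_singleton (l := l)
      (by rintro rfl; simp at hl') (fun l' hl => h0 l' (by omega))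
    rw [square, ← h1]
    exact (map_diffSum _ _ (X.ω.flip (X.σ v)) _ _).symm
  rw [e1]
  change X.ω (X.square F l) (X.δ v) + _ = 0
  have h2 := X.ω_δ (X.square F l) (X.σ v)
  rw [X.ω_σ, X.σ_δ, X.σ_σ, map_neg, neg_neg] at h2
  rw [add_comm]
  exact h2

end IsUnitalForm

/-- The operation with form `G` has arity `n + 1`. Inserted into itself it has arity `2 n + 1 > n +
1`, as `1 ≤ n`, so up to arity `n + 1` only its commutator with the differential appears. -/
theorem square_sub {F G : List E → Q} (hF : X.IsUnitalForm F) {n : ℕ} (hn : 1 ≤ n)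
    (hG : ∀ w : List E, w.length ≠ n + 2 → G w = 0) (l : List A) :
    (l.length ≤ n → X.square (fun w => F w - G w) l = X.square F l) ∧
    (l.length = n + 1 → X.square (fun w => F w - G w) l =
      X.square F l - X.δ (X.op G l) - diffSum X.σ X.δ (X.op G) l) := by
  have hg : ∀ l : List A, l.length ≠ n + 1 → X.op G l = 0 := fun l hl =>
    X.op_eq_zero fun w hw => hG w (by omega)
  have hop : X.op (fun w => F w - G w) = fun l => X.op F l - X.op G l :=
    funext fun l => X.op_sub F G l
  constructor
  · intro hl
    rw [square, square]
    refine insertSum_congr _ _ fun x v y z h => ?_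
    have h1 := congrArg List.length h
    simp only [List.length_append, List.length_cons] at h1
    rw [hop]
    simp only
    rw [hg (v :: y) (by simp; omega), sub_zero, hg (_ ++ _), sub_zero]
    simp
    omega
  · intro hl
    have hne : l ≠ [] := by rintro rfl; simp at hl
    have hs : ∀ v, X.op (fun w => F w - G w) [v] = X.δ v := by
      intro v
      rw [op_sub, hg [v] (by simp; omega), sub_zero, hF.op_singleton]
    rw [square]
    conv_lhs => enter [3]; rw [hop]
    rw [insertSum_sub_right, insertSum_eq_diffSum X.σ X.δ hs (f := X.op G)
      (fun l' hl' => hg l' (by omega)), hop, insertSum_sub_left _ _ _ (X.isMulti_op F),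
      insertSum_eq_of_length (γ := X.op G) hne, hF.op_singleton]
    · rfl
    · intro x v y z _ h
      rw [hg _ (by omega)]
      exact (X.isMulti_op F).zero _ _

/-- The correction `G` is a cyclic primitive of `squareForm F` on words of length `n + 2`. It is
reduced, so the values of `F` on words containing the unit persist. -/
theorem IsUnitalForm.exists_step {X : PairedComplex Q E A}
    (hQ : ∀ n : ℕ, n ≠ 0 → IsUnit (n : Q)) {F : List E → Q} (hF : X.IsUnitalForm F) {n : ℕ}
    (hn : 1 ≤ n) (h0 : ∀ l : List A, l.length ≤ n → X.square F l = 0) :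
    ∃ F', X.IsUnitalForm F' ∧ ∀ l : List A, l.length ≤ n + 1 → X.square F' l = 0 := by
  classical
  obtain ⟨G, h1, h2, h3, h4, h5⟩ := X.exists_cyclic_primitive hQ (n := n + 2) (k := X.d + 3)
    (F := fun w => X.squareForm F (w.map X.b)) (by omega) X.even_d_add (by omega)
    hF.squareForm_reduced hF.squareForm_hom
    (fun w hw => by
      rw [← hF.squareForm_cocycle h0 (w.map X.b) (by simpa using hw)]
      exact (diffSum_map X.b X.σ_b X.δ_b (X.isMulti_squareForm F) w).symm)
    (fun e w _ => by
      simp only [List.map_cons, List.map_append, List.map_nil]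
      exact hF.squareForm_cyclic _ _)
  have hL : ∀ l : List A, l.length = n + 2 →
      diffSum X.σ X.δ (multiExt X.b G) l = X.squareForm F l := by
    refine IsMulti.eq_of_basis X.b (isMulti_diffSum _ _ (isMulti_multiExt _ _))
      (X.isMulti_squareForm F) (n + 2) fun w hw => ?_
    rw [diffSum_map X.b X.σ_b X.δ_b (isMulti_multiExt _ _), ← h5 w hw]
    simp only [multiExt_map]
    rfl
  refine ⟨fun w => F w - G w, ⟨hF.hom.sub h2, fun e w => ?_, fun e e' => ?_, fun e e' => ?_,
    fun w hw => ?_⟩, fun l hl => ?_⟩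
  · rw [hF.cyclic, h4, mul_sub]
  · rw [h3 _ (by simp; omega), sub_zero, hF.two]
  · rw [h1 _ (by simp), sub_zero, hF.unit]
  · rw [h1 _ (by simp), sub_zero, hF.unit_higher w hw]
  · rcases hl.lt_or_eq with hl | hl
    · rw [(X.square_sub hF hn h3 l).1 (by omega), h0 l (by omega)]
    · rw [(X.square_sub hF hn h3 l).2 hl]
      refine X.eq_of_ω fun w => ?_
      have h6 := hL (w :: l) (by simpa using hl)
      rw [diffSum] at h6
      have h7 : multiExt X.b G (X.δ w :: l) = X.ω (X.δ (X.op G l)) w := by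
        rw [X.multiExt_cyclic h4, ← ω_op, ← neg_inj, ← X.ω_σ]
        exact eq_neg_of_add_eq_zero_right (X.ω_δ _ _)
      have h8 : diffSum X.σ X.δ (fun l => multiExt X.b G (X.σ w :: l)) l =
          X.ω (diffSum X.σ X.δ (X.op G) l) w := by
        have : (fun l => multiExt X.b G (X.σ w :: l)) = fun l => X.ω (X.op G l) w := by
          funext l
          rw [X.multiExt_cyclic h4, σ_σ, ω_op]
        rw [this]
        exact (map_diffSum _ _ (X.ω.flip w) _ _).symm
      rw [h7, h8] at h6
      change _ = X.ω (X.square F l) w at h6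
      rw [map_sub, map_sub, LinearMap.sub_apply, LinearMap.sub_apply, ← h6, map_zero,
        LinearMap.zero_apply]
      ring

variable [DecidableEq E]

/-- The cyclic form of the differential and of the part of the product that involves the unit. -/
def initialForm : List E → Q
  | [x, y] => X.ω (X.δ (X.b x)) (X.b y)
  | [x, y, z] =>
    if x = X.one then X.ω (X.b y) (X.b z)
    else if y = X.one then -(X.s x * X.ω (X.b x) (X.b z))
    else if z = X.one then -X.ω (X.b x) (X.b y)
    else 0
  | _ => 0

omit [DecidableEq E] in
theorem ω_ne_zero {e e' : E} (h : X.ω (X.b e) (X.b e') ≠ 0) :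
    X.sdeg e + X.sdeg e' = X.d + 2 := by
  rw [← X.ω_deg e e' h]
  simp only [DualExactComplex.sdeg]
  ring

omit [DecidableEq E] in
theorem s_mul_ω (e e' : E) : X.s e * X.ω (X.b e) (X.b e') = -(X.s e' * X.ω (X.b e) (X.b e')) := by
  have h := X.ω_σ (X.b e) (X.b e')
  rw [σ_b, σ_b, map_smul, map_smul] at h
  simpa using h

theorem initialForm_hom : X.Hom X.initialForm (X.d + 3) := by
  intro w hw
  have h1 : X.sdeg X.one = 1 := by
    simp [DualExactComplex.sdeg, (X.deg_eq_zero X.one).2 rfl]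
  rcases w with _ | ⟨x, _ | ⟨y, _ | ⟨z, _ | ⟨t, w⟩⟩⟩⟩
  · exact absurd rfl hw
  · exact absurd rfl hw
  · simp only [initialForm, δ_b, map_sum, LinearMap.sum_apply] at hw
    obtain ⟨e, -, he⟩ := Finset.exists_ne_zero_of_sum_ne_zero hw
    rw [map_smul, LinearMap.smul_apply, smul_eq_mul] at he
    have h2 := X.D_deg _ _ (left_ne_zero_of_mul he)
    have h3 := X.ω_deg _ _ (right_ne_zero_of_mul he)
    simp only [List.map_cons, List.map_nil, List.sum_cons, List.sum_nil, DualExactComplex.sdeg]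
    omega
  · simp only [initialForm] at hw
    simp only [List.map_cons, List.map_nil, List.sum_cons, List.sum_nil]
    split_ifs at hw with h2 h2 h2
    · have := X.ω_ne_zero hw
      rw [h2]; omega
    · have := X.ω_ne_zero (right_ne_zero_of_mul (neg_ne_zero.1 hw))
      rw [h2]; omega
    · have := X.ω_ne_zero (neg_ne_zero.1 hw)
      rw [h2]; omega
    · exact absurd rfl hw
  · exact absurd rfl hw

theorem isUnitalForm_initialForm : X.IsUnitalForm X.initialForm where
  hom := X.initialForm_hom
  cyclic := by
    rintro x (_ | ⟨y, _ | ⟨z, _ | ⟨t, w⟩⟩⟩)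
    · simp [initialForm]
    · change X.ω (X.δ (X.b x)) (X.b y) = X.s x * X.ω (X.δ (X.b y)) (X.b x)
      have h := eq_neg_of_add_eq_zero_left (X.ω_δ (X.b y) (X.b x))
      rw [h, X.ω_antisymm (X.σ _), neg_neg]
      by_cases h0 : X.ω (X.δ (X.b x)) (X.b y) = 0
      · simp [h0, σ_b]
      · have h1 := X.initialForm_hom [x, y] h0
        have h2 : X.s x * X.s y = 1 := by
          have h3 := X.prod_s [x, y]
          rw [h1, X.even_d_add.neg_one_pow] at h3
          simpa using h3
        rw [σ_b, map_smul, smul_eq_mul, ← mul_assoc, h2, one_mul]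
    · change (if x = X.one then X.ω (X.b y) (X.b z)
        else if y = X.one then -(X.s x * X.ω (X.b x) (X.b z))
        else if z = X.one then -X.ω (X.b x) (X.b y) else 0) =
        X.s x * (if y = X.one then X.ω (X.b z) (X.b x)
        else if z = X.one then -(X.s y * X.ω (X.b y) (X.b x))
        else if x = X.one then -X.ω (X.b y) (X.b z) else 0)
      have ha := X.ω_antisymm
      by_cases hx : x = X.one
      · rw [if_pos hx, if_pos hx, hx, X.s_one]
        split_ifs with hy hz
        · rw [hy, ha]; ring
        · have := X.s_mul_ω y X.one
          rw [X.s_one] at this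
          rw [hz, this]; ring
        · ring
      · rw [if_neg hx, if_neg hx]
        split_ifs with hy hz
        · rw [ha (X.b z)]; ring
        · have h1 := X.s_mul_ω x y
          rw [ha (X.b y)]
          linear_combination (-X.s y) * h1 + X.ω (X.b x) (X.b y) * X.s_mul_s y
        · simp
    · rcases w with _ | ⟨t', w⟩ <;> simp [initialForm]
  two _ _ := rfl
  unit _ _ := if_pos rfl
  unit_higher := by
    rintro (_ | ⟨y, _ | ⟨z, _ | ⟨t, w⟩⟩⟩) hw
    · simp at hw
    · simp at hw
    · simp at hw
    · rfl

-- `squareForm` is reduced of suspended degree `d + 4`, hence vanishes on words of more than `(d +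
-- 4) / 2` letters.
variable {X} in
omit [DecidableEq E] in
theorem IsUnitalForm.square_eq_zero {F : List E → Q} (hF : X.IsUnitalForm F)
    (h : ∀ l : List A, l.length ≤ X.d + 4 → X.square F l = 0) (l : List A) :
    X.square F l = 0 := by
  by_cases hl : l.length ≤ X.d + 4
  · exact h l hl
  · refine (X.isMulti_square F).eq_of_basis X.b (g := fun _ => 0) (fun _ _ =>
      ⟨fun _ _ => (add_zero _).symm, fun _ _ => (smul_zero _).symm⟩) l.length (fun w hw => ?_) l rfl
    refine X.ω_bijective.1 (X.b.ext fun e => ?_)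
    rw [map_zero, LinearMap.zero_apply]
    by_contra h0
    have := hF.squareForm_reduced.two_mul_length_le hF.squareForm_hom (w := e :: w) h0
    simp only [List.length_cons] at this
    omega

/-- The existence of a cyclic and strictly unital family of operations that extends the
differential, in the suspended sign convention. -/
theorem exists_isUnitalForm (hQ : ∀ n : ℕ, n ≠ 0 → IsUnit (n : Q)) :
    ∃ F, X.IsUnitalForm F ∧ ∀ l, X.square F l = 0 := by
  have h : ∀ n : ℕ, ∃ F, X.IsUnitalForm F ∧ ∀ l : List A, l.length ≤ n + 1 → X.square F l = 0 := by
    intro n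
    induction n with
    | zero =>
      have hF := X.isUnitalForm_initialForm
      refine ⟨X.initialForm, hF, ?_⟩
      rintro (_ | ⟨v, _ | ⟨u, l⟩⟩) hl
      · rfl
      · change X.op _ [X.op _ [v]] + 0 = 0
        rw [hF.op_singleton, hF.op_singleton, add_zero]
        have : X.δ ∘ₗ X.δ = 0 := X.b.ext fun e => by
          simp only [LinearMap.comp_apply, δ_b, map_sum, map_smul, Finset.smul_sum, smul_smul]
          rw [Finset.sum_comm]
          refine Finset.sum_eq_zero fun e' _ => ?_
          rw [← Finset.sum_smul, X.D_D, zero_smul]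
        exact LinearMap.congr_fun this v
      · simp at hl
    | succ n ih =>
      obtain ⟨F, hF, h0⟩ := ih
      exact hF.exists_step hQ (by omega) h0
  obtain ⟨F, hF, h0⟩ := h (X.d + 3)
  exact ⟨F, hF, hF.square_eq_zero h0⟩

end PairedComplex

/-! ### Minimal resolutions and `Ext` -/

section Resolution

variable {Q : Type u} [CommRing Q] {R : Type u} [AddCommGroup R] [Module Q R]
  (P : ProjectiveResolution (ModuleCat.of Q R))

/-- The differential of a resolution. -/
def resD (n : ℕ) : P.complex.X (n + 1) →ₗ[Q] P.complex.X n := (P.complex.d (n + 1) n).hom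

/-- The augmentation of a resolution, in degree zero. -/
def resAug : P.complex.X 0 →ₗ[Q] R :=
  (P.π.f 0 ≫ (HomologicalComplex.singleObjXSelf (ComplexShape.down ℕ) 0 (ModuleCat.of Q R)).hom).hom

theorem resD_resD (n : ℕ) (x : P.complex.X (n + 2)) : resD P n (resD P (n + 1) x) = 0 := by
  have := P.complex.d_comp_d (n + 2) (n + 1) n
  exact LinearMap.congr_fun (congrArg ModuleCat.Hom.hom this) x

theorem exists_resD_eq {n : ℕ} {x : P.complex.X (n + 1)} (hx : resD P n x = 0) :
    ∃ y, resD P (n + 1) y = x :=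
  (ShortComplex.moduleCat_exact_iff _).1 (P.exact_succ n) x hx

theorem resAug_resD (x : P.complex.X 1) : resAug P (resD P 0 x) = 0 := by
  have := P.complex_d_comp_π_f_zero
  have h := LinearMap.congr_fun (congrArg ModuleCat.Hom.hom this) x
  change (HomologicalComplex.singleObjXSelf (ComplexShape.down ℕ) 0 (ModuleCat.of Q R)).hom.hom
    ((P.π.f 0).hom ((P.complex.d 1 0).hom x)) = 0
  have h' : (P.π.f 0).hom ((P.complex.d 1 0).hom x) = 0 := h
  rw [h', map_zero]

theorem exists_resD_eq_of_resAug {x : P.complex.X 0} (hx : resAug P x = 0) :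
    ∃ y, resD P 0 y = x := by
  refine (ShortComplex.moduleCat_exact_iff _).1 P.exact₀ x ?_
  have hinj : Function.Injective (HomologicalComplex.singleObjXSelf (ComplexShape.down ℕ) 0
      (ModuleCat.of Q R)).hom.hom :=
    (ModuleCat.mono_iff_injective _).1 inferInstance
  refine hinj ?_
  rw [map_zero]
  exact hx

theorem resAug_surjective : Function.Surjective (resAug P) :=
  (ModuleCat.epi_iff_surjective _).1 (by
    change Epi (P.π.f 0 ≫ (HomologicalComplex.singleObjXSelf (ComplexShape.down ℕ) 0
      (ModuleCat.of Q R)).hom)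
    infer_instance)

theorem exists_eq_comp_resD {N : ModuleCat.{u} Q} {i : ℕ}
    (h : Subsingleton (Abelian.Ext (ModuleCat.of Q R) N (i + 1)))
    (φ : P.complex.X (i + 1) →ₗ[Q] N) (hφ : φ ∘ₗ resD P (i + 1) = 0) :
    ∃ ψ : P.complex.X i →ₗ[Q] N, φ = ψ ∘ₗ resD P i := by
  have hφ' : P.complex.d (i + 2) (i + 1) ≫ ModuleCat.ofHom φ = 0 := ModuleCat.hom_ext hφ
  obtain ⟨g, hg⟩ := (P.extMk_eq_zero_iff (ModuleCat.ofHom φ) (i + 2) rfl hφ' i rfl).1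
    (Subsingleton.elim _ _)
  exact ⟨g.hom, (congrArg ModuleCat.Hom.hom hg).symm⟩

/-- A cocycle in degree zero factors through the cokernel `R` of the first differential, and `Ext^0`
is `Hom`. -/
theorem eq_zero_of_comp_resD {N : ModuleCat.{u} Q}
    (h : Subsingleton (Abelian.Ext (ModuleCat.of Q R) N 0))
    (φ : P.complex.X 0 →ₗ[Q] N) (hφ : φ ∘ₗ resD P 0 = 0) : φ = 0 := by
  have hφ' : P.complex.d 1 0 ≫ ModuleCat.ofHom φ = 0 := ModuleCat.hom_ext hφ
  have h1 : Subsingleton (ModuleCat.of Q R ⟶ N) := Abelian.Ext.addEquiv₀.symm.subsingleton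
  have h2 := P.isColimitCokernelCofork.fac (Limits.CokernelCofork.ofπ (ModuleCat.ofHom φ) hφ')
    Limits.WalkingParallelPair.one
  rw [Subsingleton.elim (α := ModuleCat.of Q R ⟶ N)
    (P.isColimitCokernelCofork.desc (Limits.CokernelCofork.ofπ (ModuleCat.ofHom φ) hφ')) 0] at h2
  simp at h2
  exact (congrArg ModuleCat.Hom.hom h2).symm

/-- A projective resolution computes `Ext`, including the module structure. -/
theorem exists_linearMap_of_ext {N : ModuleCat.{u} Q} {i : ℕ} {T : Type*} [AddCommGroup T]
    [Module Q T] (e : Abelian.Ext (ModuleCat.of Q R) N (i + 1) ≃ₗ[Q] T)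
    (hd : resD P (i + 1) = 0) :
    ∃ θ : (P.complex.X (i + 1) →ₗ[Q] N) →ₗ[Q] T, Function.Surjective θ ∧
      ∀ φ, θ φ = 0 ↔ ∃ ψ : P.complex.X i →ₗ[Q] N, φ = ψ ∘ₗ resD P i := by
  have hd' : P.complex.d (i + 2) (i + 1) = 0 := ModuleCat.hom_ext hd
  have hφ : ∀ φ : P.complex.X (i + 1) →ₗ[Q] N,
      P.complex.d (i + 2) (i + 1) ≫ ModuleCat.ofHom φ = 0 := fun φ => by rw [hd', Limits.zero_comp]
  let θ : (P.complex.X (i + 1) →ₗ[Q] N) →ₗ[Q] Abelian.Ext (ModuleCat.of Q R) N (i + 1) :=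
    { toFun := fun φ => P.extMk (ModuleCat.ofHom φ) (i + 2) rfl (hφ φ)
      map_add' := fun φ ψ => (P.add_extMk _ _ _ rfl (hφ φ) (hφ ψ)).symm
      map_smul' := fun c φ => by
        rw [Abelian.Ext.smul_eq_comp_mk₀, RingHom.id_apply, P.extMk_comp_mk₀]
        rfl }
  refine ⟨e.toLinearMap ∘ₗ θ, e.surjective.comp fun α => ?_, fun φ => ?_⟩
  · obtain ⟨f, hf, h⟩ := P.extMk_surjective α (i + 2) rfl
    exact ⟨f.hom, h⟩
  · rw [LinearMap.comp_apply, LinearEquiv.coe_coe, e.map_eq_zero_iff]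
    refine (P.extMk_eq_zero_iff (ModuleCat.ofHom φ) (i + 2) rfl (hφ φ) i rfl).trans ?_
    constructor
    · rintro ⟨g, hg⟩
      exact ⟨g.hom, (congrArg ModuleCat.Hom.hom hg).symm⟩
    · rintro ⟨ψ, rfl⟩
      exact ⟨ModuleCat.ofHom ψ, rfl⟩

variable [IsLocalRing Q]

omit [IsLocalRing Q] in
theorem mem_of_mem_smul_top {V : Type*} [AddCommGroup V] [Module Q V] {I : Ideal Q}
    (φ : V →ₗ[Q] Q) {x : V} (hx : x ∈ I • (⊤ : Submodule Q V)) : φ x ∈ I := by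
  induction hx using Submodule.smul_induction_on' with
  | smul r hr v _ =>
    rw [map_smul, smul_eq_mul]
    exact I.mul_mem_right _ hr
  | add v _ w _ hv hw =>
    rw [map_add]
    exact I.add_mem hv hw

theorem comp_resD_mem {P : ProjectiveResolution (ModuleCat.of Q R)}
    (hP : IsMinimalFreeResolution P) {i : ℕ} (ψ : P.complex.X i →ₗ[Q] Q) (x : P.complex.X (i + 1)) :
    ψ (resD P i x) ∈ IsLocalRing.maximalIdeal Q := by
  exact mem_of_mem_smul_top ψ (hP.minimal i ⟨x, rfl⟩)

omit [IsLocalRing Q] in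
theorem subsingleton_of_isEmpty {V ι : Type*} [AddCommGroup V] [Module Q V]
    (b : Module.Basis ι Q V) [IsEmpty ι] : Subsingleton V :=
  b.repr.toEquiv.subsingleton

/-- By minimality the differential vanishes after applying `Hom` into the residue field. So
vanishing of `Ext` means that every functional on the term takes values in the maximal ideal, and a
free module with this property has empty basis. -/
theorem subsingleton_of_ext_residueField {P : ProjectiveResolution (ModuleCat.of Q R)}
    (hP : IsMinimalFreeResolution P) {i : ℕ}
    (h : Subsingleton (Abelian.Ext (ModuleCat.of Q R)
      (ModuleCat.of Q (IsLocalRing.ResidueField Q)) (i + 1))) :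
    Subsingleton (P.complex.X (i + 1)) := by
  have := hP.free (i + 1)
  have key : ∀ φ : P.complex.X (i + 1) →ₗ[Q] Q, ∀ x,
      φ x ∈ IsLocalRing.maximalIdeal Q := by
    intro φ x
    let π : Q →ₗ[Q] IsLocalRing.ResidueField Q := Algebra.linearMap _ _
    have hπ : ∀ q, π q = 0 ↔ q ∈ IsLocalRing.maximalIdeal Q := fun q =>
      IsLocalRing.residue_eq_zero_iff q
    obtain ⟨ψ, hψ⟩ := exists_eq_comp_resD P h (π ∘ₗ φ) (LinearMap.ext fun y =>
      (hπ _).2 (comp_resD_mem hP φ y))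
    rw [← hπ]
    have h1 : (π ∘ₗ φ) x = ψ (resD P i x) := LinearMap.congr_fun hψ x
    change (π ∘ₗ φ) x = 0
    rw [h1]
    have h2 : ψ (resD P i x) ∈
        (IsLocalRing.maximalIdeal Q • (⊤ : Submodule Q (P.complex.X i))).map ψ :=
      Submodule.mem_map_of_mem (hP.minimal i ⟨x, rfl⟩)
    rw [Submodule.map_smul''] at h2
    refine (Submodule.smul_le (P := (⊥ : Submodule Q _)).2 (fun q hq y _ => ?_)) h2
    change q • (y : IsLocalRing.ResidueField Q) = 0
    rw [Algebra.smul_def]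
    exact mul_eq_zero_of_left ((IsLocalRing.residue_eq_zero_iff q).2 hq) _
  let b := Module.Free.chooseBasis Q (P.complex.X (i + 1))
  have : IsEmpty (Module.Free.ChooseBasisIndex Q (P.complex.X (i + 1))) := ⟨fun j =>
    (IsLocalRing.maximalIdeal.isMaximal Q).ne_top
      ((Ideal.eq_top_iff_one _).2 (by simpa using key (b.coord j) (b j)))⟩
  exact subsingleton_of_isEmpty b

/-- At the last nonzero term every functional is a cocycle. A coordinate functional would then be a
coboundary, with values in the maximal ideal by minimality, yet it takes the value `1`. -/
theorem subsingleton_of_ext_self {P : ProjectiveResolution (ModuleCat.of Q R)}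
    (hP : IsMinimalFreeResolution P) {i : ℕ}
    (h : Subsingleton (Abelian.Ext (ModuleCat.of Q R) (ModuleCat.of Q Q) (i + 1)))
    (hi : Subsingleton (P.complex.X (i + 2))) :
    Subsingleton (P.complex.X (i + 1)) := by
  have := hP.free (i + 1)
  let b := Module.Free.chooseBasis Q (P.complex.X (i + 1))
  have : IsEmpty (Module.Free.ChooseBasisIndex Q (P.complex.X (i + 1))) := ⟨fun j => by
    obtain ⟨ψ, hψ⟩ := exists_eq_comp_resD P h (b.coord j) (LinearMap.ext fun y => by
      rw [Subsingleton.elim y 0, map_zero, map_zero])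
    have h1 : b.coord j (b j) ∈ IsLocalRing.maximalIdeal Q := by
      rw [show b.coord j (b j) = ψ (resD P i (b j)) from LinearMap.congr_fun hψ _]
      exact comp_resD_mem hP ψ _
    simp at h1⟩
  exact subsingleton_of_isEmpty b

/-- Finite projective dimension kills the terms far out through `Ext` into the residue field.
Descending from there to `d + 1`, the vanishing of `Ext^i(R, Q)` removes one term at a time. -/
theorem subsingleton_of_gorenstein {P : ProjectiveResolution (ModuleCat.of Q R)}
    (hP : IsMinimalFreeResolution P) {d : ℕ}
    (hpd : projectiveDimension (ModuleCat.of Q R) ≠ ⊤)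
    (h : ∀ i, i ≠ d → Subsingleton (Abelian.Ext (ModuleCat.of Q R) (ModuleCat.of Q Q) i))
    {i : ℕ} (hi : d < i) : Subsingleton (P.complex.X i) := by
  obtain ⟨n, hn⟩ := (projectiveDimension_ne_top_iff _).1 hpd
  have key : ∀ k i, d < i → n + 1 ≤ i + k → Subsingleton (P.complex.X i) := by
    intro k
    induction k with
    | zero =>
      intro i hi hni
      obtain ⟨i, rfl⟩ := Nat.exists_eq_add_of_lt (Nat.zero_lt_of_lt hi)
      rw [Nat.zero_add] at hi hni ⊢
      exact subsingleton_of_ext_residueField hP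
        (HasProjectiveDimensionLT.subsingleton _ (n + 1) _ hni _)
    | succ k ih =>
      intro i hi hni
      obtain ⟨i, rfl⟩ := Nat.exists_eq_add_of_lt (Nat.zero_lt_of_lt hi)
      rw [Nat.zero_add] at hi hni ⊢
      exact subsingleton_of_ext_self hP (h _ (by omega)) (ih _ (by omega) (by omega))
  exact key n i hi (by omega)

/-- A free module with a surjection to `R` whose kernel has coordinates in the maximal ideal has
rank one. -/
theorem rank_one_of_ker_le {V ι T : Type*} [AddCommGroup V] [Module Q V]
    [CommRing T] [Nontrivial T] [Algebra Q T] (hT : Function.Surjective (algebraMap Q T))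
    (b : Module.Basis ι Q V) (θ : V →ₗ[Q] T)
    (hker : ∀ v, θ v = 0 → ∀ j, b.repr v j ∈ IsLocalRing.maximalIdeal Q)
    {t : V} (ht : θ t = 1) :
    Nonempty ι ∧ Subsingleton ι ∧ ∀ j, IsUnit (b.repr t j) := by
  classical
  -- Modulo the maximal ideal every basis vector is a multiple of `t`, since `T` is generated by `1
  -- = θ t` over `Q`.
  have h1 : ∀ i, ∃ r : Q, ∀ j, b.repr (b i) j - r * b.repr t j ∈ IsLocalRing.maximalIdeal Q := by
    intro i
    obtain ⟨r, hr⟩ := hT (θ (b i))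
    refine ⟨r, fun j => ?_⟩
    have := hker (b i - r • t) (by rw [map_sub, map_smul, ht, ← hr, Algebra.smul_def, mul_one,
      sub_self]) j
    simpa using this
  choose r hr using h1
  have h2 : ∀ j, IsUnit (r j) ∧ IsUnit (b.repr t j) := by
    intro j
    have h := hr j j
    rw [b.repr_self, Finsupp.single_eq_same] at h
    rw [← IsUnit.mul_iff]
    by_contra hn
    have := Ideal.add_mem _ h ((IsLocalRing.mem_maximalIdeal _).2 hn)
    rw [sub_add_cancel] at this
    exact (IsLocalRing.maximalIdeal.isMaximal Q).ne_top ((Ideal.eq_top_iff_one _).2 this)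
  refine ⟨?_, ⟨fun i j => ?_⟩, fun j => (h2 j).2⟩
  · by_contra hι
    rw [not_nonempty_iff] at hι
    have := subsingleton_of_isEmpty b
    rw [Subsingleton.elim t 0, map_zero] at ht
    exact zero_ne_one ht
  · by_contra hij
    have h := hr i j
    rw [b.repr_self, Finsupp.single_eq_of_ne (Ne.symm hij), zero_sub, Ideal.neg_mem_iff] at h
    exact (IsLocalRing.mem_maximalIdeal _).1 h ((h2 i).1.mul (h2 j).2)

end Resolution

/-! ### Perfectness of a pairing on a minimal resolution -/

section Duality

variable {Q : Type u} [CommRing Q] [IsLocalRing Q]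

theorem surjective_of_sup_smul_top {V W : Type*} [AddCommGroup V] [Module Q V] [AddCommGroup W]
    [Module Q W] [Module.Finite Q W] (f : V →ₗ[Q] W)
    (h : ∀ w, ∃ v, w + f v ∈ IsLocalRing.maximalIdeal Q • (⊤ : Submodule Q W)) :
    Function.Surjective f := by
  rw [← LinearMap.range_eq_top, ← top_le_iff]
  refine Submodule.le_of_le_smul_of_le_jacobson_bot (I := IsLocalRing.maximalIdeal Q)
    Module.Finite.fg_top (IsLocalRing.maximalIdeal_le_jacobson _) fun w _ => ?_
  obtain ⟨v, hv⟩ := h w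
  rw [show w = f (-v) + (w + f v) by rw [map_neg]; abel]
  exact Submodule.add_mem_sup ⟨_, rfl⟩ hv

theorem injective_of_ker_le_smul_top {V W : Type*} [AddCommGroup V] [Module Q V] [AddCommGroup W]
    [Module Q W] [Module.Finite Q V] [Module.Projective Q W] (f : V →ₗ[Q] W)
    (hf : Function.Surjective f)
    (h : ∀ v, f v = 0 → v ∈ IsLocalRing.maximalIdeal Q • (⊤ : Submodule Q V)) :
    Function.Injective f := by
  obtain ⟨s, hs⟩ := Module.projective_lifting_property f LinearMap.id hf
  let p : V →ₗ[Q] V := LinearMap.id - s ∘ₗ f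
  have hp : ∀ v, f v = 0 → p v = v := fun v hv => by simp [p, hv]
  have hfp : ∀ v, f (p v) = 0 := fun v => by
    have := LinearMap.congr_fun hs (f v)
    simp only [LinearMap.comp_apply, LinearMap.id_apply] at this
    simp [p, this]
  have hbot : LinearMap.range p = ⊥ := by
    refine Submodule.eq_bot_of_le_smul_of_le_jacobson_bot (IsLocalRing.maximalIdeal Q) _
      ?_ ?_ (IsLocalRing.maximalIdeal_le_jacobson _)
    · rw [LinearMap.range_eq_map]
      exact Module.Finite.fg_top.map p
    · rintro _ ⟨v, rfl⟩
      have := Submodule.mem_map_of_mem (f := p) (h _ (hfp v))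
      rwa [hp _ (hfp v), Submodule.map_smul'', ← LinearMap.range_eq_map] at this
  rw [← LinearMap.ker_eq_bot, LinearMap.ker_eq_bot']
  intro v hv
  have : p v ∈ LinearMap.range p := ⟨v, rfl⟩
  rwa [hbot, Submodule.mem_bot, hp v hv] at this

omit [IsLocalRing Q] in
theorem mem_smul_top_of_forall_mem {V : Type*} [AddCommGroup V] [Module Q V] [Module.Free Q V]
    [Module.Finite Q V] {I : Ideal Q} {φ : V →ₗ[Q] Q} (h : ∀ v, φ v ∈ I) :
    φ ∈ I • (⊤ : Submodule Q (V →ₗ[Q] Q)) := by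
  classical
  let b := Module.Free.chooseBasis Q V
  have : φ = ∑ i, φ (b i) • b.coord i := b.ext fun j => by
    simp
  rw [this]
  exact Submodule.sum_mem _ fun i _ => Submodule.smul_mem_smul (h _) trivial

variable {R : Type u} [AddCommGroup R] [Module Q R]
  {P : ProjectiveResolution (ModuleCat.of Q R)} (hP : IsMinimalFreeResolution P)
  (p : ∀ i j, P.complex.X i →ₗ[Q] P.complex.X j →ₗ[Q] Q)

-- Onto: by `hlift` some `± a` corrects a functional to a cocycle, which lies in the maximal ideal
-- times the dual by `hex`, so Nakayama applies. Injective: a kernel element is a cycle because the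
-- pairing one degree lower is injective, hence a boundary, hence in the maximal ideal times the
-- term; a split surjection with such a kernel is injective.
include hP in
theorem pairing_bijective_step {j i : ℕ}
    (hchain : ∀ x y, p j (i + 1) (resD P j x) y + (-1) ^ j * p (j + 1) i x (resD P i y) = 0)
    (hj : Function.Bijective (p j (i + 1)))
    (hex : ∀ φ : P.complex.X i →ₗ[Q] Q, φ ∘ₗ resD P i = 0 →
      φ ∈ IsLocalRing.maximalIdeal Q • (⊤ : Submodule Q (P.complex.X i →ₗ[Q] Q)))
    (hlift : ∀ ψ : P.complex.X i →ₗ[Q] Q, ∃ a, p j (i + 1) (resD P j a) = ψ ∘ₗ resD P i) :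
    Function.Bijective (p (j + 1) i) := by
  have := hP.free
  have := hP.finite
  have hs : Function.Surjective (p (j + 1) i) := by
    refine surjective_of_sup_smul_top _ fun ψ => ?_
    obtain ⟨a, ha⟩ := hlift ψ
    refine ⟨(-1 : Q) ^ j • a, hex _ (LinearMap.ext fun y => ?_)⟩
    have h1 := hchain a y
    rw [ha] at h1
    simpa using h1
  refine ⟨injective_of_ker_le_smul_top _ hs fun a ha => ?_, hs⟩
  have h1 : resD P j a = 0 := by
    refine hj.1 (LinearMap.ext fun y => ?_)
    have := hchain a y
    rw [ha] at this
    simpa using this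
  obtain ⟨y, rfl⟩ := exists_resD_eq P h1
  exact hP.minimal (j + 1) ⟨y, rfl⟩

include hP in
/-- A pairing of a minimal free resolution with itself is perfect, if it is so in the extreme
degrees and the dual complex is exact below its top degree. -/
theorem pairing_bijective {d : ℕ}
    (hchain : ∀ j i, j + i + 1 = d → ∀ x y,
      p j (i + 1) (resD P j x) y + (-1) ^ j * p (j + 1) i x (resD P i y) = 0)
    (h0 : Function.Bijective (p 0 d))
    (h1 : ∀ (i : ℕ) (x : P.complex.X 0) (ψ : P.complex.X i →ₗ[Q] Q), i + 1 = d →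
      p 0 (i + 1) x = ψ ∘ₗ resD P i → ∃ y, resD P 0 y = x)
    (hex0 : ∀ φ : P.complex.X 0 →ₗ[Q] Q, φ ∘ₗ resD P 0 = 0 → φ = 0)
    (hex : ∀ i, i + 1 < d → ∀ φ : P.complex.X (i + 1) →ₗ[Q] Q, φ ∘ₗ resD P (i + 1) = 0 →
      ∃ ψ : P.complex.X i →ₗ[Q] Q, φ = ψ ∘ₗ resD P i) (j : ℕ) :
    ∀ i, j + i = d → Function.Bijective (p j i) := by
  have := hP.free
  have := hP.finite
  have hex' : ∀ i, i < d → ∀ φ : P.complex.X i →ₗ[Q] Q, φ ∘ₗ resD P i = 0 →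
      φ ∈ IsLocalRing.maximalIdeal Q • (⊤ : Submodule Q (P.complex.X i →ₗ[Q] Q)) := by
    rintro (_ | i) hi φ hφ
    · rw [hex0 φ hφ]
      exact Submodule.zero_mem _
    · obtain ⟨ψ, rfl⟩ := hex i hi φ hφ
      exact mem_smul_top_of_forall_mem fun v => comp_resD_mem hP ψ v
  induction j using Nat.twoStepInduction with
  | zero =>
    intro i hi
    obtain rfl : i = d := by omega
    exact h0
  | one =>
    intro i hi
    obtain rfl : d = i + 1 := by omega
    refine pairing_bijective_step hP p (hchain 0 i (by omega)) h0 (hex' i (by omega)) fun ψ => ?_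
    obtain ⟨x, hx⟩ := h0.2 (ψ ∘ₗ resD P i)
    obtain ⟨y, rfl⟩ := h1 i x ψ rfl hx
    exact ⟨y, hx⟩
  | more j ih1 ih2 =>
    intro i hi
    have hb := ih2 (i + 1) (by omega)
    refine pairing_bijective_step hP p (hchain (j + 1) i (by omega)) hb (hex' i (by omega))
      fun ψ => ?_
    obtain ⟨x, hx⟩ := hb.2 (ψ ∘ₗ resD P i)
    -- The functional `ψ ∘ ∂` is a cocycle, so by injectivity of the pairing two degrees lower its
    -- representative `x` is a cycle. In positive degree that makes it a boundary; degree zero needs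
    -- the hypothesis `h1` instead.
    have hx0 : resD P j x = 0 := by
      refine (ih1 (i + 2) (by omega)).1 (LinearMap.ext fun y => ?_)
      have := hchain j (i + 1) (by omega) x y
      rw [hx, LinearMap.comp_apply, resD_resD, map_zero, mul_zero, add_zero] at this
      rw [this, map_zero, LinearMap.zero_apply]
    obtain ⟨y, rfl⟩ := exists_resD_eq P hx0
    exact ⟨y, hx⟩

end Duality

/-! ### A unital product and the pairing it induces -/

section Product

variable {Q E A : Type*} [CommRing Q] [Fintype E] [AddCommGroup A] [Module Q A]
  (b : Module.Basis E Q A) (deg : E → ℕ) (D : E → E → Q) (δ : A →ₗ[Q] A) (one : E)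

/-- The element `v` is homogeneous of degree `n`. -/
def HasDegree (v : A) (n : ℕ) : Prop := ∀ e, b.repr v e ≠ 0 → deg e = n

variable {b deg} in
omit [Fintype E] in
theorem HasDegree.sub {v w : A} {n : ℕ} (hv : HasDegree b deg v n) (hw : HasDegree b deg w n) :
    HasDegree b deg (v - w) n := fun e he => by
  by_cases h : b.repr v e = 0
  · exact hw e fun h' => he (by simp [h, h'])
  · exact hv e h

variable {b deg} in
omit [Fintype E] in
theorem HasDegree.smul {v : A} {n : ℕ} (hv : HasDegree b deg v n) (c : Q) :
    HasDegree b deg (c • v) n := fun e he => hv e fun h => he (by simp [h])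

variable {b deg} in
omit [Fintype E] in
theorem HasDegree.sum {ι : Type*} {t : Finset ι} {v : ι → A} {n : ℕ}
    (hv : ∀ i ∈ t, HasDegree b deg (v i) n) : HasDegree b deg (∑ i ∈ t, v i) n := fun e he => by
  rw [map_sum, Finsupp.finsetSum_apply] at he
  obtain ⟨i, hi, h⟩ := Finset.exists_ne_zero_of_sum_ne_zero he
  exact hv i hi e h

omit [Fintype E] in
theorem hasDegree_basis (e : E) : HasDegree b deg (b e) (deg e) := fun e' h => by
  classical
  rw [b.repr_self, Finsupp.single_apply] at h
  rw [show e = e' by by_contra h'; exact h (if_neg h')]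

/-- The failure of the Leibniz rule for a product with structure constants `m`. -/
def leibnizDefect (m : E → E → A) (e e' : E) : A :=
  δ (m e e') - ∑ x, D e x • m x e' - (-1 : Q) ^ deg e • ∑ y, D e' y • m e y

variable {b deg D δ one}

/-- A unital product on a free resolution that satisfies the Leibniz rule. -/
theorem exists_product (hD : ∀ e e', D e e' ≠ 0 → deg e' + 1 = deg e)
    (hDD : ∀ e e'', ∑ e', D e e' * D e' e'' = 0) (hδ : ∀ e, δ (b e) = ∑ e', D e e' • b e')
    (hone : ∀ e, deg e = 0 ↔ e = one)
    (hex : ∀ n, 0 < n → ∀ v, HasDegree b deg v n → δ v = 0 →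
      ∃ a, HasDegree b deg a (n + 1) ∧ δ a = v) (n : ℕ) :
    ∃ m : E → E → A, (∀ e, m one e = b e) ∧ (∀ e, m e one = b e) ∧
      (∀ e e', HasDegree b deg (m e e') (deg e + deg e')) ∧
      ∀ e e', deg e + deg e' ≤ n → leibnizDefect deg D δ m e e' = 0 := by
  classical
  have hδδ : ∀ a, δ (δ a) = 0 := by
    have : δ ∘ₗ δ = 0 := b.ext fun e => by
      simp only [LinearMap.comp_apply, hδ, map_sum, map_smul, Finset.smul_sum, smul_smul]
      rw [Finset.sum_comm]
      refine Finset.sum_eq_zero fun e' _ => ?_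
      rw [← Finset.sum_smul, hDD, zero_smul]
    exact fun a => LinearMap.congr_fun this a
  have hδdeg : ∀ v n, HasDegree b deg v (n + 1) → HasDegree b deg (δ v) n := by
    intro v n hv
    rw [← b.sum_repr v, map_sum]
    refine HasDegree.sum fun e _ => ?_
    rw [map_smul]
    by_cases he : b.repr v e = 0
    · rw [he, zero_smul]
      exact fun e' h => absurd (by simp) h
    · have h1 := hv e he
      refine HasDegree.smul ?_ _
      rw [hδ]
      refine HasDegree.sum fun e' _ => ?_
      by_cases h : D e e' = 0
      · rw [h, zero_smul]
        exact fun e' h => absurd (by simp) h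
      · have := hD _ _ h
        rw [show n = deg e' by omega]
        exact (hasDegree_basis b deg e').smul _
  have hD1 : ∀ x, D one x = 0 := fun x => by
    by_contra h
    have := hD _ _ h
    rw [(hone one).2 rfl] at this
    omega
  have hunit : ∀ m : E → E → A, (∀ e, m one e = b e) → (∀ e, m e one = b e) →
      ∀ e e', e = one ∨ e' = one → leibnizDefect deg D δ m e e' = 0 := by
    intro m h1 h2 e e' h
    rcases h with rfl | rfl
    · simp [leibnizDefect, h1, hδ, hD1, (hone e).2 rfl]
    · simp [leibnizDefect, h2, hδ, hD1]
  induction n with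
  | zero =>
    refine ⟨fun e e' => if e = one then b e' else if e' = one then b e else 0,
      fun e => if_pos rfl, fun e => ?_, fun e e' => ?_, fun e e' h => ?_⟩
    · by_cases h : e = one <;> simp [h]
    · simp only
      split_ifs with h1 h2
      · rw [(hone e).2 h1, zero_add]
        exact hasDegree_basis b deg e'
      · rw [(hone e').2 h2, add_zero]
        exact hasDegree_basis b deg e
      · exact fun e' h => absurd (by simp) h
    · refine hunit _ (fun e => if_pos rfl) (fun e => ?_) e e' (Or.inl ((hone e).1 (by omega)))
      by_cases h : e = one <;> simp [h]
  | succ n ih =>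
    obtain ⟨m, h1, h2, h3, h4⟩ := ih
    have hc : ∀ e e', ∃ a, (deg e + deg e' = n + 1 → e ≠ one → e' ≠ one →
        HasDegree b deg a (n + 1) ∧ δ a = leibnizDefect deg D δ m e e') := by
      intro e e'
      by_cases hee : deg e + deg e' = n + 1 ∧ e ≠ one ∧ e' ≠ one
      · obtain ⟨hn, he, he'⟩ := hee
        have hd1 : deg e ≠ 0 := fun h => he ((hone e).1 h)
        have hd2 : deg e' ≠ 0 := fun h => he' ((hone e').1 h)
        -- With both factors different from the unit, the total degree `n + 1` is at least two. The
        -- Leibniz defect thus sits in positive degree `n`, where every cycle bounds.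
        suffices hz : HasDegree b deg (leibnizDefect deg D δ m e e') n ∧
            δ (leibnizDefect deg D δ m e e') = 0 by
          obtain ⟨a, ha⟩ := hex n (by omega) _ hz.1 hz.2
          exact ⟨a, fun _ _ _ => ha⟩
        constructor
        · refine ((hδdeg _ _ ?_).sub (HasDegree.sum fun x _ => ?_)).sub
            ((HasDegree.sum fun y _ => ?_).smul _)
          · rw [← hn]
            exact h3 e e'
          · by_cases h : D e x = 0
            · rw [h, zero_smul]
              exact fun e' h => absurd (by simp) h
            · rw [show n = deg x + deg e' by have := hD _ _ h; omega]
              exact (h3 x e').smul _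
          · by_cases h : D e' y = 0
            · rw [h, zero_smul]
              exact fun e' h => absurd (by simp) h
            · rw [show n = deg e + deg y by have := hD _ _ h; omega]
              exact (h3 e y).smul _
        · have e1 : ∑ x, D e x • δ (m x e') =
              ∑ x, ∑ y, (D e x * (-1) ^ deg x * D e' y) • m x y := by
            have : ∀ x, D e x • δ (m x e') = ∑ z, (D e x * D x z) • m z e' +
                ∑ y, (D e x * (-1) ^ deg x * D e' y) • m x y := by
              intro x
              by_cases h : D e x = 0
              · simp [h]
              · have h5 := h4 x e' (by have := hD _ _ h; omega)
                rw [leibnizDefect, sub_sub, sub_eq_zero] at h5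
                simp only [h5, smul_add, Finset.smul_sum, smul_smul, mul_assoc]
            rw [Finset.sum_congr rfl fun x _ => this x, Finset.sum_add_distrib, Finset.sum_comm]
            simp only [← Finset.sum_smul, hDD, zero_smul, Finset.sum_const_zero, zero_add]
          have e2 : ∑ y, D e' y • δ (m e y) = ∑ x, ∑ y, (D e x * D e' y) • m x y := by
            have : ∀ y, D e' y • δ (m e y) = ∑ x, (D e x * D e' y) • m x y +
                ∑ z, ((-1) ^ deg e * (D e' y * D y z)) • m e z := by
              intro y
              by_cases h : D e' y = 0
              · simp [h]
              · have h5 := h4 e y (by have := hD _ _ h; omega)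
                rw [leibnizDefect, sub_sub, sub_eq_zero] at h5
                simp only [h5, smul_add, Finset.smul_sum, smul_smul]
                congr 1
                · exact Finset.sum_congr rfl fun x _ => by rw [mul_comm]
                · exact Finset.sum_congr rfl fun x _ => by congr 1; ring
            rw [Finset.sum_congr rfl fun x _ => this x, Finset.sum_add_distrib, Finset.sum_comm,
              Finset.sum_comm (f := fun y z => ((-1) ^ deg e * (D e' y * D y z)) • m e z)]
            simp only [← Finset.sum_smul, ← Finset.mul_sum, hDD, mul_zero, zero_smul,
              Finset.sum_const_zero, add_zero]
          rw [leibnizDefect, map_sub, map_sub, hδδ, map_smul, map_sum, map_sum]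
          simp only [map_smul]
          rw [e1, e2, zero_sub, Finset.smul_sum, neg_sub_left, neg_eq_zero,
            ← Finset.sum_add_distrib]
          refine Finset.sum_eq_zero fun x _ => ?_
          rw [Finset.smul_sum, ← Finset.sum_add_distrib]
          refine Finset.sum_eq_zero fun y _ => ?_
          rw [smul_smul, ← add_smul]
          by_cases h : D e x = 0
          · simp [h]
          · rw [← hD _ _ h, pow_succ]
            rw [show (-1) ^ deg x * -1 * (D e x * D e' y) + D e x * (-1) ^ deg x * D e' y = 0 by ring,
              zero_smul]
      · exact ⟨0, fun h5 h6 h7 => absurd ⟨h5, h6, h7⟩ hee⟩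
    choose a ha using hc
    -- Only products of total degree exactly `n + 1` without unit factors change, so the unit law
    -- and the Leibniz rule already obtained persist.
    let m' : E → E → A := fun e e' =>
      if deg e + deg e' = n + 1 ∧ e ≠ one ∧ e' ≠ one then m e e' - a e e' else m e e'
    have h1' : ∀ e, m' one e = b e := fun e => by simp [m', h1]
    have h2' : ∀ e, m' e one = b e := fun e => by simp [m', h2]
    have hlow : ∀ e e', deg e + deg e' ≤ n → m' e e' = m e e' := fun e e' h =>
      if_neg fun h' => by omega
    refine ⟨m', h1', h2', fun e e' => ?_, fun e e' h => ?_⟩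
    · by_cases hee : deg e + deg e' = n + 1 ∧ e ≠ one ∧ e' ≠ one
      · simp only [m', if_pos hee]
        refine (h3 e e').sub ?_
        rw [hee.1]
        exact (ha e e' hee.1 hee.2.1 hee.2.2).1
      · simp only [m', if_neg hee]
        exact h3 e e'
    · by_cases hu : e = one ∨ e' = one
      · exact hunit m' h1' h2' e e' hu
      · push Not at hu
        have e1 : ∑ x, D e x • m' x e' = ∑ x, D e x • m x e' :=
          Finset.sum_congr rfl fun x _ => by
            by_cases hx : D e x = 0
            · simp [hx]
            · rw [hlow x e' (by have := hD _ _ hx; omega)]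
        have e2 : ∑ y, D e' y • m' e y = ∑ y, D e' y • m e y :=
          Finset.sum_congr rfl fun x _ => by
            by_cases hx : D e' x = 0
            · simp [hx]
            · rw [hlow e x (by have := hD _ _ hx; omega)]
        rw [leibnizDefect, e1, e2]
        rcases h.lt_or_eq with h | h
        · rw [hlow e e' (by omega)]
          exact h4 e e' (by omega)
        · simp only [m']
          rw [if_pos ⟨h, hu⟩, map_sub, (ha e e' h hu.1 hu.2).2, leibnizDefect]
          abel

/-- The antisymmetric pairing on the suspension of a resolution of length `d`, obtained from a
product and a functional on the part of degree `d`. -/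
theorem exists_pairing (hD : ∀ e e', D e e' ≠ 0 → deg e' + 1 = deg e)
    (hDD : ∀ e e'', ∑ e', D e e' * D e' e'' = 0) (hδ : ∀ e, δ (b e) = ∑ e', D e e' • b e')
    (hone : ∀ e, deg e = 0 ↔ e = one)
    (hex : ∀ n, 0 < n → ∀ v, HasDegree b deg v n → δ v = 0 →
      ∃ a, HasDegree b deg a (n + 1) ∧ δ a = v)
    {d : ℕ} (hd : Odd d) (hdeg : ∀ e, deg e ≤ d) (h2 : IsUnit (2 : Q))
    {t : E → Q} (ht : ∀ e, t e ≠ 0 → deg e = d) :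
    ∃ ω : A →ₗ[Q] A →ₗ[Q] Q, (∀ x y, ω x y = -ω y x) ∧
      (∀ e e', ω (b e) (b e') ≠ 0 → deg e + deg e' = d) ∧
      (∀ e y, ω (δ (b e)) y + (-1) ^ (deg e + 1) * ω (b e) (δ y) = 0) ∧
      ∀ e, ω (b one) (b e) = t e := by
  classical
  obtain ⟨m, hm1, hm2, hm3, hm4⟩ := exists_product hD hDD hδ hone hex (2 * d)
  obtain ⟨h, hh⟩ := h2.exists_left_inv
  let τ : A →ₗ[Q] Q := b.constr Q t
  have hτ : ∀ e, τ (b e) = t e := b.constr_basis Q t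
  -- The functional `τ` lives in the top degree `d`, and there is nothing in degree `d + 1`.
  have hτδ : ∀ v, τ (δ v) = 0 := by
    have : τ ∘ₗ δ = 0 := b.ext fun e => by
      simp only [LinearMap.comp_apply, hδ, map_sum, map_smul, hτ, LinearMap.zero_apply]
      refine Finset.sum_eq_zero fun e' _ => ?_
      by_contra hne
      have h3 := hD _ _ (left_ne_zero_of_mul hne)
      have h4 := ht _ (right_ne_zero_of_mul hne)
      have := hdeg e
      omega
    exact fun v => LinearMap.congr_fun this v
  let g : E → E → Q := fun e e' => τ (m e e')
  have hg : ∀ e e', g e e' ≠ 0 → deg e + deg e' = d := by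
    intro e e' hne
    have h3 := hm3 e e'
    simp only [g] at hne
    rw [← b.sum_repr (m e e'), map_sum] at hne
    obtain ⟨x, -, hx⟩ := Finset.exists_ne_zero_of_sum_ne_zero hne
    rw [map_smul, hτ] at hx
    rw [← h3 x (left_ne_zero_of_mul hx), ht _ (right_ne_zero_of_mul hx)]
  have hleib : ∀ e e', ∑ x, D e x * g x e' = -((-1) ^ deg e * ∑ y, D e' y * g e y) := by
    intro e e'
    have h3 := hm4 e e' (by have := hdeg e; have := hdeg e'; omega)
    have h4 := congrArg τ h3
    rw [leibnizDefect, map_sub, map_sub, hτδ, map_smul, map_sum, map_sum, map_zero, zero_sub] at h4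
    simp only [map_smul, smul_eq_mul] at h4
    linear_combination -h4
  -- Symmetrization with `h = 1 / 2`. No Koszul sign is needed, as one of two degrees with odd sum
  -- `d` is even. The factor `(-1) ^ deg e` turns the symmetric form into an antisymmetric one on
  -- the suspension.
  let w : E → E → Q := fun e e' => h * (-1) ^ deg e * (g e e' + g e' e)
  have hwd : ∀ e e', w e e' ≠ 0 → deg e + deg e' = d := by
    intro e e' hne
    by_cases h0 : g e e' = 0
    · have := hg e' e fun h0' => hne (by simp [w, h0, h0'])
      omega
    · exact hg _ _ h0
  let ω : A →ₗ[Q] A →ₗ[Q] Q := b.constr Q fun e => b.constr Q (w e)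
  have hω : ∀ e e', ω (b e) (b e') = w e e' := fun e e' => by
    simp only [ω, b.constr_basis]
  refine ⟨ω, fun x y => ?_, fun e e' he => hwd e e' (by rwa [← hω]), fun e y => ?_, fun e => ?_⟩
  · have : ω = -ω.flip := b.ext fun e => b.ext fun e' => by
      simp only [LinearMap.neg_apply, LinearMap.flip_apply, hω]
      by_cases h0 : g e e' + g e' e = 0
      · simp [w, h0, add_comm (g e' e)]
      · have h3 : deg e + deg e' = d := hwd e e' |> fun h3 => by
          by_cases h0' : g e e' = 0
          · have := hg e' e fun h0'' => h0 (by simp [h0', h0''])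
            omega
          · exact hg _ _ h0'
        have h4 : (-1 : Q) ^ deg e * (-1) ^ deg e' = -1 := by
          rw [← pow_add, h3, hd.neg_one_pow]
        have h5 : (-1 : Q) ^ deg e' * (-1) ^ deg e' = 1 := by
          rw [← mul_pow]; simp
        simp only [w]
        linear_combination (h * (-1) ^ deg e' * (g e e' + g e' e)) * h4 -
          (h * (-1) ^ deg e * (g e e' + g e' e)) * h5
    exact LinearMap.congr_fun (LinearMap.congr_fun this x) y
  · have : ω (δ (b e)) + (-1 : Q) ^ (deg e + 1) • (ω (b e)) ∘ₗ δ = 0 := b.ext fun e' => by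
      simp only [LinearMap.add_apply, LinearMap.smul_apply, LinearMap.comp_apply, hδ, map_sum,
        map_smul, LinearMap.sum_apply, hω, smul_eq_mul, LinearMap.zero_apply]
      have e1 : ∑ x, D e x * w x e' =
          -(h * (-1) ^ deg e * (∑ x, D e x * g x e' + ∑ x, D e x * g e' x)) := by
        rw [← Finset.sum_add_distrib, Finset.mul_sum, ← Finset.sum_neg_distrib]
        refine Finset.sum_congr rfl fun x _ => ?_
        by_cases h0 : D e x = 0
        · simp [h0]
        · simp only [w]
          rw [← hD _ _ h0, pow_succ]
          ring
      have e2 : ∑ y, D e' y * w e y =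
          h * (-1) ^ deg e * (∑ y, D e' y * g e y + ∑ y, D e' y * g y e) := by
        rw [← Finset.sum_add_distrib, Finset.mul_sum]
        exact Finset.sum_congr rfl fun x _ => by simp only [w]; ring
      -- Where `D e x * g e' x` is nonzero, the degrees of `e` and `e'` add up to the even number `d
      -- + 1`.
      have e3 : (-1) ^ deg e' * ∑ x, D e x * g e' x = (-1) ^ deg e * ∑ x, D e x * g e' x := by
        rw [Finset.mul_sum, Finset.mul_sum]
        refine Finset.sum_congr rfl fun x _ => ?_
        by_cases h0 : D e x * g e' x = 0
        · rw [h0, mul_zero, mul_zero]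
        · have h3 := hD _ _ (left_ne_zero_of_mul h0)
          have h4 := hg _ _ (right_ne_zero_of_mul h0)
          congr 1
          have h5 : Even (deg e' + deg e) := by
            rw [← h3, ← add_assoc, h4]
            exact hd.add_one
          rcases Nat.even_add.1 h5 with h6
          by_cases h7 : Even (deg e')
          · rw [h7.neg_one_pow, (h6.1 h7).neg_one_pow]
          · have h8 : ¬ Even (deg e) := fun h9 => h7 (h6.2 h9)
            rw [(Nat.not_even_iff_odd.1 h7).neg_one_pow, (Nat.not_even_iff_odd.1 h8).neg_one_pow]
      have h5 : (-1 : Q) ^ deg e * (-1) ^ deg e = 1 := by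
        rw [← mul_pow]; simp
      rw [e1, e2, pow_succ, hleib e e', hleib e' e, e3]
      linear_combination (h * (-1) ^ deg e * ∑ x, D e x * g e' x) * h5
    exact LinearMap.congr_fun this y
  · rw [hω]
    simp only [w, g, hm1, hm2, hτ, (hone one).2 rfl, pow_zero, mul_one]
    linear_combination t e * hh

end Product

/-! ### The direct sum of the terms, with basis and differential matrix -/

section Total

variable {Q : Type u} [CommRing Q] {R : Type u} [AddCommGroup R] [Module Q R]
  (P : ProjectiveResolution (ModuleCat.of Q R))

/-- The inclusion of a term of the resolution in the total module. -/
abbrev totalIncl (n : ℕ) : P.complex.X n →ₗ[Q] totalModule P.complex :=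
  DirectSum.lof Q ℕ (fun k => P.complex.X k) n

/-- The projection of the total module to a term of the resolution. -/
abbrev totalProj (n : ℕ) : totalModule P.complex →ₗ[Q] P.complex.X n :=
  DirectSum.component Q ℕ (fun k => P.complex.X k) n

theorem totalProj_totalIncl_self (n : ℕ) (x : P.complex.X n) :
    totalProj P n (totalIncl P n x) = x := DirectSum.component.lof_self _ _ _

theorem totalProj_totalIncl_of_ne {n m : ℕ} (h : n ≠ m) (x : P.complex.X n) :
    totalProj P m (totalIncl P n x) = 0 :=
  (DirectSum.component.of (R := Q) (M := fun k => P.complex.X k) m n x).trans (dif_neg h)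

theorem totalModule_ext {x y : totalModule P.complex}
    (h : ∀ n, totalProj P n x = totalProj P n y) : x = y := DirectSum.ext_component Q h

theorem totalDiff_totalIncl_succ (n : ℕ) (x : P.complex.X (n + 1)) :
    totalDiff P.complex (totalIncl P (n + 1) x) = totalIncl P n (resD P n x) :=
  DirectSum.toModule_lof _ _ _

theorem totalDiff_totalIncl_zero (x : P.complex.X 0) :
    totalDiff P.complex (totalIncl P 0 x) = 0 := by
  refine (DirectSum.toModule_lof _ _ _).trans ?_
  rw [P.complex.shape 0 (0 - 1) (by simp)]
  simp

theorem totalProj_totalDiff (n : ℕ) (x : totalModule P.complex) :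
    totalProj P n (totalDiff P.complex x) = resD P n (totalProj P (n + 1) x) := by
  suffices totalProj P n ∘ₗ totalDiff P.complex = resD P n ∘ₗ totalProj P (n + 1) from
    LinearMap.congr_fun this x
  refine DirectSum.linearMap_ext Q fun m => LinearMap.ext fun y => ?_
  change totalProj P n (totalDiff P.complex (totalIncl P m y)) =
    resD P n (totalProj P (n + 1) (totalIncl P m y))
  rcases m with _ | m
  · rw [totalDiff_totalIncl_zero, totalProj_totalIncl_of_ne P (by omega), map_zero, map_zero]
  · rw [totalDiff_totalIncl_succ]
    by_cases h : m = n
    · subst h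
      rw [totalProj_totalIncl_self, totalProj_totalIncl_self]
    · rw [totalProj_totalIncl_of_ne P h, totalProj_totalIncl_of_ne P (by omega), map_zero]

theorem totalDiff_totalDiff (x : totalModule P.complex) :
    totalDiff P.complex (totalDiff P.complex x) = 0 := totalModule_ext P fun n => by
  rw [totalProj_totalDiff, totalProj_totalDiff, resD_resD, map_zero]

variable {ι : ℕ → Type u} (bs : ∀ n, Module.Basis (ι n) Q (P.complex.X n))

/-- The basis of the total module given by bases of the terms of the resolution. -/
def totalBasis : Module.Basis (Σ n, ι n) Q (totalModule P.complex) := DFinsupp.basis bs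

theorem totalBasis_repr (x : totalModule P.complex) (e : Σ n, ι n) :
    (totalBasis P bs).repr x e = (bs e.1).repr (totalProj P e.1 x) e.2 := rfl

theorem totalBasis_apply (e : Σ n, ι n) :
    totalBasis P bs e = totalIncl P e.1 (bs e.1 e.2) := by
  classical
  refine (totalBasis P bs).repr.injective (Finsupp.ext fun e' => ?_)
  rw [Module.Basis.repr_self, totalBasis_repr]
  obtain ⟨n, i⟩ := e
  obtain ⟨m, j⟩ := e'
  by_cases h : n = m
  · subst h
    rw [totalProj_totalIncl_self, Module.Basis.repr_self]
    simp [Finsupp.single_apply]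
  · rw [totalProj_totalIncl_of_ne P h, map_zero, Finsupp.single_eq_of_ne (by rintro ⟨⟩; exact h rfl)]
    rfl

variable {P bs}

theorem hasDegree_totalBasis_iff {x : totalModule P.complex} {n : ℕ} :
    HasDegree (totalBasis P bs) Sigma.fst x n ↔ ∀ m, m ≠ n → totalProj P m x = 0 := by
  constructor
  · intro h m hm
    refine (bs m).repr.injective (Finsupp.ext fun i => ?_)
    rw [map_zero]
    by_contra hi
    exact hm (h ⟨m, i⟩ hi)
  · intro h e he
    by_contra hn
    rw [totalBasis_repr, h _ hn, map_zero] at he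
    exact he rfl

theorem eq_totalIncl_of_hasDegree {x : totalModule P.complex} {n : ℕ}
    (h : HasDegree (totalBasis P bs) Sigma.fst x n) : x = totalIncl P n (totalProj P n x) :=
  totalModule_ext P fun m => by
    by_cases hm : n = m
    · subst hm
      rw [totalProj_totalIncl_self]
    · rw [totalProj_totalIncl_of_ne P hm, hasDegree_totalBasis_iff.1 h m (Ne.symm hm)]

theorem hasDegree_totalIncl (n : ℕ) (x : P.complex.X n) :
    HasDegree (totalBasis P bs) Sigma.fst (totalIncl P n x) n :=
  hasDegree_totalBasis_iff.2 fun _ hm => totalProj_totalIncl_of_ne P (Ne.symm hm) x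

theorem exists_hasDegree_totalDiff_eq {n : ℕ} (hn : 0 < n) {v : totalModule P.complex}
    (hv : HasDegree (totalBasis P bs) Sigma.fst v n) (h : totalDiff P.complex v = 0) :
    ∃ a, HasDegree (totalBasis P bs) Sigma.fst a (n + 1) ∧ totalDiff P.complex a = v := by
  obtain ⟨n, rfl⟩ := Nat.exists_eq_succ_of_ne_zero hn.ne'
  have h1 := congrArg (totalProj P n) h
  rw [totalProj_totalDiff, map_zero] at h1
  obtain ⟨y, hy⟩ := exists_resD_eq P h1
  refine ⟨totalIncl P (n + 2) y, hasDegree_totalIncl _ _, ?_⟩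
  rw [totalDiff_totalIncl_succ, hy]
  exact (eq_totalIncl_of_hasDegree hv).symm

variable (P bs)

/-- The matrix of the differential. -/
def totalMatrix (e e' : Σ n, ι n) : Q :=
  (totalBasis P bs).repr (totalDiff P.complex (totalBasis P bs e)) e'

theorem totalMatrix_deg {e e' : Σ n, ι n} (h : totalMatrix P bs e e' ≠ 0) : e'.1 + 1 = e.1 := by
  by_contra h'
  rw [totalMatrix, totalBasis_repr, totalProj_totalDiff, totalBasis_apply,
    totalProj_totalIncl_of_ne P (Ne.symm h'), map_zero, map_zero] at h
  exact h rfl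

variable [Fintype (Σ n, ι n)]

theorem totalDiff_totalBasis (e : Σ n, ι n) : totalDiff P.complex (totalBasis P bs e) =
    ∑ e', totalMatrix P bs e e' • totalBasis P bs e' :=
  ((totalBasis P bs).sum_repr _).symm

theorem sum_totalMatrix_mul (φ : totalModule P.complex →ₗ[Q] Q) (e : Σ n, ι n) :
    ∑ e', totalMatrix P bs e e' * φ (totalBasis P bs e') =
      φ (totalDiff P.complex (totalBasis P bs e)) := by
  rw [totalDiff_totalBasis, map_sum]
  simp

theorem totalMatrix_mul (e e'' : Σ n, ι n) :
    ∑ e', totalMatrix P bs e e' * totalMatrix P bs e' e'' = 0 := by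
  refine (sum_totalMatrix_mul P bs ((totalBasis P bs).coord e'' ∘ₗ totalDiff P.complex) e).trans ?_
  rw [LinearMap.comp_apply, totalDiff_totalDiff, map_zero]

theorem totalMatrix_exact {d : ℕ}
    (hex0 : ∀ φ : P.complex.X 0 →ₗ[Q] Q, φ ∘ₗ resD P 0 = 0 → φ = 0)
    (hex : ∀ i, i + 1 < d → ∀ φ : P.complex.X (i + 1) →ₗ[Q] Q, φ ∘ₗ resD P (i + 1) = 0 →
      ∃ ψ : P.complex.X i →ₗ[Q] Q, φ = ψ ∘ₗ resD P i) (j : ℕ) (hj : j < d)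
    (φ : (Σ n, ι n) → Q) (hφ : ∀ e, e.1 ≠ j → φ e = 0)
    (h : ∀ e, ∑ e', totalMatrix P bs e e' * φ e' = 0) :
    ∃ ψ : (Σ n, ι n) → Q, (∀ e, e.1 + 1 ≠ j → ψ e = 0) ∧
      ∀ e, φ e = ∑ e', totalMatrix P bs e e' * ψ e' := by
  let f : P.complex.X j →ₗ[Q] Q := (bs j).constr Q fun i => φ ⟨j, i⟩
  have hf : ∀ e, φ e = (f ∘ₗ totalProj P j) (totalBasis P bs e) := by
    intro e
    rw [LinearMap.comp_apply, totalBasis_apply]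
    by_cases he : e.1 = j
    · obtain ⟨n, i⟩ := e
      subst he
      rw [totalProj_totalIncl_self]
      exact ((bs n).constr_basis Q (fun i => φ ⟨n, i⟩) i).symm
    · rw [totalProj_totalIncl_of_ne P he, map_zero, hφ e he]
  have hcomp : f ∘ₗ resD P j = 0 := (bs (j + 1)).ext fun i => by
    have h1 := h ⟨j + 1, i⟩
    simp only [hf, sum_totalMatrix_mul] at h1
    rw [LinearMap.comp_apply, totalProj_totalDiff, totalBasis_apply, totalProj_totalIncl_self] at h1
    exact h1
  rcases j with _ | j
  · refine ⟨0, fun _ _ => rfl, fun e => ?_⟩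
    rw [hf, hex0 f hcomp]
    simp
  · obtain ⟨ψ, hψ⟩ := hex j hj f hcomp
    refine ⟨fun e => (ψ ∘ₗ totalProj P j) (totalBasis P bs e), fun e he => ?_, fun e => ?_⟩
    · beta_reduce
      rw [LinearMap.comp_apply, totalBasis_apply, totalProj_totalIncl_of_ne P (by omega), map_zero]
    · rw [hf, sum_totalMatrix_mul, LinearMap.comp_apply, LinearMap.comp_apply,
        totalProj_totalDiff, hψ]
      rfl

end Total

/-! ### The paired complex of a Gorenstein homomorphism -/

section Gorenstein

variable {Q : Type u} [CommRing Q] [IsLocalRing Q] {R : Type u} [CommRing R] [IsLocalRing R]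
  [Algebra Q R] {P : ProjectiveResolution (ModuleCat.of Q R)}

/-- The minimal free resolution of a cyclic module starts with a free module of rank one. -/
theorem exists_basis_of_resAug (hP : IsMinimalFreeResolution P)
    (hsurj : Function.Surjective (algebraMap Q R)) {ι : Type*}
    (b : Module.Basis ι Q (P.complex.X 0)) :
    ∃ (_ : Unique ι) (b' : Module.Basis ι Q (P.complex.X 0)), resAug P (b' default) = (1 : R) := by
  obtain ⟨t, ht⟩ := resAug_surjective P (1 : R)
  obtain ⟨hn, hs, hu⟩ := rank_one_of_ker_le hsurj b (resAug P) (fun v hv j => by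
    obtain ⟨y, rfl⟩ := exists_resD_eq_of_resAug P hv
    exact comp_resD_mem hP (b.coord j) y) ht
  let U : Unique ι := @Unique.mk' ι ⟨hn.some⟩ hs
  refine ⟨U, b.unitsSMul fun j => (hu j).unit, ?_⟩
  have : Fintype ι := Unique.fintype
  rw [Module.Basis.unitsSMul_apply, ← ht]
  congr 1
  conv_rhs => rw [← b.sum_repr t]
  rw [Fintype.sum_unique]
  rfl

/-- The last module of the minimal resolution of a Gorenstein algebra has rank one. -/
theorem top_rank_one (hP : IsMinimalFreeResolution P) {d i : ℕ} (hR : IsSurjectiveGorenstein Q R d)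
    (hi : i + 1 = d) {ι : Type*} [Finite ι] (b : Module.Basis ι Q (P.complex.X (i + 1))) :
    Nonempty ι ∧ Subsingleton ι ∧ ∀ (j : ι) (q : Q) (ψ : P.complex.X i →ₗ[Q] Q),
      q • b.coord j = ψ ∘ₗ resD P i → algebraMap Q R q = 0 := by
  classical
  subst hi
  obtain ⟨e⟩ := hR.ext_self
  have hsub : Subsingleton (P.complex.X (i + 1 + 1)) :=
    subsingleton_of_gorenstein hP hR.finite_projectiveDimension hR.ext_other (by omega)
  obtain ⟨θ, hθ, hθ0⟩ := exists_linearMap_of_ext P e (LinearMap.ext fun x => by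
    rw [Subsingleton.elim x 0, map_zero, map_zero])
  obtain ⟨t, ht⟩ := hθ 1
  -- The dual of the last term maps onto `Ext^d ≅ R` with kernel the coboundaries, whose coordinates
  -- lie in the maximal ideal by minimality.
  obtain ⟨hn, hs, hu⟩ := rank_one_of_ker_le hR.surjective b.dualBasis θ (fun φ hφ j => by
    obtain ⟨ψ, rfl⟩ := (hθ0 φ).1 hφ
    rw [Module.Basis.dualBasis_repr]
    exact comp_resD_mem hP ψ _) ht
  refine ⟨hn, hs, fun j q ψ h => ?_⟩
  have h1 : t = (b.dualBasis.repr t j) • b.coord j := b.ext fun k => by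
    rw [Subsingleton.elim k j, Module.Basis.dualBasis_repr]
    simp
  have h2 : θ (q • b.coord j) = 0 := (hθ0 _).2 ⟨ψ, h⟩
  -- Here `t` is a multiple of the coordinate functional, so `q` kills the class `θ t = 1`.
  have h3 : θ (q • t) = 0 := by
    rw [h1, smul_comm, map_smul, h2, smul_zero]
  rw [map_smul, ht, Algebra.smul_def, mul_one] at h3
  exact h3

/-- The functional used for the pairing is the coordinate of the rank one term in degree `d`. Since
the product is unital, pairing degree zero with degree `d` is multiplication of coordinates, hence
perfect, and `pairing_bijective` carries this to all degrees. -/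
theorem exists_pairedComplex {d : ℕ} (hd : Odd d) (hR : IsSurjectiveGorenstein Q R d)
    (hP : IsMinimalFreeResolution P) (h2 : IsUnit (2 : Q)) :
    ∃ (E : Type u) (_ : Fintype E) (X : PairedComplex Q E (totalModule P.complex)), X.d = d ∧
      X.δ = totalDiff P.complex ∧ resAug P (totalProj P 0 (X.b X.one)) = (1 : R) ∧
      ∀ v n, HasDegree X.b X.deg v n ↔ ∀ m, m ≠ n → totalProj P m v = 0 := by
  classical
  have := hP.free
  have := hP.finite
  obtain ⟨c, hc⟩ := Nat.exists_eq_succ_of_ne_zero hd.pos.ne'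
  have hzero : ∀ n, d < n → Subsingleton (P.complex.X n) := fun n hn =>
    subsingleton_of_gorenstein hP hR.finite_projectiveDimension hR.ext_other hn
  let ι : ℕ → Type u := fun n => Module.Free.ChooseBasisIndex Q (P.complex.X n)
  obtain ⟨hU, b0, hb0⟩ := exists_basis_of_resAug hP hR.surjective
    (Module.Free.chooseBasis Q (P.complex.X 0))
  let bs : ∀ n, Module.Basis (ι n) Q (P.complex.X n)
    | 0 => b0
    | n + 1 => Module.Free.chooseBasis Q (P.complex.X (n + 1))
  have hι : ∀ e : Σ n, ι n, e.1 ≤ d := fun e => by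
    by_contra h
    have := hzero e.1 (by omega)
    exact (bs e.1).ne_zero e.2 (Subsingleton.elim _ _)
  have hfin : Finite (Σ n, ι n) :=
    Finite.of_injective (β := Σ n : Fin (d + 1), ι n)
      (fun e => ⟨⟨e.1, Nat.lt_succ_of_le (hι e)⟩, e.2⟩) (by
        rintro ⟨n, i⟩ ⟨m, j⟩ h
        simp only [Sigma.mk.injEq, Fin.mk.injEq] at h
        obtain ⟨rfl, h⟩ := h
        rw [eq_of_heq h])
  have : Fintype (Σ n, ι n) := Fintype.ofFinite _
  obtain ⟨hn, hs, htop⟩ := top_rank_one hP hR hc.symm (bs (c + 1))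
  have hone : ∀ e : Σ n, ι n, e.1 = 0 ↔ e = ⟨0, hU.default⟩ := by
    rintro ⟨n, i⟩
    constructor
    · rintro rfl
      rw [hU.eq_default i]
    · rintro ⟨⟩
      rfl
  obtain ⟨ω, hω1, hω2, hω3, hω4⟩ := exists_pairing (b := totalBasis P bs) (deg := Sigma.fst)
    (D := totalMatrix P bs) (δ := totalDiff P.complex) (one := ⟨0, hU.default⟩)
    (fun _ _ => totalMatrix_deg P bs) (totalMatrix_mul P bs) (totalDiff_totalBasis P bs) hone
    (fun n hn v hv h => exists_hasDegree_totalDiff_eq hn hv h) hd hι h2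
    (t := fun e => if e.1 = d then 1 else 0) (fun e he => by by_contra h; exact he (if_neg h))
  have hex0 : ∀ φ : P.complex.X 0 →ₗ[Q] Q, φ ∘ₗ resD P 0 = 0 → φ = 0 := fun φ hφ =>
    eq_zero_of_comp_resD (N := ModuleCat.of Q Q) P (hR.ext_other 0 hd.pos.ne) φ hφ
  have hex : ∀ i, i + 1 < d → ∀ φ : P.complex.X (i + 1) →ₗ[Q] Q, φ ∘ₗ resD P (i + 1) = 0 →
      ∃ ψ : P.complex.X i →ₗ[Q] Q, φ = ψ ∘ₗ resD P i := fun i hi φ hφ =>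
    exists_eq_comp_resD (N := ModuleCat.of Q Q) P (hR.ext_other _ hi.ne) φ hφ
  let p : ∀ i j, P.complex.X i →ₗ[Q] P.complex.X j →ₗ[Q] Q := fun i j =>
    (ω.domRestrict₁₂ (LinearMap.range (totalIncl P i)) (LinearMap.range (totalIncl P j))).compl₁₂
      (totalIncl P i).rangeRestrict (totalIncl P j).rangeRestrict
  have hp : ∀ i j x y, p i j x y = ω (totalIncl P i x) (totalIncl P j y) := fun _ _ _ _ => rfl
  have hpz : ∀ i j, i + j ≠ d → ∀ x y, ω (totalIncl P i x) (totalIncl P j y) = 0 := by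
    intro i j hij
    suffices p i j = 0 from fun x y => by rw [← hp, this]; rfl
    refine (bs i).ext fun k => (bs j).ext fun l => ?_
    rw [hp]
    by_contra h
    have := hω2 ⟨i, k⟩ ⟨j, l⟩ (by rw [totalBasis_apply, totalBasis_apply]; exact h)
    exact hij this
  have hbij : ∀ j i, j + i = d → Function.Bijective (p j i) := by
    have hp0 : ∀ x (j : ι (c + 1)), p 0 (c + 1) x = b0.repr x default • (bs (c + 1)).coord j := by
      intro x j
      refine (bs (c + 1)).ext fun k => ?_
      have h1 := hω4 ⟨c + 1, k⟩
      rw [totalBasis_apply, totalBasis_apply] at h1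
      have : Fintype (ι 0) := Unique.fintype
      conv_lhs => rw [← b0.sum_repr x]
      rw [Fintype.sum_unique, map_smul, LinearMap.smul_apply, hp]
      refine (congrArg _ h1).trans ?_
      rw [if_pos hc.symm, Subsingleton.elim k j]
      simp
    refine fun j i => pairing_bijective hP p (fun j i hji x y => ?_) ?_ ?_ hex0 hex j i
    · have h1 : ∀ x y, ω (totalDiff P.complex (totalIncl P (j + 1) x)) y +
          (-1) ^ j * ω (totalIncl P (j + 1) x) (totalDiff P.complex y) = 0 := by
        intro x y
        suffices ω.flip y ∘ₗ totalDiff P.complex ∘ₗ totalIncl P (j + 1) + (-1 : Q) ^ j •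
            (ω.flip (totalDiff P.complex y) ∘ₗ totalIncl P (j + 1)) = 0 from
          LinearMap.congr_fun this x
        refine (bs (j + 1)).ext fun k => ?_
        have := hω3 ⟨j + 1, k⟩ y
        rw [totalBasis_apply, pow_add _ _ 1, pow_succ, pow_one, mul_assoc, mul_assoc, neg_one_mul,
          neg_one_mul, neg_neg] at this
        exact this
      have h3 := h1 x (totalIncl P (i + 1) y)
      rw [totalDiff_totalIncl_succ, totalDiff_totalIncl_succ] at h3
      exact h3
    · subst hc
      obtain ⟨j⟩ := hn
      change Function.Bijective (p 0 (c + 1))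
      refine ⟨(injective_iff_map_eq_zero _).2 fun x hx => ?_, fun φ => ?_⟩
      · have h1 := LinearMap.congr_fun (hp0 x j) (bs (c + 1) j)
        rw [hx] at h1
        refine b0.repr.injective (Finsupp.ext fun k => ?_)
        rw [hU.eq_default k, map_zero]
        simpa using h1.symm
      · refine ⟨φ (bs (c + 1) j) • b0 default, (hp0 _ j).trans ((bs (c + 1)).ext fun k => ?_)⟩
        rw [Subsingleton.elim k j]
        simp
    · rintro i x ψ hi h
      obtain rfl : i = c := by omega
      obtain ⟨j⟩ := hn
      -- An element of degree zero pairing to a coboundary has its coefficient in the kernel of `Q →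
      -- R`, hence is killed by the augmentation and bounds.
      have h1 := htop j (b0.repr x default) ψ ((hp0 x j).symm.trans h)
      refine exists_resD_eq_of_resAug P ?_
      have : Fintype (ι 0) := Unique.fintype
      rw [← b0.sum_repr x, Fintype.sum_unique, map_smul, hb0, Algebra.smul_def, h1, zero_mul]
  have hloc : ∀ i j, i + j = d → ∀ x y,
      ω x (totalIncl P j y) = p i j (totalProj P i x) y := by
    intro i j hij x y
    suffices ω.flip (totalIncl P j y) = (p i j).flip y ∘ₗ totalProj P i from
      LinearMap.congr_fun this x
    refine DirectSum.linearMap_ext Q fun m => LinearMap.ext fun z => ?_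
    change ω (totalIncl P m z) (totalIncl P j y) = p i j (totalProj P i (totalIncl P m z)) y
    by_cases hm : m = i
    · subst hm
      rw [totalProj_totalIncl_self, hp]
    · rw [totalProj_totalIncl_of_ne P hm, map_zero, hpz m j (by omega)]
      rfl
  have hωbij : Function.Bijective ω := by
    refine ⟨(injective_iff_map_eq_zero _).2 fun x hx => totalModule_ext P fun n => ?_, fun φ => ?_⟩
    · rw [map_zero]
      by_cases hnd : n ≤ d
      · refine (injective_iff_map_eq_zero _).1 (hbij n (d - n) (by omega)).1 _
          (LinearMap.ext fun y => ?_)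
        rw [← hloc n (d - n) (by omega), hx]
        rfl
      · have := hzero n (by omega)
        exact Subsingleton.elim _ _
    · choose x hx using fun n : Fin (d + 1) =>
        (hbij n (d - n) (by omega)).2 (φ ∘ₗ totalIncl P (d - n))
      refine ⟨∑ n : Fin (d + 1), totalIncl P n (x n), DirectSum.linearMap_ext Q fun j =>
        LinearMap.ext fun y => ?_⟩
      change ω (∑ n : Fin (d + 1), totalIncl P n (x n)) (totalIncl P j y) = φ (totalIncl P j y)
      by_cases hj : j ≤ d
      · obtain ⟨n, rfl⟩ : ∃ n : Fin (d + 1), d - n = j := ⟨⟨d - j, by omega⟩, by simp; omega⟩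
        rw [hloc n (d - n) (by omega), map_sum, Finset.sum_eq_single n, totalProj_totalIncl_self,
          hx]
        · rfl
        · intro m _ hm
          exact totalProj_totalIncl_of_ne P (fun h => hm (Fin.ext h)) _
        · exact fun h => absurd (Finset.mem_univ _) h
      · have := hzero j (by omega)
        rw [Subsingleton.elim y 0, map_zero, map_zero, map_zero]
  refine ⟨Σ n, ι n, inferInstance,
    { deg := Sigma.fst
      D := totalMatrix P bs
      D_deg := fun _ _ => totalMatrix_deg P bs
      D_D := totalMatrix_mul P bs
      one := ⟨0, hU.default⟩
      deg_eq_zero := hone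
      d := d
      exact := totalMatrix_exact P bs hex0 hex
      b := totalBasis P bs
      δ := totalDiff P.complex
      δ_b := totalDiff_totalBasis P bs
      ω := ω
      ω_antisymm := hω1
      ω_deg := hω2
      ω_δ' := hω3
      ω_bijective := hωbij
      d_odd := hd }, rfl, rfl, ?_, fun v n => hasDegree_totalBasis_iff⟩
  rw [totalBasis_apply, totalProj_totalIncl_self]
  exact hb0

end Gorenstein

/-! ### Signs in the base ring -/

section Sign

variable (Q : Type*) [CommRing Q]

/-- The sign `(-1)^k` as an element of `Q`. -/
def sgn (k : ℤ) : Q := ((k.negOnePow : ℤ) : Q)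

theorem sgn_zero : sgn Q 0 = 1 := by simp [sgn]

theorem sgn_one : sgn Q 1 = -1 := by simp [sgn]

theorem sgn_add (k l : ℤ) : sgn Q (k + l) = sgn Q k * sgn Q l := by
  simp [sgn, Int.negOnePow_add]

theorem sgn_sum {ι : Type*} (t : Finset ι) (k : ι → ℤ) :
    sgn Q (∑ i ∈ t, k i) = ∏ i ∈ t, sgn Q (k i) := by
  classical
  induction t using Finset.induction_on with
  | empty => exact sgn_zero Q
  | insert i t hi ih => rw [Finset.sum_insert hi, Finset.prod_insert hi, sgn_add, ih]

theorem sgn_eq {k l : ℤ} (h : Even (k - l)) : sgn Q k = sgn Q l := by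
  rw [sgn, sgn, (Int.negOnePow_eq_iff k l).2 h]

theorem sgn_natCast (n : ℕ) : sgn Q n = (-1) ^ n := by
  rw [sgn, Int.coe_negOnePow_natCast]
  simp

variable {Q}

theorem negOnePow_smul {A : Type*} [AddCommGroup A] [Module Q A] (k : ℤ) (a : A) :
    k.negOnePow • a = sgn Q k • a := by
  rw [sgn, Int.cast_smul_eq_zsmul, Units.smul_def]

end Sign

/-! ### Insertion sums indexed as in the Stasheff identities -/

section Segment

variable {α M : Type*} [AddCommGroup M]

/-- The list of the `n` terms of a sequence from the `k`th on. -/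
def segment (a : ℕ → α) : ℕ → ℕ → List α
  | _, 0 => []
  | k, n + 1 => a k :: segment a (k + 1) n

theorem segment_congr {a b : ℕ → α} {k l n : ℕ} (h : ∀ i < n, a (k + i) = b (l + i)) :
    segment a k n = segment b l n := by
  induction n generalizing k l with
  | zero => rfl
  | succ n ih =>
    have h0 := h 0 n.succ_pos
    simp only [add_zero] at h0
    rw [segment, segment, h0, ih fun i hi => ?_]
    have := h (i + 1) (by omega)
    rwa [add_right_comm, add_right_comm l, add_assoc, add_assoc]

theorem segment_add (a : ℕ → α) (k m n : ℕ) :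
    segment a k (m + n) = segment a k m ++ segment a (k + m) n := by
  induction m generalizing k with
  | zero => rw [Nat.zero_add]; rfl
  | succ m ih =>
    rw [Nat.add_right_comm, segment, ih, segment, List.cons_append, Nat.add_right_comm k 1 m]
    rfl

theorem segment_eq_ofFn (a : ℕ → α) (k n : ℕ) :
    segment a k n = List.ofFn fun i : Fin n => a (k + i) := by
  induction n generalizing k with
  | zero => rfl
  | succ n ih =>
    rw [segment, ih, List.ofFn_succ]
    simp [Nat.add_assoc, Nat.add_comm 1]

theorem splitSum_segment (f : List α → List α → M) (a : ℕ → α) (k n : ℕ) :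
    splitSum f (segment a k n) = ∑ q ∈ Finset.HasAntidiagonal.antidiagonal n,
      f (segment a k q.1) (segment a (k + q.1) q.2) := by
  induction n generalizing f k with
  | zero => simp [segment, splitSum]
  | succ n ih =>
    change splitSum f (a k :: segment a (k + 1) n) = _
    rw [Finset.Nat.sum_antidiagonal_succ, splitSum, ih]
    simp only [segment, Nat.add_right_comm k 1]
    rfl

theorem insertSum_segment (σ : α → α) (β : List α → α) (f : List α → M) (a : ℕ → α) (k n : ℕ) :
    insertSum σ β f (segment a k n) = ∑ p ∈ Finset.HasAntidiagonal.antidiagonal n,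
      ∑ q ∈ Finset.HasAntidiagonal.antidiagonal p.2 with 1 ≤ q.1,
        f ((segment a k p.1).map σ ++ β (segment a (k + p.1) q.1) ::
          segment a (k + p.1 + q.1) q.2) := by
  induction n generalizing f k with
  | zero => simp [segment, insertSum, Finset.sum_filter]
  | succ n ih =>
    change insertSum σ β f (a k :: segment a (k + 1) n) = _
    rw [Finset.Nat.sum_antidiagonal_succ, insertSum, ih, splitSum_segment]
    congr 1
    · rw [Finset.sum_filter, Finset.Nat.sum_antidiagonal_succ]
      simp [segment, Nat.add_right_comm k 1, ← Nat.add_assoc]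
    · simp [segment, Nat.add_right_comm k 1, ← Nat.add_assoc]

end Segment

/-! ### From functions on lists to multilinear maps -/

section Multilinear

variable {Q A M : Type*} [CommRing Q] [AddCommGroup A] [Module Q A] [AddCommGroup M] [Module Q M]

theorem ofFn_update {α : Type*} {n : ℕ} (a : Fin n → α) (i : Fin n) (v : α) :
    List.ofFn (Function.update a i v) =
      (List.ofFn a).take i ++ v :: (List.ofFn a).drop (i + 1) := by
  have : List.ofFn (Function.update a i v) = (List.ofFn a).set i v := by
    refine List.ext_getElem (by simp) fun j h1 h2 => ?_
    simp only [List.getElem_ofFn, List.getElem_set, Function.update_apply, Fin.ext_iff, eq_comm]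
  rw [this, List.set_eq_take_append_cons_drop, if_pos (by simp)]

/-- The multilinear maps given by a function on lists that is linear in each entry. -/
def IsMulti.toMultilinearMap {f : List A → M} (hf : IsMulti Q f) (n : ℕ) :
    MultilinearMap Q (fun _ : Fin n => A) M where
  toFun a := f (List.ofFn a)
  map_update_add' {inst} a i v w := by
    rw [Subsingleton.elim inst (instDecidableEqFin n), ofFn_update, ofFn_update, ofFn_update]
    exact (hf _ _).map_add v w
  map_update_smul' {inst} a i c v := by
    rw [Subsingleton.elim inst (instDecidableEqFin n), ofFn_update, ofFn_update]
    exact (hf _ _).map_smul c v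

theorem IsMulti.map_segment_smul {f : List A → M} (hf : IsMulti Q f) {σ : A → A} {a : ℕ → A}
    {c : ℕ → Q} (h : ∀ i, σ (a i) = c i • a i) (k n : ℕ) (z : List A) :
    f ((segment a k n).map σ ++ z) =
      (∏ i ∈ Finset.range n, c (k + i)) • f (segment a k n ++ z) := by
  induction n generalizing f k with
  | zero => simp [segment]
  | succ n ih =>
    rw [segment, List.map_cons, List.cons_append, h,
      show f (c k • a k :: _) = c k • f (a k :: _) from (hf [] _).map_smul _ _, ih (hf.cons (a k)), Finset.prod_range_succ', smul_smul, mul_comm]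
    simp [Nat.add_assoc, Nat.add_comm 1]

end Multilinear

/-! ### Removing the suspension -/

namespace PairedComplex

variable {Q E A : Type*} [CommRing Q] [Fintype E] [AddCommGroup A] [Module Q A]
  (X : PairedComplex Q E A) (F : List E → Q)

/-- The submodules `𝒜 i` are the homogeneous components with respect to the basis. -/
def IsGrading (𝒜 : ℤ → Submodule Q A) : Prop :=
  ∀ i v, v ∈ 𝒜 i ↔ ∀ e, X.b.repr v e ≠ 0 → (X.deg e : ℤ) = i

/-- The operations of the `A∞`-structure. They differ by signs from the operations on the
suspension. -/
def mulOp (n : ℕ) : MultilinearMap Q (fun _ : Fin n => A) A :=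
  if n = 0 then 0 else ((X.isMulti_op F).toMultilinearMap n).compLinearMap fun i =>
    ((-X.σ : Module.End Q A) ^ (n - 1 - (i : ℕ)))

theorem mulOp_apply {n : ℕ} (hn : 1 ≤ n) (a : Fin n → A) :
    X.mulOp F n a =
      X.op F (List.ofFn fun i => ((-X.σ : Module.End Q A) ^ (n - 1 - (i : ℕ))) (a i)) := by
  rw [mulOp, if_neg (by omega)]
  rfl

theorem repr_σ (v : A) (e : E) : X.b.repr (X.σ v) e = X.s e * X.b.repr v e := by
  classical
  have : X.b.coord e ∘ₗ X.σ = X.s e • X.b.coord e := X.b.ext fun e' => by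
    by_cases h : e' = e
    · subst h
      simp [σ_b]
    · simp [σ_b, Finsupp.single_eq_of_ne (Ne.symm h)]
  exact LinearMap.congr_fun this v

variable {X} {𝒜 : ℤ → Submodule Q A} (h𝒜 : X.IsGrading 𝒜)

include h𝒜

theorem IsGrading.b_mem (e : E) : X.b e ∈ 𝒜 (X.deg e) := by
  classical
  refine (h𝒜 _ _).2 fun e' h => ?_
  rw [X.b.repr_self, Finsupp.single_apply] at h
  rw [show e = e' by by_contra h'; exact h (if_neg h')]

theorem IsGrading.mem_of_isHomog {v : A} {k : ℕ} {i : ℤ} (hv : X.IsHomog v k) (hk : (k : ℤ) = i + 1) :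
    v ∈ 𝒜 i := (h𝒜 _ _).2 fun e he => by
  have := hv e he
  rw [DualExactComplex.sdeg] at this
  omega

theorem IsGrading.isHomog {v : A} {k : ℕ} (hv : v ∈ 𝒜 k) : X.IsHomog v (k + 1) := fun e he => by
  have := (h𝒜 _ _).1 hv e he
  rw [DualExactComplex.sdeg]
  omega

theorem IsGrading.eq_zero_of_neg {v : A} {i : ℤ} (hv : v ∈ 𝒜 i) (hi : i < 0) : v = 0 := by
  refine X.b.repr.injective (Finsupp.ext fun e => ?_)
  rw [map_zero]
  by_contra he
  have := (h𝒜 _ _).1 hv e he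
  omega

theorem IsGrading.σ {v : A} {i : ℤ} (hv : v ∈ 𝒜 i) : X.σ v = sgn Q (i + 1) • v := by
  refine X.b.repr.injective (Finsupp.ext fun e => ?_)
  rw [repr_σ, map_smul, Finsupp.smul_apply, smul_eq_mul]
  by_cases he : X.b.repr v e = 0
  · rw [he, mul_zero, mul_zero]
  · rw [← (h𝒜 _ _).1 hv e he, DualExactComplex.s, DualExactComplex.sdeg, ← sgn_natCast,
      Nat.cast_succ]

theorem IsGrading.neg_σ_pow {v : A} {i : ℤ} (hv : v ∈ 𝒜 i) (k : ℕ) :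
    ((-X.σ : Module.End Q A) ^ k) v = sgn Q (k * i) • v := by
  induction k with
  | zero => simp [sgn_zero]
  | succ k ih =>
    rw [pow_succ', Module.End.mul_apply, ih, map_smul, LinearMap.neg_apply, h𝒜.σ hv, ← neg_smul,
      smul_smul, Nat.cast_succ, add_one_mul, sgn_add, sgn_add, sgn_one]
    simp

theorem IsGrading.mulOp_eq {n : ℕ} (hn : 1 ≤ n) {a : ℕ → A} {e : ℕ → ℤ}
    (ha : ∀ i < n, a i ∈ 𝒜 (e i)) :
    X.mulOp F n (fun j => a j) =
      sgn Q (∑ i ∈ Finset.range n, ((n : ℤ) - 1 - i) * e i) • X.op F (segment a 0 n) := by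
  rw [mulOp_apply X F hn]
  have h1 : (fun i : Fin n => ((-X.σ : Module.End Q A) ^ (n - 1 - (i : ℕ))) (a i)) =
      fun i : Fin n => sgn Q (((n : ℤ) - 1 - (i : ℕ)) * e i) • a i := funext fun i => by
    rw [h𝒜.neg_σ_pow (ha i i.2)]
    congr 3
    omega
  rw [h1]
  refine ((X.isMulti_op F).toMultilinearMap n).map_smul_univ _ _ |>.trans ?_
  rw [sgn_sum, Finset.prod_range (fun i => sgn Q (((n : ℤ) - 1 - i) * e i))]
  congr 1
  rw [segment_eq_ofFn]
  simp only [Nat.zero_add]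
  rfl

theorem IsGrading.op_segment_mem {F : List E → Q} (hF : X.Hom F (X.d + 3)) {a : ℕ → A} {e : ℕ → ℤ}
    (k : ℕ) {n : ℕ} (hn : 1 ≤ n) (ha : ∀ i < n, a (k + i) ∈ 𝒜 (e (k + i))) :
    X.op F (segment a k n) ∈ 𝒜 (∑ i ∈ Finset.range n, e (k + i) + ((n : ℤ) - 2)) := by
  -- Degrees are integers here but natural numbers on the basis. An argument of negative degree is
  -- zero and makes the value zero.
  by_cases hneg : ∃ i < n, e (k + i) < 0
  · obtain ⟨i, hi, h⟩ := hneg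
    have h0 := h𝒜.eq_zero_of_neg (ha i hi) h
    obtain ⟨j, rfl⟩ : ∃ j, n = i + (j + 1) := ⟨n - i - 1, by omega⟩
    rw [segment_add, segment, h0, (X.isMulti_op F _ _).map_zero]
    exact zero_mem _
  · push Not at hneg
    choose! c hc using fun i hi => Int.eq_ofNat_of_zero_le (hneg i hi)
    have hl : ∀ m ≤ n, ∃ ks : List ℕ, List.Forall₂ X.IsHomog (segment a (k + (n - m)) m) ks ∧
        (ks.sum : ℤ) = ∑ i ∈ Finset.range m, e (k + (n - m) + i) + m := by
      intro m
      induction m with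
      | zero => exact fun _ => ⟨[], by simp [segment]⟩
      | succ m ih =>
        intro hm
        obtain ⟨ks, h1, h2⟩ := ih (by omega)
        have h3 := ha (n - (m + 1)) (by omega)
        have h4 := hc (n - (m + 1)) (by omega)
        rw [h4] at h3
        refine ⟨(c (n - (m + 1)) + 1) :: ks, ?_, ?_⟩
        · rw [segment, show k + (n - (m + 1)) + 1 = k + (n - m) by omega]
          exact .cons (h𝒜.isHomog h3) h1
        · rw [List.sum_cons, Finset.sum_range_succ', Nat.cast_add, h2]
          rw [add_zero, h4]
          simp only [show ∀ i, k + (n - (m + 1)) + (i + 1) = k + (n - m) + i by omega]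
          push_cast
          ring
    obtain ⟨ks, h1, h2⟩ := hl n le_rfl
    simp only [Nat.sub_self, add_zero] at h1 h2
    have h3 : 0 ≤ ∑ i ∈ Finset.range n, e (k + i) :=
      Finset.sum_nonneg fun i hi => hneg i (Finset.mem_range.1 hi)
    refine h𝒜.mem_of_isHomog (X.isHomog_op hF h1 (k := ks.sum - 1) (by omega)) ?_
    omega

omit h𝒜 in
theorem segment_insert {α : Type*} (a : ℕ → α) (x : α) (r s t : ℕ) :
    segment (fun j => if j < r then a j else if j = r then x else a (j - 1 + s)) 0 (r + 1 + t) =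
      segment a 0 r ++ x :: segment a (r + s) t := by
  rw [segment_add, segment_add, List.append_assoc]
  congr 1
  · exact segment_congr fun i hi => by simp [hi]
  · simp only [segment, Nat.zero_add, List.singleton_append, lt_irrefl, if_false, if_true]
    congr 1
    refine segment_congr fun i _ => ?_
    rw [if_neg (by omega), if_neg (by omega)]
    congr 1
    omega

/-- The suspension signs of inner and outer operation, the Koszul sign and the sign `(-1)^(r + s t)`
combine to the sign of `σ` on the first `r` arguments times a sign depending only on all the
arguments. The latter is common to all terms, so the Stasheff sum is `±` the square. -/
theorem IsGrading.stasheffTerm_mulOp {F : List E → Q} (hF : X.Hom F (X.d + 3)) {a : ℕ → A}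
    {e : ℕ → ℤ} (ha : ∀ i, a i ∈ 𝒜 (e i)) {n r s t : ℕ} (hs : 1 ≤ s) (hn : r + (s + t) = n) :
    ((r : ℤ) + s * t).negOnePow • stasheffTerm (X.mulOp F) r s t a e =
      sgn Q (∑ i ∈ Finset.range n, ((n : ℤ) - 1 - i) * e i) •
        X.op F ((segment a 0 r).map X.σ ++ X.op F (segment a r s) :: segment a (r + s) t) := by
  subst hn
  have hin : X.mulOp F s (fun i => a (r + i)) =
      sgn Q (∑ i ∈ Finset.range s, ((s : ℤ) - 1 - i) * e (r + i)) • X.op F (segment a r s) := by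
    rw [h𝒜.mulOp_eq F hs (a := fun i => a (r + i)) (e := fun i => e (r + i)) fun i _ => ha _]
    congr 2
    exact segment_congr fun i _ => by simp
  have hmem := h𝒜.op_segment_mem hF r hs (fun i _ => ha (r + i))
  set y := X.op F (segment a r s) with hy
  set e' := ∑ i ∈ Finset.range s, e (r + i) + ((s : ℤ) - 2) with he'
  rw [stasheffTerm, negOnePow_smul (Q := Q), negOnePow_smul (Q := Q), hin, smul_smul]
  have hout := h𝒜.mulOp_eq F (n := r + 1 + t) (by omega)
    (a := fun j => if j < r then a j else if j = r then
      sgn Q (∑ i ∈ Finset.range s, ((s : ℤ) - 1 - i) * e (r + i)) • y else a (j - 1 + s))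
    (e := fun j => if j < r then e j else if j = r then e' else e (j - 1 + s)) (fun i _ => by
      split_ifs
      · exact ha _
      · exact (𝒜 e').smul_mem _ hmem
      · exact ha _)
  have hsmul : ∀ c : Q, X.op F (segment a 0 r ++ (c • y) :: segment a (r + s) t) =
      c • X.op F (segment a 0 r ++ y :: segment a (r + s) t) := fun c =>
    (X.isMulti_op F (segment a 0 r) (segment a (r + s) t)).map_smul c y
  rw [hout, segment_insert, hsmul,
    (X.isMulti_op F).map_segment_smul (σ := X.σ) (c := fun i => sgn Q (e i + 1)) (fun i => h𝒜.σ (ha i)),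
    ← sgn_sum, smul_smul, smul_smul, smul_smul, ← sgn_add, ← sgn_add, ← sgn_add, ← sgn_add]
  congr 1
  refine sgn_eq Q ?_
  simp only [Nat.zero_add]
  have e1 : ∑ i ∈ Finset.range (r + 1 + t), (((r + 1 + t : ℕ) : ℤ) - 1 - i) *
      (if i < r then e i else if i = r then e' else e (i - 1 + s)) =
      ∑ i ∈ Finset.range r, ((r : ℤ) + t - i) * e i + t * e' +
        ∑ i ∈ Finset.range t, ((t : ℤ) - 1 - i) * e (r + s + i) := by
    rw [Finset.sum_range_add, Finset.sum_range_succ]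
    congr 1
    · congr 1
      · refine Finset.sum_congr rfl fun i hi => ?_
        rw [if_pos (Finset.mem_range.1 hi)]
        push_cast
        ring
      · rw [if_neg (lt_irrefl _), if_pos rfl]
        push_cast
        ring
    · refine Finset.sum_congr rfl fun i _ => ?_
      rw [if_neg (by omega), if_neg (by omega), show r + 1 + i - 1 + s = r + s + i by omega]
      push_cast
      ring
  have e2 : ∑ i ∈ Finset.range (r + (s + t)), (((r + (s + t) : ℕ) : ℤ) - 1 - i) * e i =
      ∑ i ∈ Finset.range r, ((r : ℤ) + s + t - 1 - i) * e i +
      (∑ i ∈ Finset.range s, ((s : ℤ) + t - 1 - i) * e (r + i) +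
        ∑ i ∈ Finset.range t, ((t : ℤ) - 1 - i) * e (r + s + i)) := by
    rw [Finset.sum_range_add, Finset.sum_range_add]
    congr 1
    · refine Finset.sum_congr rfl fun i _ => ?_
      push_cast
      ring
    · congr 1
      · refine Finset.sum_congr rfl fun i _ => ?_
        push_cast
        ring
      · refine Finset.sum_congr rfl fun i _ => ?_
        rw [Nat.add_assoc]
        push_cast
        ring
  have e3 : ∑ i ∈ Finset.range s, ((s : ℤ) + t - 1 - i) * e (r + i) =
      t * ∑ i ∈ Finset.range s, e (r + i) +
        ∑ i ∈ Finset.range s, ((s : ℤ) - 1 - i) * e (r + i) := by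
    rw [Finset.mul_sum, ← Finset.sum_add_distrib]
    exact Finset.sum_congr rfl fun i _ => by ring
  have e4 : ∑ i ∈ Finset.range r, ((r : ℤ) + s + t - 1 - i) * e i =
      ∑ i ∈ Finset.range r, ((r : ℤ) + t - i) * e i + (s - 1) * ∑ i ∈ Finset.range r, e i := by
    rw [Finset.mul_sum, ← Finset.sum_add_distrib]
    exact Finset.sum_congr rfl fun i _ => by ring
  rw [e1, e2, e3, e4, he', Finset.sum_add_distrib]
  simp only [Finset.sum_const, Finset.card_range, nsmul_eq_mul, mul_one]
  generalize ∑ i ∈ Finset.range r, ((r : ℤ) + t - i) * e i = x1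
  generalize ∑ i ∈ Finset.range t, ((t : ℤ) - 1 - i) * e (r + s + i) = x2
  generalize ∑ i ∈ Finset.range s, ((s : ℤ) - 1 - i) * e (r + i) = x3
  generalize ∑ i ∈ Finset.range s, e (r + i) = x4
  generalize ∑ i ∈ Finset.range r, e i = x5
  exact ⟨s * t - t - x5, by ring⟩

end PairedComplex

/-! ### The cyclic `A∞`-algebra and its split unit -/

namespace PairedComplex

variable {Q : Type u} {E : Type w} {A : Type v} [CommRing Q] [Fintype E] [AddCommGroup A]
  [Module Q A] {X : PairedComplex Q E A} {F : List E → Q}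
  {𝒜 : ℤ → Submodule Q A} (h𝒜 : X.IsGrading 𝒜)

include h𝒜

theorem IsGrading.isInternal : DirectSum.IsInternal 𝒜 := by
  refine DirectSum.isInternal_submodule_of_iSupIndep_of_iSup_eq_top (fun i => ?_) ?_
  · rw [Submodule.disjoint_def]
    intro v hv hv'
    refine X.b.repr.injective (Finsupp.ext fun e => ?_)
    rw [map_zero]
    by_cases he : (X.deg e : ℤ) = i
    · have : ⨆ j, ⨆ (_ : j ≠ i), 𝒜 j ≤ LinearMap.ker (X.b.coord e) := by
        refine iSup₂_le fun j hj w hw => ?_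
        by_contra hne
        exact hj (((h𝒜 j w).1 hw e hne).symm.trans he)
      exact this hv'
    · by_contra hne
      exact he ((h𝒜 i v).1 hv e hne)
  · rw [eq_top_iff]
    rintro v -
    rw [← X.b.sum_repr v]
    exact Submodule.sum_mem _ fun e _ => Submodule.smul_mem _ _
      (Submodule.mem_iSup_of_mem _ (h𝒜.b_mem e))

/-- The `A∞`-algebra given by a cyclic form on the suspension. -/
def IsGrading.algebra (hF : X.IsUnitalForm F) (hsq : ∀ l, X.square F l = 0) :
    AInfinityAlgebra Q 𝒜 where
  isInternal := h𝒜.isInternal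
  m := X.mulOp F
  m_zero := if_pos rfl
  m_mem n hn a e ha := by
    let a' : ℕ → A := fun i => if h : i < n then a ⟨i, h⟩ else 0
    let e' : ℕ → ℤ := fun i => if h : i < n then e ⟨i, h⟩ else 0
    have haa : a = fun i : Fin n => a' i := funext fun i => by simp [a']
    have hmem : ∀ i < n, a' i ∈ 𝒜 (e' i) := fun i hi => by
      simp only [a', e', dif_pos hi]
      exact ha _
    have hsum : ∑ i, e i = ∑ i ∈ Finset.range n, e' (0 + i) := by
      rw [Finset.sum_range]
      exact Finset.sum_congr rfl fun i _ => by simp [e']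
    rw [haa, h𝒜.mulOp_eq F hn hmem, hsum]
    exact Submodule.smul_mem _ _
      (h𝒜.op_segment_mem hF.hom 0 hn fun i hi => by rw [Nat.zero_add]; exact hmem i hi)
  stasheff n _ a e ha := by
    refine Eq.trans ?_ ((congrArg _ (hsq (segment a 0 n))).trans
      (smul_zero (sgn Q (∑ i ∈ Finset.range n, ((n : ℤ) - 1 - i) * e i))))
    rw [square, insertSum_segment, Finset.smul_sum]
    refine Finset.sum_congr rfl fun p hp => ?_
    rw [Finset.smul_sum]
    refine Finset.sum_congr rfl fun q hq => ?_
    rw [Finset.HasAntidiagonal.mem_antidiagonal] at hp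
    rw [Finset.mem_filter, Finset.HasAntidiagonal.mem_antidiagonal] at hq
    rw [h𝒜.stasheffTerm_mulOp hF.hom ha hq.2 (n := n) (by omega), Nat.zero_add]

omit h𝒜 in
theorem mulOp_one (hF : X.IsUnitalForm F) (a : A) : X.mulOp F 1 (fun _ => a) = X.δ a := by
  rw [mulOp_apply X F le_rfl]
  exact hF.op_singleton a

theorem IsGrading.algebra_diff (hF : X.IsUnitalForm F) (hsq : ∀ l, X.square F l = 0) :
    (h𝒜.algebra hF hsq).diff = X.δ := LinearMap.ext fun a => mulOp_one hF a

omit h𝒜 in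
theorem neg_σ_pow_one (k : ℕ) : ((-X.σ : Module.End Q A) ^ k) (X.b X.one) = X.b X.one := by
  induction k with
  | zero => rfl
  | succ k ih =>
    rw [pow_succ, Module.End.mul_apply, LinearMap.neg_apply, σ_one, neg_neg, ih]

omit h𝒜 in
theorem mulOp_higher (hF : X.IsUnitalForm F) {n : ℕ} (hn : 2 < n) (a : Fin n → A) (i : Fin n)
    (hi : a i = X.b X.one) : X.mulOp F n a = 0 := by
  rw [mulOp_apply X F (by omega)]
  set c : Fin n → A := fun i => ((-X.σ : Module.End Q A) ^ (n - 1 - (i : ℕ))) (a i) with hc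
  have hci : c i = X.b X.one := by rw [hc]; simp only [hi, neg_σ_pow_one]
  rw [← Function.update_eq_self i c, hci, ofFn_update]
  refine hF.op_one_higher _ _ ?_
  simp
  omega

theorem IsGrading.zero_eq : 𝒜 0 = Q ∙ X.b X.one := by
  refine le_antisymm (fun v hv => ?_) ?_
  · rw [← X.b.sum_repr v]
    refine Submodule.sum_mem _ fun e _ => ?_
    by_cases he : X.b.repr v e = 0
    · rw [he, zero_smul]
      exact zero_mem _
    · have h := (h𝒜 0 v).1 hv e he
      rw [(X.deg_eq_zero e).1 (by exact_mod_cast h)]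
      exact Submodule.smul_mem _ _ (Submodule.mem_span_singleton_self _)
  · rw [Submodule.span_singleton_le_iff_mem]
    have := h𝒜.b_mem X.one
    rwa [(X.deg_eq_zero _).2 rfl] at this

theorem IsGrading.isSplitUnit (hF : X.IsUnitalForm F) (hsq : ∀ l, X.square F l = 0) :
    (h𝒜.algebra hF hsq).IsSplitUnit (X.b X.one) where
  mem := by
    rw [h𝒜.zero_eq]
    exact Submodule.mem_span_singleton_self _
  one_mul a := by
    refine (mulOp_apply X F one_le_two _).trans ?_
    simp only [List.ofFn_succ, List.ofFn_zero]
    simp only [Fin.isValue, Matrix.cons_val_zero, neg_σ_pow_one, Fin.succ_zero_eq_one]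
    simpa using hF.op_one_left a
  mul_one a := by
    refine (mulOp_apply X F one_le_two _).trans ?_
    simp only [List.ofFn_succ, List.ofFn_zero]
    simpa [σ_σ] using hF.op_one_right (-X.σ a)
  higher n hn a i hi := mulOp_higher hF hn a i hi
  free q hq := by
    have := congrArg (fun v => X.b.repr v X.one) hq
    simpa using this
  split := ⟨⊥, bot_le, disjoint_bot_right, by rw [sup_bot_eq, h𝒜.zero_eq]⟩

omit h𝒜

variable (X) in
/-- The pairing on the complex obtained from the antisymmetric pairing on its suspension. -/
def pairing : A →ₗ[Q] A →ₗ[Q] Q := X.ω ∘ₗ X.σ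

theorem pairing_symm (x y : A) : X.pairing x y = X.pairing y x := by
  rw [pairing, LinearMap.comp_apply, LinearMap.comp_apply, ω_σ, X.ω_antisymm, neg_neg]

include h𝒜

theorem IsGrading.pairing_eq_zero {i j : ℤ} (hij : i + j ≠ X.d) {x y : A} (hx : x ∈ 𝒜 i)
    (hy : y ∈ 𝒜 j) : X.pairing x y = 0 := by
  rw [← X.b.sum_repr x, ← X.b.sum_repr y]
  simp only [map_sum, LinearMap.sum_apply, map_smul, LinearMap.smul_apply]
  refine Finset.sum_eq_zero fun e _ => ?_
  by_cases he : X.b.repr y e = 0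
  · rw [he, zero_smul]
  · refine smul_eq_zero_of_right _ (Finset.sum_eq_zero fun e' _ => ?_)
    by_cases he' : X.b.repr x e' = 0
    · rw [he', zero_smul]
    · by_contra h
      rw [pairing, LinearMap.comp_apply, σ_b, map_smul, LinearMap.smul_apply] at h
      have h1 := X.ω_deg e' e (right_ne_zero_of_smul (right_ne_zero_of_smul h))
      have h2 := (h𝒜 _ _).1 hy e he
      have h3 := (h𝒜 _ _).1 hx e' he'
      omega

theorem IsGrading.exists_basis (i : ℤ) :
    ∃ b : Module.Basis {e : E // (X.deg e : ℤ) = i} Q (𝒜 i), ∀ e, (b e : A) = X.b e := by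
  have hli : LinearIndependent Q fun e : {e : E // (X.deg e : ℤ) = i} => X.b e :=
    X.b.linearIndependent.comp _ Subtype.val_injective
  have hspan : 𝒜 i = Submodule.span Q (Set.range fun e : {e : E // (X.deg e : ℤ) = i} => X.b e) := by
    refine le_antisymm (fun v hv => ?_) ?_
    · rw [← X.b.sum_repr v]
      refine Submodule.sum_mem _ fun e _ => ?_
      by_cases he : X.b.repr v e = 0
      · rw [he, zero_smul]
        exact zero_mem _
      · exact Submodule.smul_mem _ _ (Submodule.subset_span ⟨⟨e, (h𝒜 i v).1 hv e he⟩, rfl⟩)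
    · rw [Submodule.span_le]
      rintro _ ⟨⟨e, rfl⟩, rfl⟩
      exact h𝒜.b_mem e
  rw [hspan]
  exact ⟨.span hli, fun e => congrArg Subtype.val (Module.Basis.span_apply hli e)⟩

/-- An element of `𝒜 i` orthogonal to `𝒜 j` is orthogonal to everything by degrees. Conversely,
extend a functional on `𝒜 j` by zero, represent it through `ω`, and keep the component of degree
`i`. -/
theorem IsGrading.pairing_bijective {i j : ℤ} (hij : i + j = X.d) :
    Function.Bijective (X.pairing.domRestrict₁₂ (𝒜 i) (𝒜 j)) := by
  classical
  refine ⟨(injective_iff_map_eq_zero _).2 fun x hx => ?_, fun φ => ?_⟩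
  · have : X.ω (X.σ x) = 0 := X.b.ext fun e => by
      by_cases he : i + (X.deg e : ℤ) = X.d
      · exact LinearMap.congr_fun hx ⟨X.b e, by
          rw [show j = X.deg e by omega]; exact h𝒜.b_mem e⟩
      · exact h𝒜.pairing_eq_zero he x.2 (h𝒜.b_mem e)
    have h0 : X.σ x = 0 := (injective_iff_map_eq_zero _).1 X.ω_bijective.1 _ this
    refine Subtype.ext ?_
    rw [← X.σ_σ x, h0, map_zero]
    rfl
  · obtain ⟨b, hb⟩ := h𝒜.exists_basis j
    obtain ⟨z, hz⟩ := X.ω_bijective.2 (X.b.constr Q fun e =>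
      if h : (X.deg e : ℤ) = j then φ (b ⟨e, h⟩) else 0)
    refine ⟨⟨∑ e with (X.deg e : ℤ) = i, X.b.repr (X.σ z) e • X.b e, ?_⟩, b.ext fun e => ?_⟩
    · refine Submodule.sum_mem _ fun e he => Submodule.smul_mem _ _ ?_
      rw [← (Finset.mem_filter.1 he).2]
      exact h𝒜.b_mem e
    · rw [LinearMap.domRestrict₁₂_apply, hb]
      have h1 : X.pairing (X.σ z) (X.b e) = φ (b e) := by
        rw [pairing, LinearMap.comp_apply, σ_σ, hz, Module.Basis.constr_basis, dif_pos e.2]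
      rw [← h1]
      conv_rhs => rw [← X.b.sum_repr (X.σ z)]
      simp only [map_sum, LinearMap.sum_apply, Finset.sum_filter]
      refine Finset.sum_congr rfl fun e' _ => ?_
      by_cases he' : (X.deg e' : ℤ) = i
      · rw [if_pos he']
      · rw [if_neg he', map_smul, LinearMap.smul_apply, h𝒜.pairing_eq_zero (fun h => he' ?_)
          (h𝒜.b_mem e') (h𝒜.b_mem e), smul_zero]
        · simp
        · have := e.2
          omega

/-- One rotation of the suspended operation, with the signs of `σ` and of the suspension collected.
-/
theorem IsGrading.pairing_mulOp (hF : X.IsUnitalForm F) {n : ℕ} (hn : 1 ≤ n) {a : ℕ → A}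
    {e : ℕ → ℤ} (ha : ∀ i < n + 1, a i ∈ 𝒜 (e i)) :
    X.pairing (X.mulOp F n fun j => a j) (a n) =
      sgn Q (n + e 0 * ∑ i ∈ Finset.range n, e (i + 1)) *
        X.pairing (X.mulOp F n fun j => a (j + 1)) (a 0) := by
  have e1 := h𝒜.mulOp_eq F hn (a := a) (e := e) fun i hi => ha i (by omega)
  have e2 := h𝒜.mulOp_eq F hn (a := fun i => a (i + 1)) (e := fun i => e (i + 1))
    fun i hi => ha (i + 1) (by omega)
  have m1 := h𝒜.op_segment_mem hF.hom (a := a) (e := e) 0 hn fun i hi => ha _ (by omega)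
  have m2 := h𝒜.op_segment_mem hF.hom (a := a) (e := e) 1 hn fun i hi => ha _ (by omega)
  rw [e1, e2, show segment (fun i => a (i + 1)) 0 n = segment a 1 n from
    segment_congr fun i _ => by rw [Nat.zero_add, Nat.add_comm]]
  simp only [map_smul, LinearMap.smul_apply, smul_eq_mul]
  simp only [Nat.zero_add, Nat.add_comm 1] at m1 m2
  have hT : ∑ i ∈ Finset.range n, e i + e n = ∑ i ∈ Finset.range n, e (i + 1) + e 0 := by
    rw [← Finset.sum_range_succ, Finset.sum_range_succ']
  -- Both pairings vanish unless the degrees add up to `d`. The sign identity holds only under that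
  -- constraint, and it uses that `d` is odd.
  by_cases hdeg : ∑ i ∈ Finset.range n, e (i + 1) + ((n : ℤ) - 2) + e 0 = X.d
  swap
  · rw [h𝒜.pairing_eq_zero hdeg m2 (ha 0 (by omega)),
      h𝒜.pairing_eq_zero (fun h => hdeg (by omega)) m1 (ha n (by omega)), mul_zero, mul_zero,
      mul_zero]
  obtain ⟨k, rfl⟩ : ∃ k, n = k + 1 := ⟨n - 1, by omega⟩
  have h3 : X.pairing (X.op F (segment a 0 (k + 1))) (a (k + 1)) =
      sgn Q (e (k + 1) + e 0 + 1) * X.ω (X.op F (segment a 1 (k + 1))) (a 0) := by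
    rw [pairing, LinearMap.comp_apply, ω_σ, h𝒜.σ (ha (k + 1) (by omega)),
      show segment a 0 (k + 1) = a 0 :: segment a 1 k from rfl, map_smul, hF.op_cyclic,
      h𝒜.σ (ha 0 (by omega)), segment_add, Nat.add_comm 1 k, map_smul]
    simp only [segment, smul_eq_mul, sgn_add, sgn_one]
    ring
  have h4 : X.pairing (X.op F (segment a 1 (k + 1))) (a 0) =
      sgn Q (e 0) * X.ω (X.op F (segment a 1 (k + 1))) (a 0) := by
    rw [pairing, LinearMap.comp_apply, ω_σ, h𝒜.σ (ha 0 (by omega)), map_smul, sgn_add, sgn_one,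
      smul_eq_mul]
    ring
  rw [h3, h4, ← mul_assoc, ← mul_assoc, ← mul_assoc, ← sgn_add, ← sgn_add, ← sgn_add]
  congr 1
  refine sgn_eq Q ?_
  have h5 : ∑ i ∈ Finset.range (k + 1), (((k + 1 : ℕ) : ℤ) - 1 - i) * e i =
      ∑ i ∈ Finset.range k, ((k : ℤ) - 1 - i) * e (i + 1) + k * e 0 := by
    rw [Finset.sum_range_succ']
    congr 1
    · refine Finset.sum_congr rfl fun i _ => ?_
      push_cast
      ring
    · push_cast
      ring
  have h6 : ∑ i ∈ Finset.range (k + 1), (((k + 1 : ℕ) : ℤ) - 1 - i) * e (i + 1) =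
      ∑ i ∈ Finset.range k, ((k : ℤ) - 1 - i) * e (i + 1) + ∑ i ∈ Finset.range k, e (i + 1) := by
    rw [Finset.sum_range_succ, ← Finset.sum_add_distrib]
    push_cast
    rw [add_sub_cancel_right, sub_self, zero_mul, add_zero]
    exact Finset.sum_congr rfl fun i _ => by ring
  rw [Finset.sum_range_succ] at hdeg
  rw [h5, h6, Finset.sum_range_succ (fun i => e (i + 1))]
  generalize ∑ i ∈ Finset.range k, e (i + 1) = x at *
  generalize ∑ i ∈ Finset.range k, ((k : ℤ) - 1 - i) * e (i + 1) = y
  obtain ⟨c, hc⟩ := X.d_odd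
  rw [hc] at hdeg
  push_cast at hdeg ⊢
  -- Eliminating the other degrees leaves a term quadratic in `e 0`, which is even together with its
  -- linear part.
  obtain ⟨c', hc'⟩ := Int.even_mul_succ_self (e 0)
  exact ⟨k * e 0 + c + 1 - k - x - e 0 * (c + 1) + c' - e 0,
    by linear_combination hc' + (1 - e 0) * hdeg⟩

theorem IsGrading.isCyclic (hF : X.IsUnitalForm F) (hsq : ∀ l, X.square F l = 0) :
    (h𝒜.algebra hF hsq).IsCyclic X.d X.pairing where
  free i := .of_basis (h𝒜.exists_basis i).choose
  finite i := .of_basis (h𝒜.exists_basis i).choose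
  degree i j hij a ha b hb := h𝒜.pairing_eq_zero hij ha hb
  chain i a ha b := by
    rw [h𝒜.algebra_diff, negOnePow_smul (Q := Q), pairing, LinearMap.comp_apply,
      LinearMap.comp_apply, σ_δ, h𝒜.σ ha]
    have h1 := X.ω_δ (X.σ a) b
    rw [σ_σ, h𝒜.σ ha] at h1
    have h2 : sgn Q i * sgn Q (i + 1) = -1 := by
      rw [← sgn_add, ← sgn_one]
      exact sgn_eq Q ⟨i, by ring⟩
    simp only [map_smul, map_neg, LinearMap.neg_apply, LinearMap.smul_apply, smul_eq_mul] at h1 ⊢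
    linear_combination -h1 + X.ω a (X.δ b) * h2
  perfect i j hij :=
    { bijective_left := h𝒜.pairing_bijective hij
      bijective_right := by
        convert! h𝒜.pairing_bijective (i := j) (j := i) (by rw [add_comm, hij])
        ext x y
        exact pairing_symm _ _ }
  cyclic n hn a e ha := by
    let a' : ℕ → A := fun i => if h : i < n + 1 then a ⟨i, h⟩ else 0
    let e' : ℕ → ℤ := fun i => if h : i < n + 1 then e ⟨i, h⟩ else 0
    have h := h𝒜.pairing_mulOp hF hn (a := a') (e := e') fun i hi => by
      simp only [a', e', dif_pos hi]
      exact ha _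
    have h1 : (fun j : Fin n => a' j) = fun i => a i.castSucc := funext fun i =>
      dif_pos (Nat.lt_succ_of_lt i.2)
    have h2 : (fun j : Fin n => a' (j + 1)) = fun i => a i.succ := funext fun i =>
      dif_pos (Nat.succ_lt_succ i.2)
    have h3 : a' n = a (Fin.last n) := dif_pos n.lt_succ_self
    have h4 : a' 0 = a 0 := dif_pos n.succ_pos
    have h5 : e' 0 = e 0 := dif_pos n.succ_pos
    have h6 : ∑ i ∈ Finset.range n, e' (i + 1) = ∑ i : Fin n, e i.succ := by
      rw [Finset.sum_range]
      exact Finset.sum_congr rfl fun i _ => dif_pos (Nat.succ_lt_succ i.2)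
    rw [h1, h2, h3, h4, h5, h6] at h
    rw [negOnePow_smul (Q := Q)]
    exact h

end PairedComplex

theorem isUnit_natCast_of_subfield {Q : Type*} [CommRing Q] {K : Subring Q} (hK : IsField K)
    (hK0 : CharZero K) (n : ℕ) (hn : n ≠ 0) : IsUnit (n : Q) := by
  obtain ⟨b, hb⟩ := hK.mul_inv_cancel (a := (n : K)) (Nat.cast_ne_zero.2 hn)
  exact IsUnit.of_mul_eq_one (b : Q) (by simpa using congrArg Subtype.val hb)

/-! ### The augmentation as a strict quasi-isomorphism -/

section Augmentation

variable {Q : Type u} [CommRing Q] {R : Type u} [CommRing R] [Algebra Q R]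
  {P : ProjectiveResolution (ModuleCat.of Q R)} {E : Type u} [Fintype E]
  {X : PairedComplex Q E (totalModule P.complex)} {F : List E → Q}

theorem isGrading_totalGrading
    (h : ∀ v n, HasDegree X.b X.deg v n ↔ ∀ m, m ≠ n → totalProj P m v = 0) :
    X.IsGrading (totalGrading P.complex) := by
  intro i v
  by_cases hi : 0 ≤ i
  · lift i to ℕ using hi
    have h1 := h v i
    constructor
    · intro hv e he
      exact congrArg _ (h1.2 (fun m hm => hv m (by exact_mod_cast hm)) e he)
    · intro hv m hm
      exact h1.1 (fun e he => by exact_mod_cast hv e he) m (by exact_mod_cast hm)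
  · constructor
    · intro hv
      have : v = 0 := totalModule_ext P fun n => hv n (by omega)
      intro e he
      rw [this, map_zero] at he
      exact absurd rfl he
    · intro hv
      have : v = 0 := X.b.repr.injective (Finsupp.ext fun e => by
        rw [map_zero]
        by_contra he
        have := hv e he
        omega)
      rw [this]
      exact zero_mem _

theorem totalAugmentation_apply (v : totalModule P.complex) :
    totalAugmentation P v = resAug P (totalProj P 0 v) := rfl

theorem totalAugmentation_eq_zero {i : ℤ} (hi : i ≠ 0) {v : totalModule P.complex}
    (hv : v ∈ totalGrading P.complex i) : totalAugmentation P v = 0 := by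
  rw [totalAugmentation_apply, show totalProj P 0 v = 0 from hv 0 (by exact_mod_cast hi.symm),
    map_zero]

theorem totalAugmentation_totalDiff (v : totalModule P.complex) :
    totalAugmentation P (totalDiff P.complex v) = 0 := by
  rw [totalAugmentation_apply, totalProj_totalDiff, resAug_resD]

variable (h𝒜 : X.IsGrading (totalGrading P.complex)) (hF : X.IsUnitalForm F)
  (hsq : ∀ l, X.square F l = 0)

-- It suffices to check basis elements. If none of `n ≥ 2` inputs is the unit, the value has degree
-- at least `n + (n - 2) > 0` and is killed, and so are the inputs. Unit inputs are covered by the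
-- unit axioms, and `n = 1` by `ε ∘ ∂ = 0`.
include h𝒜 in
theorem totalAugmentation_mulOp (hδ : X.δ = totalDiff P.complex)
    (hone : totalAugmentation P (X.b X.one) = (1 : R)) {n : ℕ} (hn : 1 ≤ n)
    (a : Fin n → totalModule P.complex) :
    totalAugmentation P ((h𝒜.algebra hF hsq).m n a) =
      (AInfinityAlgebra.ofAlgebra Q R).m n fun i => totalAugmentation P (a i) := by
  suffices h : (totalAugmentation P).compMultilinearMap ((h𝒜.algebra hF hsq).m n) =
      ((AInfinityAlgebra.ofAlgebra Q R).m n).compLinearMap fun _ => totalAugmentation P from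
    congrArg (fun f => f a) h
  refine Module.Basis.ext_multilinear (fun _ => X.b) fun e => ?_
  rw [LinearMap.compMultilinearMap_apply, MultilinearMap.compLinearMap_apply]
  have hunit := h𝒜.isSplitUnit hF hsq
  have hne : ∀ e, e ≠ X.one → totalAugmentation P (X.b e) = 0 := fun e he =>
    totalAugmentation_eq_zero (by exact_mod_cast fun h => he ((X.deg_eq_zero e).1 h)) (h𝒜.b_mem e)
  have hmem := (h𝒜.algebra hF hsq).m_mem n hn (fun i => X.b (e i)) (fun i => X.deg (e i))
    fun i => h𝒜.b_mem _
  have hpos : (∀ i, e i ≠ X.one) → 2 ≤ n →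
      totalAugmentation P ((h𝒜.algebra hF hsq).m n fun i => X.b (e i)) = 0 := fun he h2 => by
    have : (n : ℤ) ≤ ∑ i, (X.deg (e i) : ℤ) := by
      have := Finset.sum_le_sum fun (i : Fin n) (_ : i ∈ Finset.univ) =>
        show (1 : ℤ) ≤ X.deg (e i) from
          by exact_mod_cast Nat.pos_of_ne_zero fun h => he i ((X.deg_eq_zero _).1 h)
      simpa using this
    exact totalAugmentation_eq_zero (by omega) hmem
  obtain rfl | rfl | h3 : n = 1 ∨ n = 2 ∨ 2 < n := by omega
  · have : (fun i : Fin 1 => X.b (e i)) = fun _ => X.b (e 0) := funext fun i => by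
      rw [Subsingleton.elim i 0]
    rw [this]
    refine (congrArg _ ((PairedComplex.mulOp_one hF _).trans (by rw [hδ]))).trans ?_
    rw [totalAugmentation_totalDiff]
    simp [AInfinityAlgebra.ofAlgebra]
  · have h2 : (fun i : Fin 2 => X.b (e i)) = ![X.b (e 0), X.b (e 1)] := funext fun i => by
      fin_cases i <;> rfl
    have hR : (AInfinityAlgebra.ofAlgebra Q R).m 2 (fun i => totalAugmentation P (X.b (e i))) =
        totalAugmentation P (X.b (e 0)) * (totalAugmentation P (X.b (e 1)) : R) := by
      simp [AInfinityAlgebra.ofAlgebra, MultilinearMap.mkPiAlgebraFin_apply, List.ofFn_succ]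
    refine Eq.trans ?_ hR.symm
    by_cases h0 : e 0 = X.one
    · rw [h2, h0, hunit.one_mul, hone, one_mul]
    · by_cases h1 : e 1 = X.one
      · rw [h2, h1, hunit.mul_one, hone, mul_one]
      · rw [hpos (fun i => by fin_cases i <;> assumption) le_rfl, hne _ h0, zero_mul]
  · have hR : (AInfinityAlgebra.ofAlgebra Q R).m n (fun i => totalAugmentation P (X.b (e i))) =
        0 := by
      simp [AInfinityAlgebra.ofAlgebra, h3.ne']
    refine Eq.trans ?_ hR.symm
    by_cases he : ∀ i, e i ≠ X.one
    · exact hpos he h3.le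
    · push Not at he
      obtain ⟨i, hi⟩ := he
      rw [hunit.higher n h3 _ i (by rw [hi]), map_zero]

/-- The augmentation as a strict morphism. -/
def augmentationHom (hδ : X.δ = totalDiff P.complex)
    (hone : totalAugmentation P (X.b X.one) = (1 : R)) :
    (h𝒜.algebra hF hsq).StrictHom (AInfinityAlgebra.ofAlgebra Q R) where
  toLinearMap := totalAugmentation P
  map_mem i a ha := by
    by_cases hi : i = 0
    · simp [AInfinityAlgebra.degreeZero, hi]
    · rw [totalAugmentation_eq_zero hi ha]
      exact zero_mem _
  map_m _ hn a := totalAugmentation_mulOp h𝒜 hF hsq hδ hone hn a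

theorem exists_totalDiff_eq {x : totalModule P.complex} (hx : totalDiff P.complex x = 0)
    (hx' : totalAugmentation P x = 0) : ∃ y, totalDiff P.complex y = x := by
  classical
  change x ∈ LinearMap.range (totalDiff P.complex)
  rw [← DirectSum.sum_support_of x]
  refine Submodule.sum_mem _ fun n _ => ?_
  have : ∃ y, resD P n y = totalProj P n x := by
    rcases n with _ | n
    · exact exists_resD_eq_of_resAug P hx'
    · refine exists_resD_eq P ?_
      rw [← totalProj_totalDiff, hx, map_zero]
  obtain ⟨y, hy⟩ := this
  refine ⟨totalIncl P (n + 1) y, ?_⟩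
  rw [totalDiff_totalIncl_succ, hy]
  rfl

theorem augmentationHom_isQuasiIso (hδ : X.δ = totalDiff P.complex)
    (hone : totalAugmentation P (X.b X.one) = (1 : R)) :
    (augmentationHom h𝒜 hF hsq hδ hone).IsQuasiIso := by
  have hdiff : (h𝒜.algebra hF hsq).diff = totalDiff P.complex := by rw [h𝒜.algebra_diff, hδ]
  have hdiffR : ∀ r, (AInfinityAlgebra.ofAlgebra Q R).diff r = 0 := fun r => by
    rw [AInfinityAlgebra.diff_apply]
    simp [AInfinityAlgebra.ofAlgebra]
  constructor
  · refine (injective_iff_map_eq_zero _).2 fun c hc => ?_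
    obtain ⟨⟨x, hx⟩, rfl⟩ := Submodule.Quotient.mk_surjective _ c
    rw [LinearMap.mem_ker, hdiff] at hx
    obtain ⟨r, hr⟩ := (Submodule.Quotient.mk_eq_zero _).1 hc
    rw [hdiffR] at hr
    obtain ⟨y, hy⟩ := exists_totalDiff_eq hx hr.symm
    refine (Submodule.Quotient.mk_eq_zero _).2 ⟨y, ?_⟩
    exact (LinearMap.congr_fun hdiff y).trans hy
  · intro c
    obtain ⟨⟨r, hr⟩, rfl⟩ := Submodule.Quotient.mk_surjective _ c
    obtain ⟨x, rfl⟩ := resAug_surjective P r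
    have hx : (h𝒜.algebra hF hsq).diff (totalIncl P 0 x) = 0 := by
      rw [hdiff, totalDiff_totalIncl_zero]
    refine ⟨Submodule.Quotient.mk ⟨totalIncl P 0 x, hx⟩, ?_⟩
    refine congrArg Submodule.Quotient.mk (Subtype.ext ?_)
    exact congrArg (resAug P) (totalProj_totalIncl_self P 0 x)

end Augmentation

end CyclicResolution

end

theorem mainTheorem10 (Q : Type u) [CommRing Q] [IsLocalRing Q] [IsNoetherianRing Q]
    (R : Type u) [CommRing R] [IsLocalRing R] [Algebra Q R]
    (K : Subring Q) (hK : IsField K) (hK0 : CharZero K)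
    (d : ℕ) (hd : Odd d) (hR : IsSurjectiveGorenstein Q R d)
    (P : ProjectiveResolution (ModuleCat.of Q R)) (hP : IsMinimalFreeResolution P) :
    ∃ (S : AInfinityAlgebra Q (totalGrading P.complex)) (one : totalModule P.complex)
      (B : totalModule P.complex →ₗ[Q] totalModule P.complex →ₗ[Q] Q)
      (f : S.StrictHom (AInfinityAlgebra.ofAlgebra Q R)),
      S.diff = totalDiff P.complex ∧
      S.IsSplitUnit one ∧
      S.IsCyclic d B ∧
      f.toLinearMap = totalAugmentation P ∧
      f.toLinearMap one = 1 ∧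
      f.IsQuasiIso := by
  classical
  have hQ := CyclicResolution.isUnit_natCast_of_subfield hK hK0
  obtain ⟨E, _, X, rfl, hδ, hone, hdeg⟩ :=
    CyclicResolution.exists_pairedComplex hd hR hP (by exact_mod_cast hQ 2 two_ne_zero)
  have h𝒜 := CyclicResolution.isGrading_totalGrading hdeg
  obtain ⟨F, hF, hsq⟩ := X.exists_isUnitalForm hQ
  exact ⟨h𝒜.algebra hF hsq, X.b X.one, X.pairing,
    CyclicResolution.augmentationHom h𝒜 hF hsq hδ hone, by rw [h𝒜.algebra_diff, hδ],
    h𝒜.isSplitUnit hF hsq, h𝒜.isCyclic hF hsq, rfl, hone,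
    CyclicResolution.augmentationHom_isQuasiIso h𝒜 hF hsq hδ hone⟩
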